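/- Let $\delta\ge 1$ be an integer, $\tau=\tau_1+i\tau_2$ with $\tau_2>0$, and $M=V/\Lambda$ with $V=\mathbb C$ (coordinate $z=z_1+iz_2$) and $\Lambda=\mathbb Z\{\delta,\tau\}$. Let $dx_1,dx_2$ be the real forms on $V$ dual to $\delta,\tau$. Let $L_0\to M$ be the holomorphic line bundle with multipliers $e_\delta\equiv1$, $e_\tau(z)=e^{-2\pi iz-\pi i\tau}$, so that its sections are the functions with $\theta(z+\lambda)=e_\lambda(z)\theta(z)$, and give it the metric $h_{L_0}(z)=e^{-2\pi z_2^2/\tau_2}$. Let $\widehat M=\mathrm{Pic}^0(M)=\mathbb C/\mathbb Z\{1,\tau/\delta\}$, where $\hat\mu=\hat\mu_1+i\hat\mu_2$ stands for the $(0,1)$-form $\sigma\,d\bar z=\hat\mu\cdot\frac{-i}{2\tau_2}d\bar z$, that is, for the line bundle $\mathrm P_{\hat\mu}$ with multipliers $e^{2\pi i\sigma\delta},e^{2\pi i\sigma\bar\tau}$, and let $\varphi_{L_0}:M\to\widehat M$ send $x$ to the class of $T_x^*L_0\otimes L_0^*$, where $T_x$ is the translation by $x$. Let $V^*=\{\xi=\xi_1dx_1+\xi_2dx_2:\xi_1,\xi_2\in\mathbb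 R\}$, $M^*=V^*/2\pi\Lambda^*$ with $\Lambda^*=\mathbb Z\{dx_1,dx_2\}$, and let $\mathcal P\to M\times M^*$ be the quotient of the trivial line bundle over $M\times V^*$ by the action $2\pi\nu\circ(x,\xi,\sigma)=(x,\xi+2\pi\nu,e^{-2\pi i\langle\nu,x\rangle}\sigma)$, with the connection $d+i\xi$ and the metric $h_{\mathcal P}$ induced by the constant metric $1$. Let $Iso:\widehat M\to M^*$ be given by $\xi_1=\frac{2\pi\delta}{\tau_2}\hat\mu_2$, $\xi_2=\frac{2\pi}{\tau_2}(\tau_1\hat\mu_2-\tau_2\hat\mu_1)$. Let $\mathrm P=(Id\times Iso)^*\mathcal P\to M\times\widehat M$, with the holomorphic structure given by the $(0,1)$-part of the pulled-back connection, and $h_{\mathrm P}=(Id\times Iso)^*h_{\mathcal P}$. Then $\mathrm P$ is the Poincaré line bundle: it is a holomorphic line bundle, $\mathrm P|_{M\times\{[\hat\mu]\}}\cong\mathrm P_{\hat\mu}$ for all $\hat\mu$, and $\mathrm P|_{\{0\}\times\widehat M}$ is holomorphically trivial. Moreover $(Id\times\varphi_{L_0})^*\mathrm P\to M\times M$ (coordinates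 $(z,\mu)$ on $V\times V$, $\mu=\mu_1+i\mu_2$) is isomorphic to the holomorphic line bundle $J$ with multipliers $e_{(\delta,0)}=e_{(0,\delta)}=1$, $e_{(\tau,0)}=e^{-2\pi i\mu}$, $e_{(0,\tau)}=e^{-2\pi iz}$, by an isomorphism $\Psi$ that respects the canonical trivializations of both bundles over $\{0\}\times M$. For any such $\Psi$, let $h_{(Id\times\varphi_{L_0})^*\mathrm P}$ be the metric that corresponds under $\Psi$ to the metric $e^{-4\pi z_2\mu_2/\tau_2}$ on $J$. With $\pi_1,\pi_2$ the two projections, put $$\widetilde E=\pi_1^*L_0\otimes\mathrm P\to M\times\widehat M,\quad h_{\widetilde E}=\pi_1^*h_{L_0}\otimes h_{\mathrm P},\qquad \widetilde E'=\pi_1^*L_0\otimes(Id\times\varphi_{L_0})^*\mathrm P\to M\times M,\quad h_{\widetilde E'}=\pi_1^*h_{L_0}\otimes h_{(Id\times\varphi_{L_0})^*\mathrm P},$$ $E=(\pi_2)_*\widetilde E\to\widehat M$ and $E'=(\pi_2)_*\widetilde E'\to M$, with fibres the spaces of global holomorphic sections of $\widetilde E|_{M\times\{q\}}$ and $\widetilde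 E'|_{M\times\{y\}}$, and let $h_E$, $h_{E'}$ be the $L^2$ metrics $\int_M h_{\widetilde E}(s,t)\,\frac i2dz\wedge d\bar z$ and $\int_M h_{\widetilde E'}(s,t)\,\frac i2dz\wedge d\bar z$. Then $\widetilde E,\widetilde E'$ are Hermitian holomorphic line bundles, $E,E'$ are Hermitian holomorphic vector bundles of rank $\delta$, and: (1) as Hermitian holomorphic line bundles, $(\widetilde E',h_{\widetilde E'})=(Id\times\varphi_{L_0})^*(\widetilde E,h_{\widetilde E})$ (by the identity on the fibres); (2) consequently $(E',h_{E'})=\varphi_{L_0}^*(E,h_E)$ as Hermitian holomorphic vector bundles (by the identity on the sections over $M\times\{y\}$); (3) under the identification in (2), the curvatures of the Chern connections, as endomorphism-valued $2$-forms, satisfy $\Theta(E',h_{E'})=\varphi_{L_0}^*\Theta(E,h_E)$; the differential of $\varphi_{L_0}$ used in this pull-back is a complex linear map $V\to\mathbb C$ that lifts $\varphi_{L_0}$. -/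

import Mathlib

open scoped TensorProduct Topology UpperHalfPlane ContDiff Matrix
open MeasureTheory

noncomputable section

namespace ThetaTorus

/-! ### Holomorphic vector bundles over quotients of complex vector spaces

A complex torus `X = W / Γ` (or a product of such) is presented by its universal covering map
`p : W → X`.  A function on `X` is holomorphic near `x` iff its pull-back to `W` is complex
differentiable near every point over `x`, and the tangent spaces of `X` are identified with `W`
through `p`. -/

/-- `f : X → ℂ` is holomorphic in a neighbourhood of `x`. -/
def HolFunAt {W X : Type} [NormedAddCommGroup W] [NormedSpace ℂ W] (p : W → X) (x : X)
    (f : X → ℂ) : Prop :=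
  ∀ w, p w = x → ∀ᶠ w' in 𝓝 w, DifferentiableAt ℂ (fun v => f (p v)) w'

theorem HolFunAt.add {W X : Type} [NormedAddCommGroup W] [NormedSpace ℂ W] {p : W → X} {x : X}
    {f g : X → ℂ} (hf : HolFunAt p x f) (hg : HolFunAt p x g) :
    HolFunAt p x (fun y => f y + g y) := fun w hw => by
  filter_upwards [hf w hw, hg w hw] with v h1 h2 using h1.add h2

theorem HolFunAt.const_mul {W X : Type} [NormedAddCommGroup W] [NormedSpace ℂ W] {p : W → X}
    {x : X} {f : X → ℂ} (c : ℂ) (hf : HolFunAt p x f) : HolFunAt p x (fun y => c * f y) :=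
  fun w hw => by filter_upwards [hf w hw] with v h1 using h1.const_mul c

theorem HolFunAt.const {W X : Type} [NormedAddCommGroup W] [NormedSpace ℂ W] {p : W → X}
    {x : X} (c : ℂ) : HolFunAt p x (fun _ => c) :=
  fun _ _ => Filter.Eventually.of_forall fun _ => differentiableAt_const c

/-- A family of complex vector spaces over `X` with, for every `x`, the space `hol x` of all
sections that are holomorphic in a neighbourhood of `x`.  Local triviality is the separate predicate
`IsHolBundle`. -/
structure HolBundle {W X : Type} [NormedAddCommGroup W] [NormedSpace ℂ W] [TopologicalSpace X]
    (p : W → X) : Type 1 where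
  Fib : X → Type
  [acg : ∀ x, AddCommGroup (Fib x)]
  [mod : ∀ x, Module ℂ (Fib x)]
  hol : X → Submodule ℂ (∀ x, Fib x)

attribute [instance] HolBundle.acg HolBundle.mod

/-- `e` is a local holomorphic frame near `x`: a basis of the fibres near `x`, such that the
holomorphic sections near `x` are exactly the combinations of the `e i` with holomorphic
coefficients. -/
structure IsFrame {W X : Type} [NormedAddCommGroup W] [NormedSpace ℂ W] [TopologicalSpace X]
    {p : W → X} (E : HolBundle p) (x : X) {r : ℕ} (e : Fin r → ∀ y, E.Fib y) : Prop where
  basis : ∀ᶠ y in 𝓝 x, LinearIndependent ℂ (fun i => e i y) ∧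
    Submodule.span ℂ (Set.range fun i => e i y) = ⊤
  hol : ∀ᶠ y in 𝓝 x, ∀ s : ∀ y, E.Fib y, s ∈ E.hol y ↔
    ∃ c : Fin r → X → ℂ, (∀ i, HolFunAt p y (c i)) ∧
      ∀ᶠ y' in 𝓝 y, s y' = ∑ i, c i y' • e i y'

/-- `E` is a holomorphic vector bundle of rank `r`. -/
def IsHolBundle {W X : Type} [NormedAddCommGroup W] [NormedSpace ℂ W] [TopologicalSpace X]
    {p : W → X} (E : HolBundle p) (r : ℕ) : Prop :=
  ∀ x, ∃ e : Fin r → ∀ y, E.Fib y, IsFrame E x e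

/-- `h` is a smooth Hermitian metric on `E` (linear in the first variable). -/
structure IsHermMetric {W X : Type} [NormedAddCommGroup W] [NormedSpace ℂ W] [TopologicalSpace X]
    {p : W → X} (E : HolBundle p) (h : ∀ x, E.Fib x → E.Fib x → ℂ) : Prop where
  add_left : ∀ x u v w, h x (u + v) w = h x u w + h x v w
  smul_left : ∀ x (c : ℂ) u w, h x (c • u) w = c * h x u w
  conj_symm : ∀ x u v, h x v u = (starRingEnd ℂ) (h x u v)
  pos : ∀ x u, u ≠ 0 → 0 < (h x u u).re
  smooth : ∀ x, ∀ s ∈ E.hol x, ∀ t ∈ E.hol x, ∀ w, p w = x →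
    ContDiffAt ℝ ∞ (fun v => h (p v) (s (p v)) (t (p v))) w

/-- An isomorphism of holomorphic bundles over `X` (covering the identity). -/
structure HolIso {W X : Type} [NormedAddCommGroup W] [NormedSpace ℂ W] [TopologicalSpace X]
    {p : W → X} (E F : HolBundle p) where
  toEquiv : ∀ x, E.Fib x ≃ₗ[ℂ] F.Fib x
  hol_iff : ∀ x (s : ∀ y, E.Fib y), s ∈ E.hol x ↔ (fun y => toEquiv y (s y)) ∈ F.hol x

/-- The isomorphism `F` is isometric for the metrics `h` and `h'`. -/
def HolIso.IsIsometry {W X : Type} [NormedAddCommGroup W] [NormedSpace ℂ W] [TopologicalSpace X]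
    {p : W → X} {E E' : HolBundle p} (F : HolIso E E') (h : ∀ x, E.Fib x → E.Fib x → ℂ)
    (h' : ∀ x, E'.Fib x → E'.Fib x → ℂ) : Prop :=
  ∀ x u v, h' x (F.toEquiv x u) (F.toEquiv x v) = h x u v

/-- The trivial line bundle. -/
def trivialBundle {W X : Type} [NormedAddCommGroup W] [NormedSpace ℂ W] [TopologicalSpace X]
    (p : W → X) : HolBundle p where
  Fib _ := ℂ
  hol x :=
    { carrier := {s | HolFunAt p x s}
      add_mem' := fun hf hg => hf.add hg
      zero_mem' := HolFunAt.const 0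
      smul_mem' := fun c _ hf => hf.const_mul c }

/-- The pull-back `g^* E` along `g : X' → X`; its holomorphic sections are locally the finite sums
of `c • (e ∘ g)` with `c` and `e` holomorphic. -/
def pullback {W X W' X' : Type} [NormedAddCommGroup W] [NormedSpace ℂ W] [TopologicalSpace X]
    [NormedAddCommGroup W'] [NormedSpace ℂ W'] [TopologicalSpace X'] {p : W → X} (p' : W' → X')
    (g : X' → X) (E : HolBundle p) : HolBundle p' where
  Fib y := E.Fib (g y)
  hol y := Submodule.span ℂ {s | ∃ c : X' → ℂ, HolFunAt p' y c ∧ ∃ e ∈ E.hol (g y),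
    ∀ᶠ y' in 𝓝 y, s y' = c y' • e (g y')}

/-- The tensor product `E ⊗ F`; its holomorphic sections are locally the finite sums of `e ⊗ f`
with `e` and `f` holomorphic. -/
def tensor {W X : Type} [NormedAddCommGroup W] [NormedSpace ℂ W] [TopologicalSpace X]
    {p : W → X} (E F : HolBundle p) : HolBundle p where
  Fib x := E.Fib x ⊗[ℂ] F.Fib x
  hol x := Submodule.span ℂ {s | ∃ e ∈ E.hol x, ∃ f ∈ F.hol x,
    ∀ᶠ y in 𝓝 x, s y = e y ⊗ₜ[ℂ] f y}

/-- The dual bundle `E^*`. -/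
def dual {W X : Type} [NormedAddCommGroup W] [NormedSpace ℂ W] [TopologicalSpace X]
    {p : W → X} (E : HolBundle p) : HolBundle p where
  Fib x := Module.Dual ℂ (E.Fib x)
  hol x :=
    { carrier := {l | ∀ s ∈ E.hol x, HolFunAt p x (fun y => l y (s y))}
      add_mem' := fun hf hg s hs => (hf s hs).add (hg s hs)
      zero_mem' := fun _ _ => HolFunAt.const 0
      smul_mem' := fun c _ hf s hs => (hf s hs).const_mul c }

/-- Sesquilinear forms, linear in the first and conjugate linear in the second variable. -/
abbrev Sesq (V : Type) [AddCommGroup V] [Module ℂ V] : Type := V →ₗ[ℂ] V →ₗ⋆[ℂ] ℂ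

/-- The form with `(a ⊗ b, a' ⊗ b') ↦ B (a, a') * C (b, b')`. -/
def tensorSesq {V U : Type} [AddCommGroup V] [Module ℂ V] [AddCommGroup U] [Module ℂ U]
    (B : Sesq V) (C : Sesq U) : Sesq (V ⊗[ℂ] U) :=
  TensorProduct.lift <| LinearMap.mk₂ ℂ
    (fun a b => TensorProduct.lift <|
      LinearMap.mk₂'ₛₗ (starRingEnd ℂ) (starRingEnd ℂ) (fun a' b' => B a a' * C b b')
        (by intros; simp [add_mul]) (by intros; simp [mul_assoc])
        (by intros; simp [mul_add]) (by intros; simp [mul_left_comm]))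
    (by intros; ext; simp [add_mul]) (by intros; ext; simp [mul_assoc])
    (by intros; ext; simp [mul_add]) (by intros; ext; simp [mul_left_comm])

theorem tensorSesq_tmul {V U : Type} [AddCommGroup V] [Module ℂ V] [AddCommGroup U] [Module ℂ U]
    (B : Sesq V) (C : Sesq U) (a a' : V) (b b' : U) :
    tensorSesq B C (a ⊗ₜ b) (a' ⊗ₜ b') = B a a' * C b b' := rfl

/-- The push-forward of `E → X₁ × X₂` under the second projection: the fibre at `y` is the space
`H⁰(X₁, E|_{X₁ × {y}})` of global holomorphic sections, and a family of such sections is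
holomorphic near `y` iff it is holomorphic as a section of `E` near `X₁ × {y}`. -/
def pushforward {W₁ X₁ W₂ X₂ : Type} [NormedAddCommGroup W₁] [NormedSpace ℂ W₁]
    [TopologicalSpace X₁] [NormedAddCommGroup W₂] [NormedSpace ℂ W₂] [TopologicalSpace X₂]
    (p₁ : W₁ → X₁) (p₂ : W₂ → X₂) (E : HolBundle (Prod.map p₁ p₂)) : HolBundle p₂ where
  Fib y := (⨅ x, (pullback p₁ (fun x => (x, y)) E).hol x :
    Submodule ℂ (∀ x, (pullback p₁ (fun x => (x, y)) E).Fib x))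
  hol y :=
    { carrier := {s | ∀ x, (fun q : X₁ × X₂ => ((s q.2).1 q.1 : E.Fib q)) ∈ E.hol (x, y)}
      add_mem' := fun hf hg x => (E.hol (x, y)).add_mem (hf x) (hg x)
      zero_mem' := fun x => (E.hol (x, y)).zero_mem
      smul_mem' := fun c _ hf x => (E.hol (x, y)).smul_mem c (hf x) }

/-- The `L²` metric on the push-forward, `(s, t) = ∫_D h(s, t)`, where `D ⊆ W₁` is a fundamental
domain of `p₁`. -/
def l2Metric {W₁ X₁ W₂ X₂ : Type} [NormedAddCommGroup W₁] [NormedSpace ℂ W₁] [MeasureSpace W₁]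
    [TopologicalSpace X₁] [NormedAddCommGroup W₂] [NormedSpace ℂ W₂] [TopologicalSpace X₂]
    (p₁ : W₁ → X₁) (p₂ : W₂ → X₂) (E : HolBundle (Prod.map p₁ p₂)) (D : Set W₁)
    (h : ∀ x, E.Fib x → E.Fib x → ℂ) (y : X₂) (s t : (pushforward p₁ p₂ E).Fib y) : ℂ :=
  ∫ z in D, h (p₁ z, y) (s.1 (p₁ z)) (t.1 (p₁ z))

/-! ### Curvature of the Chern connection -/

/-- `(∂f)(v)` at the point `w`. -/
def del {W : Type} [NormedAddCommGroup W] [NormedSpace ℂ W] (f : W → ℂ) (v w : W) : ℂ :=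
  (fderiv ℝ f w v - Complex.I * fderiv ℝ f w (Complex.I • v)) / 2

/-- `(∂̄f)(v)` at the point `w`. -/
def delbar {W : Type} [NormedAddCommGroup W] [NormedSpace ℂ W] (f : W → ℂ) (v w : W) : ℂ :=
  (fderiv ℝ f w v + Complex.I * fderiv ℝ f w (Complex.I • v)) / 2

/-- The Gram matrix `H = (h(e_j, e_k))` of a frame, as a function on `W`. -/
def gram {W X : Type} [NormedAddCommGroup W] [NormedSpace ℂ W] [TopologicalSpace X]
    {p : W → X} {E : HolBundle p} (h : ∀ x, E.Fib x → E.Fib x → ℂ) {r : ℕ}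
    (e : Fin r → ∀ y, E.Fib y) (w : W) : Matrix (Fin r) (Fin r) ℂ :=
  Matrix.of fun j k => h (p w) (e j (p w)) (e k (p w))

/-- The connection matrix `(∂H · H⁻¹)(v)` of the Chern connection, `∇ e_j = ∑ₗ θ_{jl} e_l`. -/
def connMatrix {W X : Type} [NormedAddCommGroup W] [NormedSpace ℂ W] [TopologicalSpace X]
    {p : W → X} {E : HolBundle p} (h : ∀ x, E.Fib x → E.Fib x → ℂ) {r : ℕ}
    (e : Fin r → ∀ y, E.Fib y) (v w : W) : Matrix (Fin r) (Fin r) ℂ :=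
  (Matrix.of fun j k => del (fun u => gram h e u j k) v w) * (gram h e w)⁻¹

/-- The curvature matrix `∂̄(∂H · H⁻¹)(v, v')`. -/
def curvMatrix {W X : Type} [NormedAddCommGroup W] [NormedSpace ℂ W] [TopologicalSpace X]
    {p : W → X} {E : HolBundle p} (h : ∀ x, E.Fib x → E.Fib x → ℂ) {r : ℕ}
    (e : Fin r → ∀ y, E.Fib y) (v v' w : W) : Matrix (Fin r) (Fin r) ℂ :=
  Matrix.of fun j l => delbar (fun u => connMatrix h e v' u j l) v w
    - delbar (fun u => connMatrix h e v u j l) v' w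

/-- The curvature `Θ(E, h)`, an `End(E)`-valued 2-form on `X`: `curvature h x v v'` is the
endomorphism of the fibre at `x` whose matrix in every local holomorphic frame near `x` is the
curvature matrix at `(v, v')`. -/
def curvature {W X : Type} [NormedAddCommGroup W] [NormedSpace ℂ W] [TopologicalSpace X]
    {p : W → X} {E : HolBundle p} (h : ∀ x, E.Fib x → E.Fib x → ℂ) (x : X) (v v' : W) :
    E.Fib x →ₗ[ℂ] E.Fib x :=
  Classical.epsilon fun R => ∀ (r : ℕ) (e : Fin r → ∀ y, E.Fib y) (w : W), p w = x →
    IsFrame E x e → ∀ j, R (e j x) = ∑ l, curvMatrix h e v v' w j l • e l x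

/-! ### Line bundles given by multipliers -/

/-- The fibre at `x` of the line bundle with multipliers `e i` for the generators `gen i` of the
lattice: functions `s` on the preimage of `x` with `s (w + gen i) = e i w * s w`. -/
def multFib {W X ι : Type} [AddCommGroup W] (p : W → X) (gen : ι → W) (e : ι → W → ℂ) (x : X) :
    Submodule ℂ ({w : W // p w = x} → ℂ) where
  carrier := {s | ∀ i (w w' : {w : W // p w = x}), w'.1 = w.1 + gen i → s w' = e i w.1 * s w}
  add_mem' := fun hs ht i w w' hw => by
    simp only [Pi.add_apply, hs i w w' hw, ht i w w' hw, mul_add]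
  zero_mem' := fun i w w' _ => by simp
  smul_mem' := fun c s hs i w w' hw => by
    simp only [Pi.smul_apply, hs i w w' hw, smul_eq_mul, mul_left_comm]

/-- The line bundle with holomorphic multipliers `e i`.  A section is a quasi-periodic function on
`W`, and it is holomorphic iff this function is. -/
def multBundle {W X ι : Type} [NormedAddCommGroup W] [NormedSpace ℂ W] [TopologicalSpace X]
    (p : W → X) (gen : ι → W) (e : ι → W → ℂ) : HolBundle p where
  Fib x := multFib p gen e x
  hol x :=
    { carrier := {s | ∀ w, p w = x →
        ∀ᶠ w' in 𝓝 w, DifferentiableAt ℂ (fun v => (s (p v)).1 ⟨v, rfl⟩) w'}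
      add_mem' := fun hs ht w hw => by
        filter_upwards [hs w hw, ht w hw] with v h1 h2 using h1.add h2
      zero_mem' := fun _ _ => Filter.Eventually.of_forall fun _ => differentiableAt_const 0
      smul_mem' := fun c _ hs w hw => by
        filter_upwards [hs w hw] with v h1 using h1.const_mul c }

/-- The metric `(s, t) = k(w) s(w) conj (t(w))` on a line bundle given by multipliers, where `w`
lies over `x`; for `k` with `k (w + gen i) * |e i w|² = k w` the choice of `w` does not matter. -/
def multMetric {W X ι : Type} [AddCommGroup W] {p : W → X} (hp : Function.Surjective p)
    (gen : ι → W) (e : ι → W → ℂ) (k : W → ℝ) (x : X) : Sesq (multFib p gen e x) :=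
  LinearMap.mk₂'ₛₗ (RingHom.id ℂ) (starRingEnd ℂ)
    (fun s t => (k (Function.surjInv hp x) : ℂ) *
      (s.1 ⟨_, Function.surjInv_eq hp x⟩ * (starRingEnd ℂ) (t.1 ⟨_, Function.surjInv_eq hp x⟩)))
    (by intros; simp [add_mul, mul_add]) (by intros; simp; ring)
    (by intros; simp [mul_add]) (by intros; simp; ring)

/-! ### The torus `M`, its dual `M̂`, and the real dual torus `M^*` -/

/-- The lattice `Λ = ℤ{δ, τ}` in the coordinate `z`. -/
def lat (δ : ℕ+) (τ : ℍ) : AddSubgroup ℂ := AddSubgroup.closure {((δ : ℕ) : ℂ), (τ : ℂ)}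

/-- The lattice `Λ̄^* = ℤ{1, τ/δ}` in the coordinate `μ̂` of the space of `(0,1)`-forms
`μ̂ · (-i/(2τ₂)) dz̄`. -/
def latHat (δ : ℕ+) (τ : ℍ) : AddSubgroup ℂ :=
  AddSubgroup.closure {1, (τ : ℂ) / ((δ : ℕ) : ℂ)}

/-- The lattice `2πΛ^*` in the coordinates `ξ = ξ₁ dx₁ + ξ₂ dx₂`. -/
def latStar : AddSubgroup (ℝ × ℝ) :=
  AddSubgroup.closure {(2 * Real.pi, 0), (0, 2 * Real.pi)}

abbrev M (δ : ℕ+) (τ : ℍ) : Type := ℂ ⧸ lat δ τ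

abbrev Mhat (δ : ℕ+) (τ : ℍ) : Type := ℂ ⧸ latHat δ τ

abbrev Mstar : Type := (ℝ × ℝ) ⧸ latStar

def pM (δ : ℕ+) (τ : ℍ) : ℂ → M δ τ := fun z => (z : ℂ ⧸ lat δ τ)

def pMhat (δ : ℕ+) (τ : ℍ) : ℂ → Mhat δ τ := fun z => (z : ℂ ⧸ latHat δ τ)

def pMstar : ℝ × ℝ → Mstar := fun ξ => (ξ : (ℝ × ℝ) ⧸ latStar)

theorem pM_surj (δ : ℕ+) (τ : ℍ) : Function.Surjective (pM δ τ) := QuotientAddGroup.mk_surjective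

theorem pMstar_surj : Function.Surjective pMstar := QuotientAddGroup.mk_surjective

/-- The fundamental parallelogram of `Λ`. -/
def fundPar (δ : ℕ+) (τ : ℍ) : Set ℂ :=
  {z | ∃ a ∈ Set.Ico (0 : ℝ) 1, ∃ b ∈ Set.Ico (0 : ℝ) 1, z = a * ((δ : ℕ) : ℂ) + b * (τ : ℂ)}

/-- The real coordinate `x₁` on `V`, dual to the basis `δ, τ` of `Λ`. -/
def x₁ (δ : ℕ+) (τ : ℍ) (z : ℂ) : ℝ := (z.re - τ.re * z.im / τ.im) / (δ : ℕ)

/-- The real coordinate `x₂` on `V`, dual to the basis `δ, τ` of `Λ`. -/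
def x₂ (τ : ℍ) (z : ℂ) : ℝ := z.im / τ.im

/-! ### The line bundle `L₀`, the bundles `P_μ̂`, and the map `φ_{L₀}` -/

def genM (δ : ℕ+) (τ : ℍ) : Fin 2 → ℂ := ![((δ : ℕ) : ℂ), (τ : ℂ)]

def multL₀ (τ : ℍ) : Fin 2 → ℂ → ℂ :=
  ![fun _ => 1, fun z => Complex.exp (-2 * Real.pi * Complex.I * z - Real.pi * Complex.I * τ)]

def L₀ (δ : ℕ+) (τ : ℍ) : HolBundle (pM δ τ) := multBundle (pM δ τ) (genM δ τ) (multL₀ τ)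

/-- The metric `exp(-2π z₂² / τ₂)` on `L₀`. -/
def hL₀ (δ : ℕ+) (τ : ℍ) (x : M δ τ) : Sesq ((L₀ δ τ).Fib x) :=
  multMetric (pM_surj δ τ) (genM δ τ) (multL₀ τ)
    (fun z => Real.exp (-2 * Real.pi / τ.im * z.im ^ 2)) x

/-- The degree-zero line bundle on `M` that corresponds to the `(0,1)`-form
`σ dz̄ = μ̂ · (-i/(2τ₂)) dz̄`: its multipliers are `exp(2πi σ δ)` and `exp(2πi σ τ̄)`. -/
def picBundle (δ : ℕ+) (τ : ℍ) (μh : ℂ) : HolBundle (pM δ τ) :=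
  multBundle (pM δ τ) (genM δ τ)
    ![fun _ => Complex.exp (2 * Real.pi * Complex.I * (μh * (-Complex.I / (2 * τ.im))) * (δ : ℕ)),
      fun _ => Complex.exp (2 * Real.pi * Complex.I * (μh * (-Complex.I / (2 * τ.im))) *
        (starRingEnd ℂ) (τ : ℂ))]

/-- `φ_{L₀} : M → M̂ = Pic⁰(M)`, the map that sends `x` to the class of `T_x^* L₀ ⊗ L₀^*`, where
`T_x` is the translation by `x`. -/
def φL₀ (δ : ℕ+) (τ : ℍ) (x : M δ τ) : Mhat δ τ :=
  Classical.epsilon fun q => ∃ μh : ℂ, pMhat δ τ μh = q ∧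
    Nonempty (HolIso (picBundle δ τ μh)
      (tensor (pullback (pM δ τ) (fun y => y + x) (L₀ δ τ)) (dual (L₀ δ τ))))

/-- `Id × φ_{L₀} : M × M → M × M̂`. -/
def IdPhi (δ : ℕ+) (τ : ℍ) : M δ τ × M δ τ → M δ τ × Mhat δ τ := Prod.map id (φL₀ δ τ)

/-! ### The bundle `𝒫 → M × M^*` with its metric and connection -/

abbrev pMM (δ : ℕ+) (τ : ℍ) : ℂ × ℂ → M δ τ × M δ τ := Prod.map (pM δ τ) (pM δ τ)

abbrev pMMhat (δ : ℕ+) (τ : ℍ) : ℂ × ℂ → M δ τ × Mhat δ τ := Prod.map (pM δ τ) (pMhat δ τ)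

abbrev pMMstar (δ : ℕ+) (τ : ℍ) : ℂ × (ℝ × ℝ) → M δ τ × Mstar := Prod.map (pM δ τ) pMstar

def genMMstar (δ : ℕ+) (τ : ℍ) : Fin 4 → ℂ × (ℝ × ℝ) :=
  ![(((δ : ℕ) : ℂ), 0), ((τ : ℂ), 0), (0, (2 * Real.pi, 0)), (0, (0, 2 * Real.pi))]

/-- The action `2πν ∘ (x, ξ, σ) = (x, ξ + 2πν, exp(-2πi⟨ν, x⟩) σ)` for `ν = dx₁, dx₂`. -/
def multMMstar (δ : ℕ+) (τ : ℍ) : Fin 4 → ℂ × (ℝ × ℝ) → ℂ :=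
  ![fun _ => 1, fun _ => 1, fun w => Complex.exp (-2 * Real.pi * Complex.I * x₁ δ τ w.1),
    fun w => Complex.exp (-2 * Real.pi * Complex.I * x₂ τ w.1)]

/-- The fibres of `𝒫`, the quotient of the trivial line bundle over `M × V^*` by `2πΛ^*`. -/
abbrev PcalFib (δ : ℕ+) (τ : ℍ) (y : M δ τ × Mstar) :
    Submodule ℂ ({w : ℂ × (ℝ × ℝ) // pMMstar δ τ w = y} → ℂ) :=
  multFib (pMMstar δ τ) (genMMstar δ τ) (multMMstar δ τ) y

/-- The metric on `𝒫` induced from the constant metric `1`. -/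
def hPcal (δ : ℕ+) (τ : ℍ) (y : M δ τ × Mstar) : Sesq (PcalFib δ τ y) :=
  multMetric ((pM_surj δ τ).prodMap pMstar_surj) (genMMstar δ τ) (multMMstar δ τ) (fun _ => 1) y

/-- The connection form `iξ = i (ξ₁ dx₁ + ξ₂ dx₂)` at `w = (z, ξ)`, evaluated on a tangent vector
with first component `v`. -/
def connPcal (δ : ℕ+) (τ : ℍ) (w : ℂ × (ℝ × ℝ)) (v : ℂ) : ℂ :=
  Complex.I * (w.2.1 * x₁ δ τ v + w.2.2 * x₂ τ v)

/-! ### The Poincaré line bundle -/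

/-- The linear map that induces `Iso : M̂ → M^*`. -/
def isoLift (δ : ℕ+) (τ : ℍ) : ℂ →+ ℝ × ℝ where
  toFun μh := (2 * Real.pi * (δ : ℕ) / τ.im * μh.im,
    2 * Real.pi / τ.im * (τ.re * μh.im - τ.im * μh.re))
  map_zero' := by simp
  map_add' := fun a b => by
    ext
    · simp; ring
    · simp; ring

theorem isoLift_le (δ : ℕ+) (τ : ℍ) : latHat δ τ ≤ latStar.comap (isoLift δ τ) := by
  have hτ : τ.im ≠ 0 := τ.im_ne_zero
  have hδ : ((δ : ℕ) : ℝ) ≠ 0 := by exact_mod_cast δ.pos.ne'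
  refine (AddSubgroup.closure_le _).2 ?_
  rintro z (rfl | rfl)
  · have h : isoLift δ τ 1 = -(0, 2 * Real.pi) := by
      ext
      · simp [isoLift]
      · simp [isoLift]; field_simp
    show isoLift δ τ 1 ∈ latStar
    rw [h]
    exact latStar.neg_mem (AddSubgroup.subset_closure (by simp))
  · have h : isoLift δ τ ((τ : ℂ) / ((δ : ℕ) : ℂ)) = (2 * Real.pi, 0) := by
      ext
      · simp [isoLift]; field_simp
      · simp [isoLift]; right; ring
    show isoLift δ τ _ ∈ latStar
    rw [h]
    exact AddSubgroup.subset_closure (by simp)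

/-- `Iso : M̂ → M^*`, sending `dx_j^*` to `2π dx_j`. -/
def IsoMap (δ : ℕ+) (τ : ℍ) : Mhat δ τ →+ Mstar :=
  QuotientAddGroup.map (latHat δ τ) latStar (isoLift δ τ) (isoLift_le δ τ)

/-- `Id × Iso : M × M̂ → M × M^*`. -/
abbrev IdIso (δ : ℕ+) (τ : ℍ) : M δ τ × Mhat δ τ → M δ τ × Mstar :=
  Prod.map id (IsoMap δ τ)

/-- A section of `(Id × Iso)^* 𝒫` as a function on `V × V̂`. -/
def liftP (δ : ℕ+) (τ : ℍ) (s : ∀ y : M δ τ × Mhat δ τ, PcalFib δ τ (IdIso δ τ y))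
    (w : ℂ × ℂ) : ℂ :=
  (s (pMMhat δ τ w)).1 ⟨(w.1, isoLift δ τ w.2), rfl⟩

/-- The covariant derivative `∇_v` of (the function `u` of) a section of `(Id × Iso)^* 𝒫` at `w`,
for the pulled back connection. -/
def covP (δ : ℕ+) (τ : ℍ) (u : ℂ × ℂ → ℂ) (w v : ℂ × ℂ) : ℂ :=
  fderiv ℝ u w v + connPcal δ τ (w.1, isoLift δ τ w.2) v.1 * u w

/-- The Poincaré line bundle `P = (Id × Iso)^* 𝒫` over `M × M̂`; a section is holomorphic iff the
`(0,1)`-part of its covariant derivative vanishes, i.e. iff `v ↦ ∇_v u` is complex linear. -/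
def PBundle (δ : ℕ+) (τ : ℍ) : HolBundle (pMMhat δ τ) where
  Fib y := PcalFib δ τ (IdIso δ τ y)
  hol y :=
    { carrier := {s | ∀ w, pMMhat δ τ w = y → ∀ᶠ w' in 𝓝 w,
        DifferentiableAt ℝ (liftP δ τ s) w' ∧
        ∀ v : ℂ × ℂ, covP δ τ (liftP δ τ s) w' (Complex.I • v) =
          Complex.I * covP δ τ (liftP δ τ s) w' v}
      add_mem' := fun {s t} hs ht w hw => by
        filter_upwards [hs w hw, ht w hw] with w' h1 h2
        have e : liftP δ τ (s + t) = liftP δ τ s + liftP δ τ t := rfl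
        refine ⟨e ▸ h1.1.add h2.1, fun v => ?_⟩
        have h3 := h1.2 v
        have h4 := h2.2 v
        simp only [covP, e, fderiv_add h1.1 h2.1, add_apply,
          Pi.add_apply] at h3 h4 ⊢
        linear_combination h3 + h4
      zero_mem' := fun w hw => Filter.Eventually.of_forall fun w' => by
        have e : liftP δ τ 0 = fun _ => 0 := rfl
        simp [covP, e]
      smul_mem' := fun c {s} hs w hw => by
        filter_upwards [hs w hw] with w' h1
        have e : liftP δ τ (c • s) = c • liftP δ τ s := rfl
        refine ⟨e ▸ h1.1.const_smul c, fun v => ?_⟩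
        have h3 := h1.2 v
        simp only [covP, e, fderiv_const_smul h1.1, smul_apply,
          Pi.smul_apply, smul_eq_mul] at h3 ⊢
        linear_combination c * h3 }

/-- The metric `h_P = (Id × Iso)^* h_𝒫`. -/
def hP (δ : ℕ+) (τ : ℍ) (y : M δ τ × Mhat δ τ) : Sesq ((PBundle δ τ).Fib y) :=
  hPcal δ τ (IdIso δ τ y)

/-- The two properties that characterize the Poincaré line bundle: the restriction to `M × {[μ̂]}` is
the line bundle that corresponds to `[μ̂]`, and the restriction to `{0} × M̂` is trivial. -/
def IsPoincare (δ : ℕ+) (τ : ℍ) (P : HolBundle (pMMhat δ τ)) : Prop :=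
  IsHolBundle P 1 ∧
  (∀ μh : ℂ, Nonempty (HolIso (pullback (pM δ τ) (fun x => (x, pMhat δ τ μh)) P)
    (picBundle δ τ μh))) ∧
  Nonempty (HolIso (pullback (pMhat δ τ) (fun q => (pM δ τ 0, q)) P) (trivialBundle (pMhat δ τ)))

/-! ### The metric on `(Id × φ_{L₀})^* P` in the description by multipliers -/

def genMM (δ : ℕ+) (τ : ℍ) : Fin 4 → ℂ × ℂ :=
  ![(((δ : ℕ) : ℂ), 0), ((τ : ℂ), 0), (0, ((δ : ℕ) : ℂ)), (0, (τ : ℂ))]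

def multJ : Fin 4 → ℂ × ℂ → ℂ :=
  ![fun _ => 1, fun w => Complex.exp (-2 * Real.pi * Complex.I * w.2),
    fun _ => 1, fun w => Complex.exp (-2 * Real.pi * Complex.I * w.1)]

/-- The line bundle over `M × M` with multipliers `1, exp(-2πiμ), 1, exp(-2πiz)`. -/
def J (δ : ℕ+) (τ : ℍ) : HolBundle (pMM δ τ) := multBundle (pMM δ τ) (genMM δ τ) multJ

/-- The metric `exp(-4π z₂ μ₂ / τ₂)` on `J`. -/
def hJ (δ : ℕ+) (τ : ℍ) (y : M δ τ × M δ τ) : Sesq ((J δ τ).Fib y) :=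
  multMetric ((pM_surj δ τ).prodMap (pM_surj δ τ)) (genMM δ τ) multJ
    (fun w => Real.exp (-4 * Real.pi / τ.im * (w.1.im * w.2.im))) y

/-- `(Id × φ_{L₀})^* P`. -/
def phiP (δ : ℕ+) (τ : ℍ) : HolBundle (pMM δ τ) := pullback (pMM δ τ) (IdPhi δ τ) (PBundle δ τ)

/-- Over `{0} × M` the multipliers of `J`, and those of `𝒫` over `{0} × M^*`, trivialize the bundles
canonically.  The isomorphism `Ψ` is normalized if it respects these trivializations. -/
def IsNormalized (δ : ℕ+) (τ : ℍ) (Ψ : HolIso (J δ τ) (phiP δ τ)) : Prop :=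
  ∀ (μ : ℂ) (v : (J δ τ).Fib (pM δ τ 0, pM δ τ μ)) (ξ : ℝ × ℝ)
    (hξ : pMMstar δ τ (0, ξ) = IdIso δ τ (IdPhi δ τ (pM δ τ 0, pM δ τ μ))),
    Subtype.val (p := (· ∈ PcalFib δ τ (IdIso δ τ (IdPhi δ τ (pM δ τ 0, pM δ τ μ)))))
      (Ψ.toEquiv (pM δ τ 0, pM δ τ μ) v) ⟨(0, ξ), hξ⟩ = v.1 ⟨(0, μ), rfl⟩

/-- The metric on `(Id × φ_{L₀})^* P` that is given by `exp(-4π z₂ μ₂ / τ₂)` in the description by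
multipliers, that is, transported from `J` by `Ψ`. -/
def hPhiP (δ : ℕ+) (τ : ℍ) (Ψ : HolIso (J δ τ) (phiP δ τ)) (y : M δ τ × M δ τ) :
    Sesq ((phiP δ τ).Fib y) :=
  LinearMap.mk₂'ₛₗ (RingHom.id ℂ) (starRingEnd ℂ)
    (fun u v => hJ δ τ y ((Ψ.toEquiv y).symm u) ((Ψ.toEquiv y).symm v))
    (by intros; simp) (by intros; simp) (by intros; simp) (by intros; simp)

/-! ### The bundles `Ẽ`, `Ẽ'`, `E`, `E'` with their metrics -/

/-- `Ẽ = π₁^* L₀ ⊗ P` over `M × M̂`. -/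
def Etilde (δ : ℕ+) (τ : ℍ) : HolBundle (pMMhat δ τ) :=
  tensor (pullback (pMMhat δ τ) Prod.fst (L₀ δ τ)) (PBundle δ τ)

def hEtilde (δ : ℕ+) (τ : ℍ) (y : M δ τ × Mhat δ τ) (u v : (Etilde δ τ).Fib y) : ℂ :=
  tensorSesq (hL₀ δ τ y.1) (hP δ τ y) u v

/-- `Ẽ' = π₁^* L₀ ⊗ (Id × φ_{L₀})^* P` over `M × M`. -/
def Etilde' (δ : ℕ+) (τ : ℍ) : HolBundle (pMM δ τ) :=
  tensor (pullback (pMM δ τ) Prod.fst (L₀ δ τ)) (phiP δ τ)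

def hEtilde' (δ : ℕ+) (τ : ℍ) (Ψ : HolIso (J δ τ) (phiP δ τ)) (y : M δ τ × M δ τ)
    (u v : (Etilde' δ τ).Fib y) : ℂ :=
  tensorSesq (hL₀ δ τ y.1) (hPhiP δ τ Ψ y) u v

/-- `E = (π₂)_* Ẽ` over `M̂`. -/
def EBundle (δ : ℕ+) (τ : ℍ) : HolBundle (pMhat δ τ) :=
  pushforward (pM δ τ) (pMhat δ τ) (Etilde δ τ)

/-- The `L²` metric on `E`. -/
def hE (δ : ℕ+) (τ : ℍ) : ∀ q, (EBundle δ τ).Fib q → (EBundle δ τ).Fib q → ℂ :=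
  l2Metric (pM δ τ) (pMhat δ τ) (Etilde δ τ) (fundPar δ τ) (hEtilde δ τ)

/-- `E' = (π₂)_* Ẽ'` over `M`. -/
def EBundle' (δ : ℕ+) (τ : ℍ) : HolBundle (pM δ τ) :=
  pushforward (pM δ τ) (pM δ τ) (Etilde' δ τ)

/-- The `L²` metric on `E'`. -/
def hE' (δ : ℕ+) (τ : ℍ) (Ψ : HolIso (J δ τ) (phiP δ τ)) :
    ∀ y, (EBundle' δ τ).Fib y → (EBundle' δ τ).Fib y → ℂ :=
  l2Metric (pM δ τ) (pM δ τ) (Etilde' δ τ) (fundPar δ τ) (hEtilde' δ τ Ψ)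

end ThetaTorus

end

open ThetaTorus

/-! All bundles are studied on the vector spaces covering their bases. A `LiftTriv` is a
trivialization there, together with its holomorphic factors of automorphy; holomorphic sections
become holomorphic functions. Tensor products, duals, pull-backs and push-forwards inherit such
trivializations. Factors related by a nowhere vanishing entire function give isomorphic bundles
(`LiftTriv.exists_iso`), and every isomorphism of line bundles is multiplication by such a function
(`LiftTriv.exists_mul_of_iso`).

The central fact is that `φL₀` lifts to the identity of ℂ (`φL₀_pM`). Indeed T_μ^*L₀ ⊗ L₀^* has the
constant factors exp(-2πibμ) for aδ + bτ, and multiplication by exp(-2πiσz) turns the factors of P_μ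
into these; conversely Liouville's theorem shows that the isomorphism class determines μ modulo
`latHat`.

The function `gaugeP` converts the (0,1)-condition of the connection on P into ordinary holomorphy
(`covP_iff`), and the constant metric 1 becomes the weight |`gaugeP`|⁻² = exp(-4π z₂ μ̂₂/τ₂). Pulled
back along the identity lift, P has exactly the factors of J. A normalized Ψ is multiplication by a
function that is Λ-periodic in z, hence constant in z, hence 1 (`liftPhiP_of_isNormalized`). So the
metric transported from J is the pulled-back metric of P, which gives (1).

For (2), sections over M × {μ} are the functions f(z + μ) with f in H⁰(L₀), a space of dimension δ
(`thetaEquiv`). By completing the square, -z₂² - 2z₂μ₂ = μ₂² - (z₂ + μ₂)², and by translation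
invariance of the integral, the L² metric is exp(2π μ₂²/τ₂) times a fixed Hermitian form
(`IsThetaLift.l2Metric_apply`). This holds for E and E' in the same coordinate μ, which identifies
them isometrically.

A metric of this shape has scalar curvature, computed from the weight alone
(`LiftTriv.curvature_eq`). As the lift of `φL₀` is the identity, both curvatures are the same
scalar, which is (3). -/

set_option linter.unusedSectionVars false

noncomputable section

namespace ThetaTorus

open Filter

/-! ### Regular coverings by vector spaces -/

section Covering

variable {W X : Type} [NormedAddCommGroup W] [NormedSpace ℂ W] [TopologicalSpace X]

/-- `p` is a regular covering map with the group `Γ` of translations as deck group. -/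
structure IsCov (p : W → X) (Γ : AddSubgroup W) : Prop where
  surj : Function.Surjective p
  map_nhds : ∀ w, map p (𝓝 w) = 𝓝 (p w)
  inj : ∀ w, ∃ U ∈ 𝓝 w, Set.InjOn p U
  deck : ∀ w w', p w = p w' ↔ w' - w ∈ Γ

variable {p : W → X} {Γ : AddSubgroup W}

theorem IsCov.eventually (hp : IsCov p Γ) {w : W} {P : X → Prop} :
    (∀ᶠ y in 𝓝 (p w), P y) ↔ ∀ᶠ v in 𝓝 w, P (p v) := by
  rw [← hp.map_nhds w, eventually_map]

theorem IsCov.add (hp : IsCov p Γ) {l : W} (hl : l ∈ Γ) (w : W) : p (w + l) = p w :=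
  ((hp.deck _ _).2 (by simpa using hl)).symm

/-- A local section of `p` near `p w₀`, through `w₀`. -/
theorem IsCov.exists_section (hp : IsCov p Γ) (w₀ : W) :
    ∃ σ : X → W, (∀ y, p (σ y) = y) ∧ ∀ᶠ v in 𝓝 w₀, σ (p v) = v := by
  classical
  obtain ⟨U, hU, hinj⟩ := hp.inj w₀
  -- Whenever a preimage in `U` exists the chosen one lies in `U`; injectivity on `U` then forces `σ
  -- (p v) = v` there, so continuity of `σ` is never needed.
  have key : ∀ y, ∃ w, p w = y ∧ ((∃ u ∈ U, p u = y) → w ∈ U) := fun y => by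
    by_cases h : ∃ u ∈ U, p u = y
    · obtain ⟨u, hu, h'⟩ := h
      exact ⟨u, h', fun _ => hu⟩
    · obtain ⟨w, hw⟩ := hp.surj y
      exact ⟨w, hw, fun h' => absurd h' h⟩
  choose σ hσ hσU using key
  refine ⟨σ, hσ, ?_⟩
  filter_upwards [hU] with v hv
  exact hinj (hσU _ ⟨v, hv, rfl⟩) hv (hσ _)

/-- The lifted function is invariant under deck translations, so differentiability near one preimage
is carried to all others. -/
theorem HolFunAt.iff_one (hp : IsCov p Γ) {w : W} {f : X → ℂ} :
    HolFunAt p (p w) f ↔ ∀ᶠ v in 𝓝 w, DifferentiableAt ℂ (fun v => f (p v)) v := by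
  refine ⟨fun h => h w rfl, fun h w' hw' => ?_⟩
  have hl := (hp.deck _ _).1 hw'
  have h1 : Tendsto (fun v => v + (w - w')) (𝓝 w') (𝓝 w) := by
    have : Tendsto (fun v => v + (w - w')) (𝓝 w') (𝓝 (w' + (w - w'))) :=
      (continuous_id.add continuous_const).tendsto _
    simpa using this
  filter_upwards [h1.eventually h] with v hv
  have h2 : (fun v => f (p v)) = fun v => f (p (v + (w - w'))) := by
    funext v; rw [hp.add hl]
  rw [h2]
  have h3 : DifferentiableAt ℂ (fun v => v + (w - w')) v := by fun_prop
  exact DifferentiableAt.comp (g := fun v => f (p v)) v hv h3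

end Covering

/-! ### Trivializations over the covering space, frames and isomorphisms -/

section LiftTriv

variable {W X : Type} [NormedAddCommGroup W] [NormedSpace ℂ W] [TopologicalSpace X]
  {p : W → X}

/-- The sections near `x` that are holomorphic in terms of trivializations `T`. -/
def diffSections (E : HolBundle p) {V : Type} [NormedAddCommGroup V] [NormedSpace ℂ V]
    (T : ∀ x w, p w = x → E.Fib x ≃ₗ[ℂ] V) (x : X) : Submodule ℂ (∀ y, E.Fib y) where
  carrier := {s | ∀ w, p w = x →
    ∀ᶠ v in 𝓝 w, DifferentiableAt ℂ (fun v => T (p v) v rfl (s (p v))) v}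
  zero_mem' w _ := Eventually.of_forall fun v => by simp
  add_mem' {s t} hs ht w hw := by
    filter_upwards [hs w hw, ht w hw] with v h1 h2
    simp only [Pi.add_apply, map_add]
    exact h1.add h2
  smul_mem' c s hs w hw := by
    filter_upwards [hs w hw] with v h1
    simp only [Pi.smul_apply, map_smul]
    exact h1.const_smul c

/-- A trivialization of the pull-back of `E` to the covering space of the base: linear isomorphisms
`T x w` of the fibre at `x` with `V`, for all `w` over `x`, which change by holomorphic factors of
automorphy under deck transformations, and which detect the holomorphic sections. -/
structure LiftTriv (E : HolBundle p) (V : Type) [NormedAddCommGroup V] [NormedSpace ℂ V]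
    (Γ : AddSubgroup W) where
  T : ∀ x w, p w = x → E.Fib x ≃ₗ[ℂ] V
  deck : ∀ l ∈ Γ, ∃ m : W → V →L[ℂ] V, Differentiable ℂ m ∧
    ∀ x w (h : p w = x) (h' : p (w + l) = x) u, T x (w + l) h' u = m w (T x w h u)
  hol : ∀ x (s : ∀ y, E.Fib y), s ∈ E.hol x ↔
    ∀ w, p w = x → ∀ᶠ v in 𝓝 w, DifferentiableAt ℂ (fun v => T (p v) v rfl (s (p v))) v

variable {E : HolBundle p} {V : Type} [NormedAddCommGroup V] [NormedSpace ℂ V]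
  {Γ : AddSubgroup W}

theorem LiftTriv.T_rfl (L : LiftTriv E V Γ) (s : ∀ y, E.Fib y) {x : X} {w : W} (h : p w = x) :
    L.T x w h (s x) = L.T (p w) w rfl (s (p w)) := by
  subst h; rfl

theorem LiftTriv.symm_rfl (L : LiftTriv E V Γ) {x : X} {w w' : W} (hw : w = w') (h : p w = x)
    (h' : p w' = x) : L.T x w h = L.T x w' h' := by
  subst hw; rfl

/-- Trivializations at two points over the same base point differ by a translation and a holomorphic
factor, neither of which affects differentiability. -/
theorem LiftTriv.hol_iff_one (L : LiftTriv E V Γ) (hp : IsCov p Γ) (w : W)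
    (s : ∀ y, E.Fib y) : s ∈ E.hol (p w) ↔
      ∀ᶠ v in 𝓝 w, DifferentiableAt ℂ (fun v => L.T (p v) v rfl (s (p v))) v := by
  rw [L.hol]
  refine ⟨fun h => h w rfl, fun h w' hw' => ?_⟩
  have hl := (hp.deck _ _).1 hw'
  have hl' := (hp.deck _ _).1 hw'.symm
  obtain ⟨m, hm, hT⟩ := L.deck _ hl'
  have h1 : Tendsto (fun v => v + (w - w')) (𝓝 w') (𝓝 w) := by
    have : Tendsto (fun v => v + (w - w')) (𝓝 w') (𝓝 (w' + (w - w'))) :=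
      (continuous_id.add continuous_const).tendsto _
    simpa using this
  filter_upwards [h1.eventually h] with v hv
  have h2 : (fun v => L.T (p v) v rfl (s (p v))) = fun v => m (v + (w - w'))
      (L.T (p (v + (w - w'))) (v + (w - w')) rfl (s (p (v + (w - w'))))) := by
    funext v
    have e : v + (w - w') + (w' - w) = v := by abel
    have := hT (p v) (v + (w - w')) (hp.add hl v) (by rw [e]) (s (p v))
    rw [← L.T_rfl s (hp.add hl v), ← this]
    rw [L.symm_rfl e]
  rw [h2]
  have h3 : DifferentiableAt ℂ (fun v => v + (w - w')) v := by fun_prop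
  exact ((hm _).comp v h3).clm_apply (DifferentiableAt.comp
    (g := fun v => L.T (p v) v rfl (s (p v))) v hv h3)

/-- The definition of `HolBundle` does not force `hol x` to depend on germs only; the trivialization
does. -/
theorem LiftTriv.hol_congr (L : LiftTriv E V Γ) (hp : IsCov p Γ) {x : X}
    {s t : ∀ y, E.Fib y} (hs : s ∈ E.hol x) (h : ∀ᶠ y in 𝓝 x, t y = s y) : t ∈ E.hol x := by
  obtain ⟨w, rfl⟩ := hp.surj x
  rw [L.hol_iff_one hp] at hs ⊢
  filter_upwards [hs, (hp.eventually.1 h).eventually_nhds] with v h1 h2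
  refine h1.congr_of_eventuallyEq ?_
  filter_upwards [h2] with v hv
  rw [hv]

theorem LiftTriv.hol_smul (L : LiftTriv E V Γ) {x : X}
    {s : ∀ y, E.Fib y} {c : X → ℂ} (hc : HolFunAt p x c) (hs : s ∈ E.hol x) :
    (fun y => c y • s y) ∈ E.hol x := by
  rw [L.hol] at hs ⊢
  intro w hw
  filter_upwards [hs w hw, hc w hw] with v h1 h2
  simp only [map_smul]
  exact h2.smul h1

/-- The local section with value `b` in the trivialization, along the local section `σ` of `p`. -/
def LiftTriv.sec (L : LiftTriv E V Γ) {σ : X → W} (hσ : ∀ y, p (σ y) = y) (b : V) :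
    ∀ y, E.Fib y := fun y => (L.T y (σ y) (hσ y)).symm b

theorem LiftTriv.T_sec (L : LiftTriv E V Γ) {σ : X → W} (hσ : ∀ y, p (σ y) = y) (b : V) {w : W}
    {x : X} (h : p w = x) (hw : σ (p w) = w) : L.T x w h (L.sec hσ b x) = b := by
  subst h
  unfold sec
  rw [← L.symm_rfl hw (hσ _) rfl]
  simp

theorem LiftTriv.sec_hol (L : LiftTriv E V Γ) (hp : IsCov p Γ) {σ : X → W}
    (hσ : ∀ y, p (σ y) = y) (b : V) {w : W} (hw : ∀ᶠ v in 𝓝 w, σ (p v) = v) :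
    L.sec hσ b ∈ E.hol (p w) := by
  rw [L.hol_iff_one hp]
  filter_upwards [hw.eventually_nhds] with v hv
  refine (differentiableAt_const b).congr_of_eventuallyEq ?_
  filter_upwards [hv] with v hv
  exact L.T_sec hσ b rfl hv

/-- The frame attached to a basis of `V` and a local section of `p`. -/
theorem LiftTriv.isFrame (L : LiftTriv E V Γ) (hp : IsCov p Γ) {σ : X → W}
    (hσ : ∀ y, p (σ y) = y) {w : W} (hw : ∀ᶠ v in 𝓝 w, σ (p v) = v) {r : ℕ}
    (b : Module.Basis (Fin r) ℂ V) [FiniteDimensional ℂ V] :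
    IsFrame E (p w) (fun i => L.sec hσ (b i)) where
  basis := by
    refine Eventually.of_forall fun y => ?_
    have e : (fun i => L.sec hσ (b i) y) = (b.map (L.T y (σ y) (hσ y)).symm) := by
      funext i; simp [sec]
    rw [e]
    exact ⟨Module.Basis.linearIndependent _, Module.Basis.span_eq _⟩
  hol := by
    rw [hp.eventually]
    filter_upwards [hw.eventually_nhds] with v hv s
    constructor
    · intro hs
      refine ⟨fun i y => b.repr (L.T y (σ y) (hσ y) (s y)) i, fun i => ?_, ?_⟩
      · rw [HolFunAt.iff_one hp]
        rw [L.hol_iff_one hp] at hs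
        filter_upwards [hs, hv.eventually_nhds] with v h1 h2
        have h3 : DifferentiableAt ℂ (fun v => LinearMap.toContinuousLinearMap (b.coord i)
            (L.T (p v) v rfl (s (p v)))) v :=
          (ContinuousLinearMap.differentiableAt _).comp v h1
        refine h3.congr_of_eventuallyEq ?_
        filter_upwards [h2] with v hv
        rw [L.symm_rfl hv _ rfl]
        simp
      · refine Eventually.of_forall fun y => ?_
        apply (L.T y (σ y) (hσ y)).injective
        simp [sec, b.sum_repr]
    · rintro ⟨c, hc, h⟩
      refine L.hol_congr hp (s := ∑ i, fun y => c i y • L.sec hσ (b i) y) ?_ ?_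
      · exact Submodule.sum_mem _ fun i _ => L.hol_smul (hc i) (L.sec_hol hp hσ _ hv)
      · filter_upwards [h] with y hy
        rw [hy]; simp

theorem LiftTriv.isHolBundle (L : LiftTriv E V Γ) (hp : IsCov p Γ) [FiniteDimensional ℂ V]
    {r : ℕ} (hr : Module.finrank ℂ V = r) : IsHolBundle E r := by
  intro x
  obtain ⟨w, rfl⟩ := hp.surj x
  obtain ⟨σ, hσ, hw⟩ := hp.exists_section w
  exact ⟨_, L.isFrame hp hσ hw (Module.finBasisOfFinrankEq ℂ V hr)⟩

/-- Under translation by `l` the trivialization is multiplied by `m`. -/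
def LiftTriv.HasFactor (L : LiftTriv E V Γ) (l : W) (m : W → ℂ) : Prop :=
  ∀ x w (h : p w = x) (h' : p (w + l) = x) u, L.T x (w + l) h' u = m w • L.T x w h u

theorem LiftTriv.HasFactor.congr {L : LiftTriv E V Γ} {l : W} {m m' : W → ℂ}
    (h : L.HasFactor l m) (h' : ∀ w, m w = m' w) : L.HasFactor l m' :=
  funext h' ▸ h

theorem LiftTriv.hol_section_of_basis_eq {r : ℕ} (L : LiftTriv E V Γ) [FiniteDimensional ℂ V]
    (b : Module.Basis (Fin r) ℂ V) {σ : X → W} (hσ : ∀ y, p (σ y) = y) (y : X) (u : E.Fib y) :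
    u = ∑ i, b.repr (L.T y (σ y) (hσ y) u) i • L.sec hσ (b i) y := by
  apply (L.T y (σ y) (hσ y)).injective
  simp [sec, b.sum_repr]

/-- The trivial line bundle. -/
def trivialLift (p : W → X) (Γ : AddSubgroup W) : LiftTriv (trivialBundle p) ℂ Γ where
  T _ _ _ := LinearEquiv.refl ℂ ℂ
  deck _ _ := ⟨fun _ => ContinuousLinearMap.id ℂ ℂ, differentiable_const _, fun _ _ _ _ _ => rfl⟩
  hol _ _ := Iff.rfl

theorem trivialLift_factor (l : W) : (trivialLift p Γ).HasFactor l 1 :=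
  fun _ _ _ _ u => (one_mul (show ℂ from u)).symm

/-! #### Isomorphisms -/

variable {F : HolBundle p} (L : LiftTriv E V Γ) (L' : LiftTriv F V Γ)

/-- The inverse isomorphism. -/
def HolIso.symm (A : HolIso E F) : HolIso F E where
  toEquiv x := (A.toEquiv x).symm
  hol_iff x s := by
    rw [A.hol_iff]
    simp only [LinearEquiv.apply_symm_apply]

/-- Fibrewise isomorphisms that are, in the trivializations, multiplication by a nowhere vanishing
holomorphic function `g`. -/
def LiftTriv.isoOfMul (A : ∀ x, E.Fib x ≃ₗ[ℂ] F.Fib x) (g : W → ℂ) (hg : Differentiable ℂ g)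
    (hg0 : ∀ w, g w ≠ 0) (hA : ∀ x w h u, L'.T x w h (A x u) = g w • L.T x w h u) :
    HolIso E F where
  toEquiv := A
  hol_iff x s := by
    rw [L.hol, L'.hol]
    refine forall₂_congr fun w hw => eventually_congr (Eventually.of_forall fun v => ?_)
    simp only [hA]
    refine ⟨fun h => (hg v).smul h, fun h => ?_⟩
    have := ((hg v).inv (hg0 v)).smul h
    refine this.congr_of_eventuallyEq (Eventually.of_forall fun v => ?_)
    simp [smul_smul, inv_mul_cancel₀ (hg0 v)]

/-- The map is defined with one chosen point over each `x`; the relation between `g`, `m` and `m'`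
says precisely that any other point gives the same map. -/
theorem LiftTriv.exists_iso (hp : IsCov p Γ) (g : W → ℂ) (hg : Differentiable ℂ g)
    (hg0 : ∀ w, g w ≠ 0)
    (h : ∀ l ∈ Γ, ∃ m m', L.HasFactor l m ∧ L'.HasFactor l m' ∧
      ∀ w, g (w + l) * m w = m' w * g w) :
    ∃ A : HolIso E F, ∀ x w h u, L'.T x w h (A.toEquiv x u) = g w • L.T x w h u := by
  choose σ hσ using hp.surj
  let A : ∀ x, E.Fib x ≃ₗ[ℂ] F.Fib x := fun x =>
    ((L.T x (σ x) (hσ x)).trans (LinearEquiv.smulOfNeZero ℂ V (g (σ x)) (hg0 _))).trans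
      (L'.T x (σ x) (hσ x)).symm
  have hA : ∀ x w h u, L'.T x w h (A x u) = g w • L.T x w h u := by
    intro x w hw u
    obtain ⟨m, m', h1, h2, h3⟩ := h (w - σ x) ((hp.deck _ _).1 ((hσ x).trans hw.symm))
    have e : σ x + (w - σ x) = w := by abel
    have h4 := h1 x (σ x) (hσ x) (by rw [e, hw]) u
    have h5 := h2 x (σ x) (hσ x) (by rw [e, hw]) (A x u)
    rw [L.symm_rfl e _ hw] at h4
    rw [L'.symm_rfl e _ hw] at h5
    have h6 := h3 (σ x)
    rw [e] at h6
    rw [h4, h5, smul_smul, h6, mul_smul]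
    congr 1
    simp [A]
  exact ⟨L.isoOfMul L' A g hg hg0 hA, hA⟩

end LiftTriv

/-! ### Line bundles: isomorphisms, tensor products and duals -/

section LineLift

variable {W X : Type} [NormedAddCommGroup W] [NormedSpace ℂ W] [TopologicalSpace X]
  {p : W → X} {E F : HolBundle p} {Γ : AddSubgroup W}
  (L : LiftTriv E ℂ Γ) (L' : LiftTriv F ℂ Γ)

/-- Every isomorphism of line bundles is multiplication by a nowhere vanishing function. -/
theorem LiftTriv.exists_mul_of_iso (hp : IsCov p Γ) (A : HolIso E F) :
    ∃ g : W → ℂ, Differentiable ℂ g ∧ (∀ w, g w ≠ 0) ∧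
      ∀ x w h u, L'.T x w h (A.toEquiv x u) = g w * L.T x w h u := by
  let g : W → ℂ := fun w =>
    L'.T (p w) w rfl (A.toEquiv (p w) ((L.T (p w) w rfl).symm 1))
  have key : ∀ x w h u, L'.T x w h (A.toEquiv x u) = g w * L.T x w h u := by
    rintro x w rfl u
    have : u = L.T (p w) w rfl u • (L.T (p w) w rfl).symm 1 := by
      apply (L.T (p w) w rfl).injective
      simp
    conv_lhs => rw [this]
    simp [g, mul_comm]
  refine ⟨g, fun w => ?_, fun w h0 => ?_, key⟩
  · obtain ⟨σ, hσ, hw⟩ := hp.exists_section w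
    -- The image of the local section with value 1 has value `g`, so `g` is holomorphic.
    have h1 := (A.hol_iff _ _).1 (L.sec_hol hp hσ 1 hw)
    rw [L'.hol_iff_one hp] at h1
    refine h1.self_of_nhds.congr_of_eventuallyEq ?_
    filter_upwards [hw] with v hv
    rw [key, L.T_sec hσ 1 rfl hv, mul_one]
  · have := key (p w) w rfl ((L.T (p w) w rfl).symm 1)
    rw [h0, zero_mul] at this
    simp at this

/-- The vector with value 1 at `w` is transported to `w + l` in two ways. -/
theorem LiftTriv.mul_factor_eq {g m m' : W → ℂ} {A : ∀ x, E.Fib x → F.Fib x}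
    (hA : ∀ x w h u, L'.T x w h (A x u) = g w * L.T x w h u) {l : W}
    (hl : ∀ w, p (w + l) = p w)
    (h : L.HasFactor l m) (h' : L'.HasFactor l m') (w : W) : g (w + l) * m w = m' w * g w := by
  have h1 := hA (p w) (w + l) (hl w) ((L.T (p w) w rfl).symm 1)
  rw [h' _ w rfl, h _ w rfl, hA (p w) w rfl] at h1
  simpa using h1.symm

/-! #### Tensor products and duals of line bundles -/

/-- The identification of a tensor product of two lines with `ℂ`. -/
def lineTensor {P Q : Type} [AddCommGroup P] [Module ℂ P] [AddCommGroup Q] [Module ℂ Q]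
    (A : P ≃ₗ[ℂ] ℂ) (B : Q ≃ₗ[ℂ] ℂ) : P ⊗[ℂ] Q ≃ₗ[ℂ] ℂ :=
  (TensorProduct.congr A B).trans (TensorProduct.lid ℂ ℂ)

theorem lineTensor_tmul {P Q : Type} [AddCommGroup P] [Module ℂ P] [AddCommGroup Q] [Module ℂ Q]
    (A : P ≃ₗ[ℂ] ℂ) (B : Q ≃ₗ[ℂ] ℂ) (a : P) (b : Q) :
    lineTensor A B (a ⊗ₜ b) = A a * B b := by
  simp [lineTensor]

theorem lineTensor_mul {P Q : Type} [AddCommGroup P] [Module ℂ P] [AddCommGroup Q] [Module ℂ Q]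
    {A A' : P ≃ₗ[ℂ] ℂ} {B B' : Q ≃ₗ[ℂ] ℂ} {c d : ℂ} (hA : ∀ u, A' u = c * A u)
    (hB : ∀ u, B' u = d * B u) (u : P ⊗[ℂ] Q) :
    lineTensor A' B' u = c * d * lineTensor A B u := by
  induction u using TensorProduct.induction_on with
  | zero => simp
  | add a b ha hb => rw [map_add, ha, hb, map_add, mul_add]
  | tmul a b => rw [lineTensor_tmul, lineTensor_tmul, hA, hB]; ring

/-- In a product of two lines every tensor is pure with a prescribed generator as second factor.
This avoids sums when a section is to be written as `e ⊗ f`. -/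
theorem lineTensor_symm {P Q : Type} [AddCommGroup P] [Module ℂ P] [AddCommGroup Q] [Module ℂ Q]
    (A : P ≃ₗ[ℂ] ℂ) (B : Q ≃ₗ[ℂ] ℂ) (u : P ⊗[ℂ] Q) :
    u = A.symm (lineTensor A B u) ⊗ₜ B.symm 1 := by
  apply (lineTensor A B).injective
  simp [lineTensor_tmul]

theorem tensor_mem_hol {x : X} {s : ∀ y, (tensor E F).Fib y} (h : ∃ e ∈ E.hol x, ∃ f ∈ F.hol x,
    ∀ᶠ y in 𝓝 x, s y = e y ⊗ₜ[ℂ] f y) : s ∈ (tensor E F).hol x :=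
  Submodule.subset_span (R := ℂ) (M := ∀ y, E.Fib y ⊗[ℂ] F.Fib y) h

/-- The product trivialization of a tensor product of line bundles. -/
def LiftTriv.tensor (hp : IsCov p Γ) : LiftTriv (tensor E F) ℂ Γ where
  T x w h := lineTensor (L.T x w h) (L'.T x w h)
  deck l hl := by
    obtain ⟨m, hm, h1⟩ := L.deck l hl
    obtain ⟨m', hm', h2⟩ := L'.deck l hl
    refine ⟨fun w => (m w 1 * m' w 1) • ContinuousLinearMap.id ℂ ℂ, ?_, ?_⟩
    · exact ((hm.clm_apply (differentiable_const _)).mul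
        (hm'.clm_apply (differentiable_const _))).smul (differentiable_const _)
    · intro x w h h' u
      have e : ∀ (n : ℂ →L[ℂ] ℂ) a, n a = n 1 * a := fun n a => by
        simpa [mul_comm] using n.map_smul a 1
      exact lineTensor_mul (fun u => (h1 x w h h' u).trans (e _ _))
        (fun u => (h2 x w h h' u).trans (e _ _)) u
  hol x s := by
    constructor
    -- The left side is a span and `diffSections` is a submodule, so only pure tensors need
    -- checking.
    · suffices h : (ThetaTorus.tensor E F).hol x ≤ diffSections (ThetaTorus.tensor E F)
        (fun x w h => lineTensor (L.T x w h) (L'.T x w h)) x from fun hs => h hs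
      refine Submodule.span_le.2 ?_
      rintro s ⟨e, he, f, hf, h⟩ w rfl
      rw [L.hol] at he
      rw [L'.hol] at hf
      filter_upwards [he w rfl, hf w rfl, (hp.eventually.1 h).eventually_nhds] with v h1 h2 h3
      refine (h1.mul h2).congr_of_eventuallyEq ?_
      filter_upwards [h3] with v hv
      rw [hv]
      exact lineTensor_tmul _ _ _ _
    · obtain ⟨w, rfl⟩ := hp.surj x
      intro hs
      obtain ⟨σ, hσ, hw⟩ := hp.exists_section w
      -- The first factor carries all of `s`; the second is the local section with value 1.
      refine tensor_mem_hol ⟨fun y => (L.T y (σ y) (hσ y)).symm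
        (lineTensor (L.T y (σ y) (hσ y)) (L'.T y (σ y) (hσ y)) (s y)), ?_,
        L'.sec hσ 1, L'.sec_hol hp hσ 1 hw, Eventually.of_forall fun y => lineTensor_symm _ _ _⟩
      rw [L.hol_iff_one hp]
      filter_upwards [hs w rfl, hw.eventually_nhds] with v h1 h2
      refine h1.congr_of_eventuallyEq ?_
      filter_upwards [h2] with v hv
      rw [← L.symm_rfl hv (hσ _) rfl, LinearEquiv.apply_symm_apply, L.symm_rfl hv (hσ _) rfl,
        L'.symm_rfl hv (hσ _) rfl]
      rfl

variable {L L'} in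
theorem LiftTriv.HasFactor.tensor (hp : IsCov p Γ) {l : W} {m m' : W → ℂ}
    (hm : L.HasFactor l m) (hm' : L'.HasFactor l m') :
    (L.tensor L' hp).HasFactor l (m * m') :=
  fun x w h h' u => lineTensor_mul (hm x w h h') (hm' x w h h') u

/-- The identification of the dual of a line with `ℂ`. -/
def lineDual {P : Type} [AddCommGroup P] [Module ℂ P] (A : P ≃ₗ[ℂ] ℂ) :
    Module.Dual ℂ P ≃ₗ[ℂ] ℂ :=
  A.symm.dualMap.trans (LinearMap.ringLmapEquivSelf ℂ ℂ ℂ)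

theorem lineDual_apply {P : Type} [AddCommGroup P] [Module ℂ P] (A : P ≃ₗ[ℂ] ℂ)
    (f : Module.Dual ℂ P) : lineDual A f = f (A.symm 1) := by
  simp [lineDual]

/-- The dual of a line scales inversely; `c` cannot vanish because `A'` is surjective. -/
theorem lineDual_mul {P : Type} [AddCommGroup P] [Module ℂ P] {A A' : P ≃ₗ[ℂ] ℂ} {c : ℂ}
    (hA : ∀ u, A' u = c * A u) (f : Module.Dual ℂ P) : lineDual A' f = c⁻¹ * lineDual A f := by
  have hc : c ≠ 0 := by
    rintro rfl
    simpa using hA (A'.symm 1)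
  have : A'.symm 1 = c⁻¹ • A.symm 1 := by
    apply A'.injective
    rw [map_smul, hA (A.symm 1), LinearEquiv.apply_symm_apply, LinearEquiv.apply_symm_apply]
    simp [hc]
  rw [lineDual_apply, lineDual_apply, this, map_smul, smul_eq_mul]

theorem lineDual_eval {P : Type} [AddCommGroup P] [Module ℂ P] (A : P ≃ₗ[ℂ] ℂ)
    (f : Module.Dual ℂ P) (u : P) : f u = lineDual A f * A u := by
  have : u = A u • A.symm 1 := by
    apply A.injective; simp
  conv_lhs => rw [this]
  rw [map_smul, lineDual_apply, smul_eq_mul, mul_comm]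

/-- The dual trivialization of the dual of a line bundle. -/
def LiftTriv.dual (hp : IsCov p Γ) : LiftTriv (dual E) ℂ Γ where
  T x w h := lineDual (L.T x w h)
  deck l hl := by
    obtain ⟨m, hm, h1⟩ := L.deck l hl
    have e : ∀ (n : ℂ →L[ℂ] ℂ) a, n a = n 1 * a := fun n a => by
      simpa [mul_comm] using n.map_smul a 1
    refine ⟨fun w => (m w 1)⁻¹ • ContinuousLinearMap.id ℂ ℂ, ?_, ?_⟩
    -- A vanishing factor would make the trivialization at `w + l` zero, although it is an
    -- isomorphism.
    · have h0 : ∀ w, m w 1 ≠ 0 := fun w h0 => by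
        have := h1 (p w) w rfl (hp.add hl w) ((L.T (p w) (w + l) (hp.add hl w)).symm 1)
        rw [e, h0, zero_mul] at this
        simp at this
      exact Differentiable.smul (fun w => ((hm.clm_apply (differentiable_const _)) w).inv (h0 w))
        (differentiable_const _)
    · intro x w h h' u
      exact lineDual_mul (fun u => (h1 x w h h' u).trans (e _ _)) u
  hol x f := by
    constructor
    · rintro hf w rfl
      obtain ⟨σ, hσ, hw⟩ := hp.exists_section w
      have h1 := hf _ (L.sec_hol hp hσ 1 hw) w rfl
      filter_upwards [h1, hw.eventually_nhds] with v h2 h3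
      refine h2.congr_of_eventuallyEq ?_
      filter_upwards [h3] with v hv
      have h4 := lineDual_eval (L.T (p v) v rfl) (f (p v)) (L.sec hσ 1 (p v))
      rw [L.T_sec hσ 1 rfl hv, mul_one] at h4
      exact h4.symm
    · intro hf s hs w hw
      filter_upwards [hf w hw, (L.hol x s).1 hs w hw] with v h1 h2
      refine (h1.mul h2).congr_of_eventuallyEq (Eventually.of_forall fun v => ?_)
      exact lineDual_eval (L.T (p v) v rfl) (f (p v)) (s (p v))

variable {L} in
theorem LiftTriv.HasFactor.dual (hp : IsCov p Γ) {l : W} {m : W → ℂ}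
    (hm : L.HasFactor l m) : (L.dual hp).HasFactor l (m⁻¹) :=
  fun x w h h' f => lineDual_mul (hm x w h h') f

end LineLift

/-! ### Pull-backs along maps with a holomorphic lift -/

section Pullback

variable {W X W' X' : Type} [NormedAddCommGroup W] [NormedSpace ℂ W] [TopologicalSpace X]
  [NormedAddCommGroup W'] [NormedSpace ℂ W'] [TopologicalSpace X'] {p : W → X} {p' : W' → X'}
  {E : HolBundle p} {Γ : AddSubgroup W} {Γ' : AddSubgroup W'}
  {V : Type} [NormedAddCommGroup V] [NormedSpace ℂ V] [FiniteDimensional ℂ V]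
  (L : LiftTriv E V Γ)

theorem pullback_mem_hol {g : X' → X} {x : X'} {s : ∀ y, (pullback p' g E).Fib y}
    (h : ∃ c : X' → ℂ, HolFunAt p' x c ∧ ∃ e ∈ E.hol (g x), ∀ᶠ y in 𝓝 x, s y = c y • e (g y)) :
    s ∈ (pullback p' g E).hol x :=
  Submodule.subset_span (R := ℂ) (M := ∀ y, E.Fib (g y)) h

/-- The trivialization of a pull-back along a map `g` with a holomorphic lift `gt`. -/
def LiftTriv.pullback (hp : IsCov p Γ) (hp' : IsCov p' Γ') (g : X' → X) (gt : W' → W)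
    (hg : ∀ w, p (gt w) = g (p' w)) (hd : Differentiable ℂ gt)
    (hΓ : ∀ l ∈ Γ', ∃ k ∈ Γ, ∀ w, gt (w + l) = gt w + k) :
    LiftTriv (pullback p' g E) V Γ' where
  T x w h := L.T (g x) (gt w) (by rw [hg, h])
  deck l hl := by
    obtain ⟨k, hk, h1⟩ := hΓ l hl
    obtain ⟨m, hm, h2⟩ := L.deck k hk
    refine ⟨fun w => m (gt w), hm.comp hd, fun x w h h' u => ?_⟩
    have h3 : p (gt w + k) = g x := by rw [← h1, hg, h']
    exact (congrFun (congrArg _ (L.symm_rfl (h1 w) _ h3)) u).trans (h2 _ _ _ h3 u)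
  hol x s := by
    constructor
    · suffices h : (ThetaTorus.pullback p' g E).hol x ≤ diffSections (ThetaTorus.pullback p' g E)
        (fun x w h => L.T (g x) (gt w) (by rw [hg, h])) x from fun hs => h hs
      refine Submodule.span_le.2 ?_
      rintro s ⟨c, hc, e, he, h⟩ w rfl
      rw [L.hol] at he
      have h1 := (hd w).continuousAt.eventually (he (gt w) (hg w))
      filter_upwards [h1, hc w rfl, (hp'.eventually.1 h).eventually_nhds] with v h1 h2 h3
      refine (h2.smul (DifferentiableAt.comp
        (g := fun v => L.T (p v) v rfl (e (p v))) v h1 (hd v))).congr_of_eventuallyEq ?_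
      filter_upwards [h3] with v hv
      rw [hv]
      refine (map_smul (L.T (g (p' v)) (gt v) (hg v)) (c (p' v)) (e (g (p' v)))).trans ?_
      rw [L.T_rfl]
      rfl
    · obtain ⟨w, rfl⟩ := hp'.surj x
      intro hs
      obtain ⟨σ', hσ', hw'⟩ := hp'.exists_section w
      obtain ⟨σ, hσ, hw⟩ := hp.exists_section (gt w)
      let b := Module.finBasis ℂ V
      let c : Fin (Module.finrank ℂ V) → X' → ℂ := fun i y =>
        b.repr (L.T (g y) (gt (σ' y)) (by rw [hg, hσ']) (s y)) i
      -- The expansion of `s` in the pulled-back frame of `E` near `g (p' w)`; each term has the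
      -- form required of a generator of the span.
      let t : Fin (Module.finrank ℂ V) → ∀ y, (ThetaTorus.pullback p' g E).Fib y := fun i y =>
        c i y • (L.sec hσ (b i) (g y) : E.Fib (g y))
      have ht : ∀ i, t i ∈ (ThetaTorus.pullback p' g E).hol (p' w) := fun i => by
        refine pullback_mem_hol ⟨c i, ?_, L.sec hσ (b i), ?_, Eventually.of_forall fun y => rfl⟩
        · rw [HolFunAt.iff_one hp']
          filter_upwards [hs w rfl, hw'.eventually_nhds] with v h1 h2
          have h3 : DifferentiableAt ℂ (fun v => LinearMap.toContinuousLinearMap (b.coord i)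
              (L.T (g (p' v)) (gt v) (hg v) (s (p' v)))) v :=
            (ContinuousLinearMap.differentiableAt _).comp v h1
          refine h3.congr_of_eventuallyEq ?_
          filter_upwards [h2] with v hv
          simp only [c, L.symm_rfl (congrArg gt hv) _ (hg v)]
          simp
        · rw [← hg]
          exact L.sec_hol hp hσ _ hw
      -- The expansion equals `s` only near `p' w`. The difference vanishes there and therefore lies
      -- in the span, as `0 • 0` near `p' w`.
      have hsum : s = (∑ i, t i) + (s - ∑ i, t i) := by abel
      rw [hsum]
      refine Submodule.add_mem _ (Submodule.sum_mem _ fun i _ => ht i) (pullback_mem_hol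
        ⟨fun _ => 0, HolFunAt.const 0, 0, Submodule.zero_mem _, ?_⟩)
      rw [hp'.eventually]
      filter_upwards [hw', (hd w).continuousAt.eventually hw] with v h1 h2
      rw [zero_smul, Pi.sub_apply, Finset.sum_apply]
      refine sub_eq_zero.2 ?_
      have h3 : gt (σ' (p' v)) = σ (g (p' v)) := by rw [h1, ← hg, h2]
      have h4 := L.hol_section_of_basis_eq b hσ (g (p' v)) (s (p' v))
      simp only [← L.symm_rfl h3 (by rw [hg, hσ']) (hσ _)] at h4
      exact h4

theorem LiftTriv.HasFactor.pullback {L : LiftTriv E V Γ} (hp : IsCov p Γ) (hp' : IsCov p' Γ')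
    {g : X' → X} {gt : W' → W} (hg : ∀ w, p (gt w) = g (p' w)) (hd : Differentiable ℂ gt)
    (hΓ : ∀ l ∈ Γ', ∃ k ∈ Γ, ∀ w, gt (w + l) = gt w + k) {l : W'} {k : W} {m : W → ℂ}
    (hm : L.HasFactor k m) (hk : ∀ w, gt (w + l) = gt w + k) :
    (L.pullback hp hp' g gt hg hd hΓ).HasFactor l (fun w => m (gt w)) := by
  intro x w h h' u
  have h3 : p (gt w + k) = g x := by rw [← hk, hg, h']
  exact (congrFun (congrArg _ (L.symm_rfl (hk w) _ h3)) u).trans (hm _ _ _ h3 u)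

end Pullback

/-! ### Complex differentiable functions of several variables are smooth -/

section Smooth

variable {W : Type} [NormedAddCommGroup W] [NormedSpace ℂ W] [FiniteDimensional ℂ W]

/-- Cauchy's formula on a small circle in the direction `v` writes the directional derivative as an
integral of values of `F`, which is then differentiated under the integral sign. -/
theorem differentiableAt_fderiv_apply {F : W → ℂ} {x : W} {R : ℝ} (hR : 0 < R)
    (hF : DifferentiableOn ℂ F (Metric.ball x R)) (v : W) :
    DifferentiableAt ℂ (fun w => fderiv ℂ F w v) x := by
  have : ProperSpace W := FiniteDimensional.proper ℂ W
  -- Base points stay within `ρ` of `x`, points of the circles within `2ρ`, and `F` is bounded on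
  -- the closed ball of radius `3ρ`, compactly inside the domain.
  obtain ⟨ρ, hρ, rfl⟩ : ∃ ρ, 0 < ρ ∧ R = 4 * ρ := ⟨R / 4, by positivity, by ring⟩
  have hv : 0 < ‖v‖ + 1 := by positivity
  -- The summand 1 covers the case `v = 0`.
  set r := ρ / (‖v‖ + 1) with hr
  have hr0 : 0 < r := by positivity
  have hrv : r * ‖v‖ ≤ ρ := by
    rw [hr, div_mul_eq_mul_div, div_le_iff₀ hv]
    nlinarith [norm_nonneg v]
  have hd : ∀ w ∈ Metric.ball x (4 * ρ), DifferentiableAt ℂ F w := fun w hw =>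
    hF.differentiableAt (Metric.isOpen_ball.mem_nhds hw)
  obtain ⟨C, hC⟩ := (isCompact_closedBall x (3 * ρ)).exists_bound_of_continuousOn
    (f := F) (hF.continuousOn.mono (Metric.closedBall_subset_ball (by linarith)))
  have hmem : ∀ w ∈ Metric.ball x ρ, ∀ ζ : ℂ, ‖ζ‖ ≤ r → w + ζ • v ∈ Metric.ball x (2 * ρ) := by
    intro w hw ζ hζ
    rw [mem_ball_iff_norm] at hw ⊢
    have h1 : ‖ζ • v‖ ≤ ρ := by
      rw [norm_smul]
      exact (mul_le_mul_of_nonneg_right hζ (norm_nonneg _)).trans hrv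
    calc ‖w + ζ • v - x‖ = ‖(w - x) + ζ • v‖ := by congr 1; abel
      _ ≤ ‖w - x‖ + ‖ζ • v‖ := norm_add_le _ _
      _ < 2 * ρ := by linarith
  have hbd : ∀ w ∈ Metric.ball x (2 * ρ), ‖fderiv ℂ F w‖ ≤ 2 * C / ρ := by
    intro w hw
    have hsub : Metric.ball w ρ ⊆ Metric.closedBall x (3 * ρ) := fun u hu => by
      rw [Metric.mem_closedBall]
      have := dist_triangle u w x
      rw [Metric.mem_ball] at hu hw
      linarith
    -- `F` maps the ball of radius `ρ` about `w` into the closed ball of radius `2C` about `F w`;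
    -- this bounds the derivative and supplies the dominating function.
    refine Complex.norm_fderiv_le_div_of_mapsTo_ball (R₁ := ρ) (R₂ := 2 * C) (hF.mono
      (hsub.trans (Metric.closedBall_subset_ball (by linarith)))) ?_ hρ
    intro u hu
    rw [mem_closedBall_iff_norm]
    have h1 := hC u (hsub hu)
    have h2 := hC w (hsub (Metric.mem_ball_self hρ))
    linarith [norm_sub_le (F u) (F w)]
  let c : ℝ → ℂ := circleMap 0 r
  have hc : ∀ θ, ‖c θ‖ = r := fun θ => by simp [c, abs_of_pos hr0]
  have hc0 : ∀ θ, c θ ≠ 0 := fun θ h => by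
    have := hc θ; rw [h, norm_zero] at this; exact hr0.ne this
  let κ : ℝ → ℂ := fun θ => deriv c θ * (1 / (c θ) ^ 2)
  have hcc : Continuous c := continuous_circleMap 0 r
  have hκ : Continuous κ := by
    have h1 : Continuous (deriv c) := by
      have : deriv c = fun θ => c θ * Complex.I := by
        funext θ; simp [c, deriv_circleMap]
      rw [this]; fun_prop
    exact h1.mul (continuous_const.div (hcc.pow 2) fun θ => pow_ne_zero 2 (hc0 θ))
  let G : W → ℝ → ℂ := fun w θ => κ θ * F (w + c θ • v)
  have hGcont : ∀ w ∈ Metric.ball x ρ, Continuous (G w) := fun w hw => by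
    refine hκ.mul (continuous_iff_continuousAt.2 fun θ => ?_)
    have h1 := hmem w hw (c θ) (hc θ).le
    have h2 := (hd _ (Metric.ball_subset_ball (by linarith) h1)).continuousAt
    exact ContinuousAt.comp (f := fun θ => w + c θ • v) h2 (by fun_prop)
  have hformula : ∀ w ∈ Metric.ball x ρ, fderiv ℂ F w v =
      (2 * Real.pi * Complex.I : ℂ)⁻¹ • ∫ θ in (0 : ℝ)..(2 * Real.pi), G w θ := by
    intro w hw
    have hline : ∀ ζ : ℂ, ‖ζ‖ ≤ r → DifferentiableAt ℂ (fun ζ : ℂ => F (w + ζ • v)) ζ := by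
      intro ζ hζ
      have h1 := hd _ (Metric.ball_subset_ball (by linarith) (hmem w hw ζ hζ))
      exact DifferentiableAt.comp (g := F) (f := fun ζ : ℂ => w + ζ • v) ζ h1 (by fun_prop)
    have h1 : DiffContOnCl ℂ (fun ζ : ℂ => F (w + ζ • v)) (Metric.ball 0 r) := by
      refine DifferentiableOn.diffContOnCl fun ζ hζ => (hline ζ ?_).differentiableWithinAt
      rw [closure_ball _ hr0.ne'] at hζ
      simpa using hζ
    have h2 := h1.deriv_eq_smul_circleIntegral hr0
    have h3 : deriv (fun ζ : ℂ => F (w + ζ • v)) 0 = fderiv ℂ F w v := by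
      have h4 : HasFDerivAt F (fderiv ℂ F w) (w + (0 : ℂ) • v) := by
        rw [zero_smul, add_zero]
        exact (hd w (Metric.ball_subset_ball (by linarith) hw)).hasFDerivAt
      have h5 : HasDerivAt (fun ζ : ℂ => w + ζ • v) v 0 := by
        simpa using ((hasDerivAt_id (0 : ℂ)).smul_const v).const_add w
      exact (h4.comp_hasDerivAt (0 : ℂ) h5).deriv
    rw [← h3, eq_inv_smul_iff₀ Complex.two_pi_I_ne_zero, ← h2]
    rw [circleIntegral]
    refine intervalIntegral.integral_congr fun θ _ => ?_
    simp only [G, κ, smul_eq_mul, sub_zero, c]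
    ring
  have hball : Metric.ball x ρ ∈ 𝓝 x := Metric.ball_mem_nhds _ hρ
  have hx : x ∈ Metric.ball x ρ := Metric.mem_ball_self hρ
  have hmain := intervalIntegral.hasFDerivAt_integral_of_dominated_of_fderiv_le (𝕜 := ℂ)
    (μ := volume) (a := 0) (b := 2 * Real.pi) (F := G)
    (F' := fun w θ => κ θ • fderiv ℂ F (w + c θ • v)) (x₀ := x)
    (bound := fun θ => ‖κ θ‖ * (2 * C / ρ)) hball
    (by
      filter_upwards [hball] with w hw
      exact (hGcont w hw).aestronglyMeasurable)
    ((hGcont x hx).intervalIntegrable _ _)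
    (by
      borelize W
      refine AEStronglyMeasurable.smul hκ.aestronglyMeasurable ?_
      -- Continuity of `fderiv` is not yet available, but its measurability holds without
      -- assumptions.
      have h1 : Measurable fun θ => fderiv ℂ F (x + c θ • v) :=
        (measurable_fderiv ℂ F).comp (by fun_prop : Continuous fun θ => x + c θ • v).measurable
      exact h1.aestronglyMeasurable)
    (Eventually.of_forall fun θ _ w hw => by
      rw [norm_smul]
      exact mul_le_mul_of_nonneg_left (hbd _ (hmem w hw _ (hc θ).le)) (norm_nonneg _))
    ((hκ.norm.mul continuous_const).intervalIntegrable _ _)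
    (Eventually.of_forall fun θ _ w hw => by
      have h1 := (hd _ (Metric.ball_subset_ball (by linarith) (hmem w hw _ (hc θ).le))).hasFDerivAt
      have h2 : HasFDerivAt (fun w => F (w + c θ • v)) (fderiv ℂ F (w + c θ • v)) w := by
        have h3 := h1.comp w ((hasFDerivAt_id w).add_const (c θ • v))
        rwa [ContinuousLinearMap.comp_id] at h3
      exact h2.const_mul (κ θ))
  have h2 := hmain.differentiableAt.const_smul ((2 * Real.pi * Complex.I : ℂ)⁻¹)
  refine h2.congr_of_eventuallyEq ?_
  filter_upwards [hball] with w hw using hformula w hw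

/-- Induction on the order: every directional derivative is again complex differentiable. -/
theorem contDiffOn_of_differentiableOn_complex {U : Set W} (hU : IsOpen U) (n : ℕ) :
    ∀ {F : W → ℂ}, DifferentiableOn ℂ F U → ContDiffOn ℂ n F U := by
  induction n with
  | zero =>
    intro F hF
    exact contDiffOn_zero.2 hF.continuousOn
  | succ n ih =>
    intro F hF
    rw [Nat.cast_add, Nat.cast_one, contDiffOn_succ_iff_fderiv_of_isOpen hU]
    refine ⟨hF, by simp, contDiffOn_clm_apply.2 fun v => ih fun x hx => ?_⟩
    obtain ⟨R, hR, hsub⟩ := Metric.isOpen_iff.1 hU x hx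
    exact (differentiableAt_fderiv_apply hR (hF.mono hsub) v).differentiableWithinAt

/-- A function of several variables that is complex differentiable near a point is smooth there. -/
theorem contDiffAt_of_differentiable_complex {F : W → ℂ} {w : W}
    (h : ∀ᶠ v in 𝓝 w, DifferentiableAt ℂ F v) : ContDiffAt ℝ ∞ F w := by
  obtain ⟨U, hUF, hU, hw⟩ := eventually_nhds_iff.1 h
  rw [contDiffAt_infty]
  intro n
  have h1 := contDiffOn_of_differentiableOn_complex hU n fun v hv =>
    (hUF v hv).differentiableWithinAt
  exact (h1.contDiffAt (hU.mem_nhds hw)).restrict_scalars ℝ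

theorem contDiffAt_of_differentiable_complex' {V : Type} [NormedAddCommGroup V] [NormedSpace ℂ V]
    [FiniteDimensional ℂ V] {F : W → V} {w : W}
    (h : ∀ᶠ v in 𝓝 w, DifferentiableAt ℂ F v) : ContDiffAt ℝ ∞ F w := by
  let e := (Module.finBasis ℂ V).equivFun.toContinuousLinearEquiv
  have h1 : ContDiffAt ℝ ∞ (fun v => e (F v)) w := by
    rw [contDiffAt_pi]
    intro i
    refine contDiffAt_of_differentiable_complex ?_
    filter_upwards [h] with v hv
    exact differentiableAt_pi.1 (e.differentiableAt.comp v hv) i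
  have h2 : ContDiffAt ℝ ∞ (fun v => e.symm (e (F v))) w :=
    (e.symm.contDiff.restrict_scalars ℝ).contDiffAt.comp w h1
  simpa using h2

end Smooth

/-! ### Hermitian metrics given by a weight and a constant form -/

section Metric

variable {W X : Type} [NormedAddCommGroup W] [NormedSpace ℂ W] [TopologicalSpace X]
  {p : W → X} {E : HolBundle p} {Γ : AddSubgroup W} {V : Type} [NormedAddCommGroup V]
  [NormedSpace ℂ V] [FiniteDimensional ℂ V]

/-- A positive definite Hermitian form. -/
structure IsPosHerm (B : Sesq V) : Prop where
  symm : ∀ u v, B v u = (starRingEnd ℂ) (B u v)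
  pos : ∀ u, u ≠ 0 → 0 < (B u u).re

/-- Over ℝ a sesquilinear form is bilinear, and in finite dimension it is bounded. -/
theorem Sesq.contDiff (B : Sesq V) : ContDiff ℝ ∞ fun q : V × V => B q.1 q.2 := by
  have h : IsBilinearMap ℝ fun u v : V => B u v :=
    { add_left := by intros; simp
      smul_left := by
        intro c u v
        rw [← Complex.coe_smul c u]; simp
      add_right := by intros; simp
      smul_right := by
        intro c u v
        rw [← Complex.coe_smul c v, map_smulₛₗ]; simp }
  have : FiniteDimensional ℝ V := FiniteDimensional.complexToReal V
  exact h.toContinuousBilinearMap.isBoundedBilinearMap.contDiff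

theorem LiftTriv.isHermMetric [FiniteDimensional ℂ W] (L : LiftTriv E V Γ) (hp : IsCov p Γ)
    {B : Sesq V} (hB : IsPosHerm B) {k : W → ℝ} (hk : ContDiff ℝ ∞ k) (hk0 : ∀ w, 0 < k w)
    {h : ∀ x, E.Fib x → E.Fib x → ℂ}
    (hh : ∀ x w (hw : p w = x) u v, h x u v = k w * B (L.T x w hw u) (L.T x w hw v)) :
    IsHermMetric E h where
  add_left x u v w := by
    obtain ⟨y, hy⟩ := hp.surj x
    simp only [hh x y hy, map_add, LinearMap.add_apply, mul_add]
  smul_left x c u w := by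
    obtain ⟨y, hy⟩ := hp.surj x
    simp only [hh x y hy, map_smul, LinearMap.smul_apply, smul_eq_mul]
    ring
  conj_symm x u v := by
    obtain ⟨y, hy⟩ := hp.surj x
    simp only [hh x y hy, map_mul, Complex.conj_ofReal, ← hB.symm]
  pos x u hu := by
    obtain ⟨y, hy⟩ := hp.surj x
    rw [hh x y hy, Complex.re_ofReal_mul]
    exact mul_pos (hk0 y) (hB.pos _ (by simpa using hu))
  smooth x s hs t ht w hw := by
    have e : (fun v => h (p v) (s (p v)) (t (p v))) = fun v =>
        (k v : ℂ) * B (L.T (p v) v rfl (s (p v))) (L.T (p v) v rfl (t (p v))) := by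
      funext v; exact hh _ _ _ _ _
    rw [e]
    have h1 := contDiffAt_of_differentiable_complex' ((L.hol x s).1 hs w hw)
    have h2 := contDiffAt_of_differentiable_complex' ((L.hol x t).1 ht w hw)
    exact (Complex.ofRealCLM.contDiff.comp hk).contDiffAt.mul
      ((Sesq.contDiff B).contDiffAt.comp w (h1.prodMk h2))

end Metric

/-! ### The Chern curvature of a Gaussian weight times a constant form -/

section Curvature

theorem del_mul {f g : ℂ → ℂ} {w : ℂ} (hf : DifferentiableAt ℝ f w) (hg : DifferentiableAt ℝ g w)
    (v : ℂ) : del (fun u => f u * g u) v w = del f v w * g w + f w * del g v w := by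
  simp only [del, fderiv_fun_mul hf hg, add_apply, smul_apply, smul_eq_mul]
  ring

theorem del_congr {f g : ℂ → ℂ} {w : ℂ} (h : f =ᶠ[𝓝 w] g) (v : ℂ) : del f v w = del g v w := by
  simp only [del, h.fderiv_eq]

theorem delbar_congr {f g : ℂ → ℂ} {w : ℂ} (h : f =ᶠ[𝓝 w] g) (v : ℂ) :
    delbar f v w = delbar g v w := by
  simp only [delbar, h.fderiv_eq]

theorem delbar_add {f g : ℂ → ℂ} {w : ℂ} (hf : DifferentiableAt ℝ f w)
    (hg : DifferentiableAt ℝ g w) (v : ℂ) :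
    delbar (fun u => f u + g u) v w = delbar f v w + delbar g v w := by
  simp only [delbar, fderiv_fun_add hf hg, add_apply]
  ring

theorem del_sum {ι : Type} (s : Finset ι) {f : ι → ℂ → ℂ} {w : ℂ}
    (hf : ∀ i ∈ s, DifferentiableAt ℝ (f i) w) (v : ℂ) :
    del (fun u => ∑ i ∈ s, f i u) v w = ∑ i ∈ s, del (f i) v w := by
  simp only [del, fderiv_fun_sum hf, sum_apply]
  rw [← Finset.sum_div, Finset.sum_sub_distrib, ← Finset.mul_sum]

theorem fderiv_real_of_complex {f : ℂ → ℂ} {w : ℂ} (hf : DifferentiableAt ℂ f w) (v : ℂ) :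
    fderiv ℝ f w v = v * deriv f w := by
  rw [hf.fderiv_restrictScalars ℝ]
  simp

theorem del_of_complex {f : ℂ → ℂ} {w : ℂ} (hf : DifferentiableAt ℂ f w) (v : ℂ) :
    del f v w = v * deriv f w := by
  simp only [del, fderiv_real_of_complex hf, smul_eq_mul]
  linear_combination (-(v * deriv f w) / 2) * Complex.I_mul_I

theorem delbar_of_complex {f : ℂ → ℂ} {w : ℂ} (hf : DifferentiableAt ℂ f w) (v : ℂ) :
    delbar f v w = 0 := by
  simp only [delbar, fderiv_real_of_complex hf, smul_eq_mul]
  linear_combination ((v * deriv f w) / 2) * Complex.I_mul_I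

theorem del_conj_of_complex {f : ℂ → ℂ} {w : ℂ} (hf : DifferentiableAt ℂ f w) (v : ℂ) :
    del (fun u => (starRingEnd ℂ) (f u)) v w = 0 := by
  have h1 : fderiv ℝ (fun u => (starRingEnd ℂ) (f u)) w =
      (Complex.conjCLE : ℂ →L[ℝ] ℂ).comp (fderiv ℝ f w) :=
    (Complex.conjCLE.hasFDerivAt.comp w (hf.restrictScalars ℝ).hasFDerivAt).fderiv
  simp only [del, h1, ContinuousLinearMap.comp_apply, fderiv_real_of_complex hf, smul_eq_mul]
  simp
  linear_combination ((starRingEnd ℂ) v * (starRingEnd ℂ) (deriv f w)) * Complex.I_mul_I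

theorem fderiv_im (w v : ℂ) : fderiv ℝ (fun u : ℂ => (u.im : ℂ)) w v = v.im := by
  have h : HasFDerivAt (fun u : ℂ => (u.im : ℂ)) (Complex.ofRealCLM.comp Complex.imCLM) w :=
    (Complex.ofRealCLM.comp Complex.imCLM).hasFDerivAt
  rw [h.fderiv]; rfl

theorem differentiable_im : Differentiable ℝ (fun u : ℂ => (u.im : ℂ)) :=
  (Complex.ofRealCLM.comp Complex.imCLM).differentiable

/-- Chain rule with ∂(Im u)(v) = -iv/2. -/
theorem del_gauss (a : ℝ) (w v : ℂ) :
    del (fun u => ((Real.exp (a * u.im ^ 2) : ℝ) : ℂ)) v w =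
      (-Complex.I * a * w.im * v) * (Real.exp (a * w.im ^ 2) : ℝ) := by
  have e : (fun u : ℂ => ((Real.exp (a * u.im ^ 2) : ℝ) : ℂ)) =
      fun u => Complex.exp (a * (u.im : ℂ) ^ 2) := by funext u; push_cast; rfl
  have h1 : DifferentiableAt ℝ (fun u : ℂ => (a : ℂ) * (u.im : ℂ) ^ 2) w :=
    ((differentiable_im w).pow 2).const_mul _
  have h2 : ∀ v, fderiv ℝ (fun u : ℂ => Complex.exp (a * (u.im : ℂ) ^ 2)) w v =
      Complex.exp (a * (w.im : ℂ) ^ 2) * (a * (2 * w.im * v.im)) := by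
    intro v
    have h3 := ((differentiable_im w).hasFDerivAt.pow 2).const_mul (a : ℂ)
    have h4 := h3.cexp.fderiv
    have h5 := congrArg (fun q : ℂ →L[ℝ] ℂ => q v) h4
    refine h5.trans ?_
    simp only [smul_apply, smul_eq_mul, fderiv_im]
    simp
  simp only [e, del, h2]
  have hv : v = v.re + v.im * Complex.I := (Complex.re_add_im v).symm
  have h3 : ((Complex.I • v).im : ℂ) = v.re := by simp
  rw [h3]
  push_cast
  conv_rhs => rw [hv]
  linear_combination (a * w.im * v.im * Complex.exp (a * (w.im : ℂ) ^ 2)) * Complex.I_mul_I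

theorem delbar_im (w v : ℂ) : delbar (fun u : ℂ => (u.im : ℂ)) v w =
    Complex.I * (starRingEnd ℂ) v / 2 := by
  simp only [delbar, fderiv_im]
  have h3 : ((Complex.I • v).im : ℂ) = v.re := by simp
  have hv : (starRingEnd ℂ) v = v.re - v.im * Complex.I := by
    apply Complex.ext <;> simp
  rw [h3, hv]
  linear_combination (v.im / 2 : ℂ) * Complex.I_mul_I

theorem differentiableAt_det {n : ℕ} {A : ℂ → Matrix (Fin n) (Fin n) ℂ} {w : ℂ}
    (hA : ∀ i j, DifferentiableAt ℂ (fun u => A u i j) w) :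
    DifferentiableAt ℂ (fun u => (A u).det) w := by
  simp only [Matrix.det_apply]
  refine DifferentiableAt.fun_sum fun σ _ => ?_
  refine DifferentiableAt.const_smul ?_ _
  exact DifferentiableAt.fun_finsetProd fun i _ => hA _ _

/-- Cramer's rule: the entries of the inverse are quotients of determinants. -/
theorem differentiableAt_inv_entry {n : ℕ} {A : ℂ → Matrix (Fin n) (Fin n) ℂ} {w : ℂ}
    (hA : ∀ i j, DifferentiableAt ℂ (fun u => A u i j) w) (h0 : (A w).det ≠ 0) (i j : Fin n) :
    DifferentiableAt ℂ (fun u => (A u)⁻¹ i j) w := by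
  simp only [Matrix.inv_def, Matrix.smul_apply, Ring.inverse_eq_inv', Matrix.adjugate_apply,
    smul_eq_mul]
  refine ((differentiableAt_det hA).inv h0).mul (differentiableAt_det fun k l => ?_)
  by_cases hk : k = j
  · subst hk; simp
  · simp only [Matrix.updateRow_ne hk]; exact hA k l

/-- The connection and curvature matrices for the metric `exp (a u₂²) A C A^*`, `A` holomorphic. -/
theorem conn_eq {n : ℕ} {A H : ℂ → Matrix (Fin n) (Fin n) ℂ} {C : Matrix (Fin n) (Fin n) ℂ}
    {a : ℝ} {w : ℂ} (hA : ∀ i j, DifferentiableAt ℂ (fun u => A u i j) w)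
    (h0 : (A w).det ≠ 0) (hC : C.det ≠ 0)
    (hH : ∀ᶠ u in 𝓝 w, H u = ((Real.exp (a * u.im ^ 2) : ℝ) : ℂ) • (A u * C * (A u)ᴴ)) (v : ℂ) :
    (Matrix.of fun j k => del (fun u => H u j k) v w) * (H w)⁻¹ =
      (-Complex.I * a * w.im * v) • (1 : Matrix (Fin n) (Fin n) ℂ) +
        v • ((Matrix.of fun j k => deriv (fun u => A u j k) w) * (A w)⁻¹) := by
  set k : ℂ → ℂ := fun u => ((Real.exp (a * u.im ^ 2) : ℝ) : ℂ) with hk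
  have hkd : DifferentiableAt ℝ k w := by
    have e : k = fun u => Complex.exp (a * (u.im : ℂ) ^ 2) := by
      funext u; simp only [hk]; push_cast; rfl
    rw [e]
    exact (((differentiable_im w).pow 2).const_mul _).cexp
  have hk0 : k w ≠ 0 := by simp only [hk]; exact_mod_cast (Real.exp_pos _).ne'
  have hdet : (H w).det ≠ 0 := by
    rw [hH.self_of_nhds, Matrix.det_smul, Matrix.det_mul, Matrix.det_mul,
      Matrix.det_conjTranspose]
    exact mul_ne_zero (pow_ne_zero _ hk0) (mul_ne_zero (mul_ne_zero h0 hC)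
      (star_ne_zero.2 h0))
  -- The factor `Aᴴ` is antiholomorphic and is annihilated by ∂; only the weight and `A` are
  -- differentiated.
  have hent : ∀ j l, del (fun u => H u j l) v w =
      (-Complex.I * a * w.im * v) * H w j l +
        v * (k w * ((Matrix.of fun j k => deriv (fun u => A u j k) w) * C * (A w)ᴴ) j l) := by
    intro j l
    have e1 : (fun u => H u j l) =ᶠ[𝓝 w] fun u => k u * ∑ q, ∑ i, A u j i *
        (C i q * (starRingEnd ℂ) (A u l q)) := by
      filter_upwards [hH] with u hu
      rw [hu, Matrix.smul_apply, Matrix.mul_apply, smul_eq_mul]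
      congr 1
      refine Finset.sum_congr rfl fun q _ => ?_
      rw [Matrix.mul_apply, Finset.sum_mul]
      refine Finset.sum_congr rfl fun i _ => ?_
      rw [Matrix.conjTranspose_apply, mul_assoc]; rfl
    have hAr : ∀ i j, DifferentiableAt ℝ (fun u => A u i j) w := fun i j =>
      (hA i j).restrictScalars ℝ
    have hAc : ∀ i j, DifferentiableAt ℝ (fun u => (starRingEnd ℂ) (A u i j)) w := fun i j =>
      Complex.conjCLE.differentiableAt.comp w (hAr i j)
    have hD : ∀ i q, DifferentiableAt ℝ (fun u => A u j i *
        (C i q * (starRingEnd ℂ) (A u l q))) w := fun i q =>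
      (hAr _ _).mul ((hAc _ _).const_mul _)
    rw [del_congr e1, del_mul hkd (DifferentiableAt.fun_sum fun q _ =>
      DifferentiableAt.fun_sum fun i _ => hD i q), del_gauss, show H w j l = _ from e1.self_of_nhds]
    rw [del_sum _ fun q _ => DifferentiableAt.fun_sum fun i _ => hD i q]
    have e2 : ∀ q, del (fun u => ∑ i, A u j i * (C i q * (starRingEnd ℂ) (A u l q))) v w =
        ∑ i, v * deriv (fun u => A u j i) w * (C i q * (starRingEnd ℂ) (A w l q)) := by
      intro q
      rw [del_sum _ fun i _ => hD i q]
      refine Finset.sum_congr rfl fun i _ => ?_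
      rw [del_mul (hAr _ _) ((hAc _ _).const_mul _), del_of_complex (hA _ _),
        del_mul (differentiableAt_const _) (hAc _ _), del_conj_of_complex (hA _ _)]
      have : del (fun _ => C i q) v w = 0 := by simp [del]
      rw [this]; ring
    simp only [e2]
    rw [mul_assoc]
    congr 1
    rw [Matrix.mul_apply]
    simp only [Matrix.mul_apply, Matrix.of_apply, Matrix.conjTranspose_apply, Finset.mul_sum,
      Finset.sum_mul]
    refine Finset.sum_congr rfl fun q _ => Finset.sum_congr rfl fun i _ => ?_
    simp only [starRingEnd_apply]
    ring
  -- Since `k C Aᴴ = A⁻¹ H`, the whole of ∂H is a multiple of `H` from the left, and `H⁻¹` then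
  -- cancels.
  have hmat : (Matrix.of fun j k => del (fun u => H u j k) v w) =
      ((-Complex.I * a * w.im * v) • (1 : Matrix (Fin n) (Fin n) ℂ) +
        v • ((Matrix.of fun j k => deriv (fun u => A u j k) w) * (A w)⁻¹)) * H w := by
    have h1 : (Matrix.of fun j k => deriv (fun u => A u j k) w) * (A w)⁻¹ * H w =
        k w • ((Matrix.of fun j k => deriv (fun u => A u j k) w) * C * (A w)ᴴ) := by
      rw [hH.self_of_nhds, Matrix.mul_smul]
      congr 1
      rw [Matrix.mul_assoc, Matrix.mul_assoc (A w), Matrix.nonsing_inv_mul_cancel_left _ _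
        (isUnit_iff_ne_zero.2 h0), Matrix.mul_assoc]
    rw [Matrix.add_mul, Matrix.smul_mul, Matrix.one_mul, Matrix.smul_mul, h1]
    ext j l
    rw [Matrix.of_apply, hent]
    simp
  rw [hmat, Matrix.mul_assoc, Matrix.mul_nonsing_inv _ (isUnit_iff_ne_zero.2 hdet), Matrix.mul_one]

/-- In the connection matrix of `conn_eq` the term A'A⁻¹ is holomorphic and drops out. The scalar
term gives (-i a v')·(i v̄/2) = a v' v̄/2. -/
theorem delbar_conn_eq {n : ℕ} {A H : ℂ → Matrix (Fin n) (Fin n) ℂ}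
    {C : Matrix (Fin n) (Fin n) ℂ} {a : ℝ} {w : ℂ}
    (hA : ∀ᶠ u in 𝓝 w, ∀ i j, DifferentiableAt ℂ (fun u => A u i j) u)
    (h0 : ∀ᶠ u in 𝓝 w, (A u).det ≠ 0) (hC : C.det ≠ 0)
    (hH : ∀ᶠ u in 𝓝 w, H u = ((Real.exp (a * u.im ^ 2) : ℝ) : ℂ) • (A u * C * (A u)ᴴ))
    (v v' : ℂ) (j l : Fin n) :
    delbar (fun u => ((Matrix.of fun j k => del (fun u => H u j k) v' u) * (H u)⁻¹) j l) v w =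
      (a / 2 * (v' * (starRingEnd ℂ) v)) * (1 : Matrix (Fin n) (Fin n) ℂ) j l := by
  set N : ℂ → ℂ := fun u =>
    ((Matrix.of fun j k => deriv (fun u => A u j k) u) * (A u)⁻¹) j l with hN
  have hNd : DifferentiableAt ℂ N w := by
    have h1 : ∀ i j, DifferentiableAt ℂ (deriv fun u => A u i j) w := fun i j => by
      have : AnalyticAt ℂ (fun u => A u i j) w :=
        Complex.analyticAt_iff_eventually_differentiableAt.2 (by
          filter_upwards [hA] with u hu using hu i j)
      exact this.deriv.differentiableAt
    simp only [hN, Matrix.mul_apply, Matrix.of_apply]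
    exact DifferentiableAt.fun_sum fun i _ => (h1 _ _).mul
      (differentiableAt_inv_entry hA.self_of_nhds h0.self_of_nhds _ _)
  have e : (fun u => ((Matrix.of fun j k => del (fun u => H u j k) v' u) * (H u)⁻¹) j l) =ᶠ[𝓝 w]
      fun u => (-Complex.I * a * v' * (1 : Matrix (Fin n) (Fin n) ℂ) j l) * (u.im : ℂ) +
        v' * N u := by
    filter_upwards [hA, h0, hH.eventually_nhds] with u h1 h2 h3
    rw [conn_eq h1 h2 hC h3]
    simp only [Matrix.add_apply, Matrix.smul_apply, smul_eq_mul, hN]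
    ring
  rw [delbar_congr e, delbar_add ((differentiable_im w).const_mul _)
    ((hNd.const_mul _).restrictScalars ℝ), delbar_of_complex (hNd.const_mul _), add_zero]
  have h2 : ∀ c : ℂ, delbar (fun u : ℂ => c * (u.im : ℂ)) v w =
      c * delbar (fun u : ℂ => (u.im : ℂ)) v w := by
    intro c
    simp only [delbar, fderiv_const_mul (differentiable_im w), smul_apply, smul_eq_mul]
    ring
  rw [h2, delbar_im]
  linear_combination (-(a / 2 * v' * (starRingEnd ℂ) v * (1 : Matrix (Fin n) (Fin n) ℂ) j l)) *
    Complex.I_mul_I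

variable {X : Type} [TopologicalSpace X] {p : ℂ → X} {E : HolBundle p} {Γ : AddSubgroup ℂ} {n : ℕ}

theorem Sesq.expand (B : Sesq (Fin n → ℂ)) (x y : Fin n → ℂ) :
    B x y = ∑ l, (∑ i, x i * B (Pi.single i 1) (Pi.single l 1)) * (starRingEnd ℂ) (y l) := by
  conv_lhs => rw [pi_eq_sum_univ' y]
  rw [map_sum]
  refine Finset.sum_congr rfl fun l _ => ?_
  conv_lhs => rw [pi_eq_sum_univ' x]
  simp only [map_smulₛₗ, map_sum, LinearMap.sum_apply, LinearMap.smul_apply, smul_eq_mul,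
    RingHom.id_apply]
  ring

/-- The matrix of a positive definite form is invertible. -/
theorem IsPosHerm.det_ne_zero {B : Sesq (Fin n → ℂ)} (hB : IsPosHerm B) :
    (Matrix.of fun i j => B (Pi.single i 1) (Pi.single j 1)).det ≠ 0 := by
  intro h0
  obtain ⟨v, hv, hv0⟩ := Matrix.exists_vecMul_eq_zero_iff.2 h0
  have h3 : B v v = 0 := by
    rw [Sesq.expand]
    refine Finset.sum_eq_zero fun l _ => ?_
    have h2 := congrFun hv0 l
    simp only [Matrix.vecMul, dotProduct, Matrix.of_apply, Pi.zero_apply] at h2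
    rw [h2, zero_mul]
  have := hB.pos v hv
  rw [h3] at this
  simp at this

/-- Every holomorphic frame near `x` has the Gram matrix exp(a u₂²) A C Aᴴ with `A` holomorphic, so
its curvature matrix is the same scalar matrix. A scalar matrix represents the same endomorphism in
every frame, hence the condition defining `curvature` can be met. -/
theorem LiftTriv.curvature_eq (L : LiftTriv E (Fin n → ℂ) Γ) (hp : IsCov p Γ)
    {B : Sesq (Fin n → ℂ)} (hB : IsPosHerm B) {a : ℝ} {h : ∀ x, E.Fib x → E.Fib x → ℂ}
    (hh : ∀ x w (hw : p w = x) u v,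
      h x u v = (Real.exp (a * w.im ^ 2) : ℝ) * B (L.T x w hw u) (L.T x w hw v))
    (x : X) (v v' : ℂ) :
    curvature h x v v' =
      (a / 2 * (v' * (starRingEnd ℂ) v) - a / 2 * (v * (starRingEnd ℂ) v') : ℂ) •
        LinearMap.id := by
  set c : ℂ := a / 2 * (v' * (starRingEnd ℂ) v) - a / 2 * (v * (starRingEnd ℂ) v') with hc
  have key : ∀ (r : ℕ) (e : Fin r → ∀ y, E.Fib y) (w : ℂ), p w = x → IsFrame E x e →
      ∀ j, c • e j x = ∑ l, curvMatrix h e v v' w j l • e l x := by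
    rintro r e w rfl he j
    obtain ⟨hli, hsp⟩ := he.basis.self_of_nhds
    -- A frame comes with its own rank, which must agree with the dimension of the fibre.
    have hr : r = n := by
      have h1 := Module.finrank_eq_card_basis
        ((Module.Basis.mk hli hsp.ge).map (L.T (p w) w rfl))
      simpa using h1.symm
    subst hr
    let A : ℂ → Matrix (Fin r) (Fin r) ℂ := fun u => Matrix.of fun j i =>
      L.T (p u) u rfl (e j (p u)) i
    let C : Matrix (Fin r) (Fin r) ℂ := Matrix.of fun i j => B (Pi.single i 1) (Pi.single j 1)
    have hA : ∀ᶠ u in 𝓝 w, ∀ i j, DifferentiableAt ℂ (fun u => A u i j) u := by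
      have h1 : ∀ i, e i ∈ E.hol (p w) := fun i => (he.hol.self_of_nhds (e i)).2
        ⟨fun k _ => if k = i then 1 else 0, fun k => HolFunAt.const _,
          Eventually.of_forall fun y => by simp⟩
      rw [eventually_all]
      intro i
      filter_upwards [(L.hol_iff_one hp w (e i)).1 (h1 i)] with u hu j
      exact differentiableAt_pi.1 hu j
    have h0 : ∀ᶠ u in 𝓝 w, (A u).det ≠ 0 := by
      filter_upwards [hp.eventually.1 he.basis] with u hu
      have h1 := hu.1.map' (L.T (p u) u rfl).toLinearMap (LinearEquiv.ker _)
      have h2 : IsUnit (A u) := Matrix.linearIndependent_rows_iff_isUnit.1 h1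
      exact ((Matrix.isUnit_iff_isUnit_det _).1 h2).ne_zero
    have hH : ∀ u, gram h e u = ((Real.exp (a * u.im ^ 2) : ℝ) : ℂ) • (A u * C * (A u)ᴴ) := by
      intro u
      ext j l
      refine (hh (p u) u rfl (e j (p u)) (e l (p u))).trans ?_
      rw [Sesq.expand]
      simp [Matrix.mul_apply, A, C]
    have h3 : ∀ j l, curvMatrix h e v v' w j l = c * (1 : Matrix (Fin r) (Fin r) ℂ) j l := by
      intro j l
      have h4 := fun v v' => delbar_conn_eq hA h0 hB.det_ne_zero (Eventually.of_forall hH) v v' j l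
      refine (congrArg₂ (· - ·) (h4 v v') (h4 v' v)).trans ?_
      simp only [hc]; ring
    simp [h3, Matrix.one_apply]
  obtain ⟨w, rfl⟩ := hp.surj x
  -- `key` proves that an endomorphism with the defining property exists; the existence of one frame
  -- then makes it unique.
  have hspec := Classical.epsilon_spec
    (p := fun R : E.Fib (p w) →ₗ[ℂ] E.Fib (p w) => ∀ (r : ℕ) (e : Fin r → ∀ y, E.Fib y) (w' : ℂ),
      p w' = p w → IsFrame E (p w) e → ∀ j, R (e j (p w)) =
        ∑ l, curvMatrix h e v v' w' j l • e l (p w)) ⟨c • LinearMap.id, key⟩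
  obtain ⟨e, he⟩ := L.isHolBundle hp (r := n) (by simp) (p w)
  obtain ⟨hli, hsp⟩ := he.basis.self_of_nhds
  refine LinearMap.ext_on_range hsp fun j => ?_
  exact (hspec n e w rfl he j).trans (key n e w rfl he j).symm

end Curvature

/-! ### Theta functions of degree one -/

section DegreeOne

theorem cexp_two_pi_int (n : ℤ) : Complex.exp (2 * Real.pi * Complex.I * n) = 1 := by
  rw [mul_comm]; exact Complex.exp_int_mul_two_pi_mul_I n

/-- The horizontal period integral of an entire periodic function does not depend on the height. -/
theorem integral_period_eq {G : ℂ → ℂ} (hG : Differentiable ℂ G) (h1 : ∀ z, G (z + 1) = G z)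
    (c : ℂ) : ∫ x in (0 : ℝ)..1, G (x + c) = ∫ x in (0 : ℝ)..1, G x := by
  have hper : Function.Periodic (fun x : ℝ => G (x + c.im * Complex.I)) 1 := fun x => by
    simp only
    rw [← h1 (x + c.im * Complex.I)]
    push_cast; ring_nf
  have h2 : ∫ x in (0 : ℝ)..1, G (x + c) = ∫ x in (0 : ℝ)..1, G (x + c.im * Complex.I) := by
    have h3 := hper.intervalIntegral_add_eq c.re 0
    rw [zero_add] at h3
    rw [← h3]
    have h4 := intervalIntegral.integral_comp_add_right (a := 0) (b := 1)
      (fun x : ℝ => G (x + c.im * Complex.I)) c.re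
    rw [zero_add, add_comm (1 : ℝ)] at h4
    rw [← h4]
    refine intervalIntegral.integral_congr fun x _ => ?_
    congr 1
    conv_lhs => rw [← Complex.re_add_im c]
    push_cast; ring
  have h5 := Complex.integral_boundary_rect_eq_zero_of_differentiableOn G 0 (1 + c.im * Complex.I)
    hG.differentiableOn
  have e1 : (1 + (c.im : ℂ) * Complex.I).re = 1 := by simp
  have e2 : (1 + (c.im : ℂ) * Complex.I).im = c.im := by simp
  rw [e1, e2] at h5
  -- By periodicity the two vertical sides of the rectangle cancel in Cauchy's theorem.
  have h6 : ∀ y : ℝ, G (((1 : ℝ) : ℂ) + y * Complex.I) = G (((0 : ℂ).re : ℂ) + y * Complex.I) := by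
    intro y
    rw [← h1 (((0 : ℂ).re : ℂ) + y * Complex.I)]
    congr 1
    simp; ring
  simp only [h6] at h5
  rw [h2]
  simp only [Complex.zero_re, Complex.zero_im, Complex.ofReal_zero, zero_mul, add_zero] at h5
  linear_combination -h5

/-- A continuous function of period one whose Fourier coefficients vanish is zero. -/
theorem eq_zero_of_fourier {g : ℝ → ℂ} (hg : Continuous g) (h1 : Function.Periodic g 1)
    (h0 : ∀ n : ℤ, ∫ x in (0 : ℝ)..1, Complex.exp (2 * Real.pi * Complex.I * n * x) * g x = 0)
    (x : ℝ) : g x = 0 := by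
  let f : C(AddCircle (1 : ℝ), ℂ) := ⟨h1.lift, by
    refine continuous_coinduced_dom.2 ?_
    exact hg⟩
  have hf : ∀ x : ℝ, f (x : AddCircle (1 : ℝ)) = g x := fun x => h1.lift_coe x
  have hc : ∀ n, fourierCoeff f n = 0 := by
    intro n
    rw [fourierCoeff_eq_intervalIntegral f n 0]
    have h2 := h0 (-n)
    rw [zero_add]
    refine smul_eq_zero_of_right _ (Eq.trans ?_ h2)
    refine intervalIntegral.integral_congr fun x _ => ?_
    simp only [hf, fourier_coe_apply, smul_eq_mul]
    simp
  have h2 := has_pointwise_sum_fourier_series_of_summable (f := f)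
    (by rw [show fourierCoeff f = fun _ => 0 from funext hc]; exact summable_zero) x
  simp only [hc, zero_smul] at h2
  rw [← hf]
  exact h2.unique hasSum_zero

/-- Identity theorem, with the zeros 1/(n+1) accumulating at 0. -/
theorem eq_zero_of_real {f : ℂ → ℂ} (hf : Differentiable ℂ f) (h : ∀ x : ℝ, f x = 0) : f = 0 := by
  have h1 : AnalyticOnNhd ℂ f Set.univ := fun z _ => hf.analyticAt z
  have h2 : ∃ᶠ z in 𝓝[≠] (0 : ℂ), f z = (0 : ℂ → ℂ) z := by
    have h3 : Tendsto (fun n : ℕ => (((1 / ((n : ℝ) + 1) : ℝ)) : ℂ)) atTop (𝓝[≠] 0) := by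
      rw [tendsto_nhdsWithin_iff]
      constructor
      · have := (Complex.continuous_ofReal.tendsto 0).comp
          (tendsto_one_div_add_atTop_nhds_zero_nat (𝕜 := ℝ))
        rwa [Complex.ofReal_zero] at this
      · refine Eventually.of_forall fun n => ?_
        have : (1 / ((n : ℝ) + 1) : ℝ) ≠ 0 := by positivity
        exact Complex.ofReal_ne_zero.2 this
    exact h3.frequently (Frequently.of_forall fun n => h _)
  exact h1.eq_of_frequently_eq (fun z _ => differentiable_const (0 : ℂ) |>.analyticAt z) h2

variable {τ : ℂ}

/-- Moving the period integral by τ relates consecutive Fourier coefficients by nonzero factors. If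
the mean vanishes, so do all of them. -/
theorem theta_eq_zero {f : ℂ → ℂ} (hf : Differentiable ℂ f) (h1 : ∀ z, f (z + 1) = f z)
    (hτ : ∀ z, f (z + τ) =
      Complex.exp (-2 * Real.pi * Complex.I * z - Real.pi * Complex.I * τ) * f z)
    (h0 : ∫ x in (0 : ℝ)..1, f x = 0) : f = 0 := by
  let a : ℤ → ℂ := fun n =>
    ∫ x in (0 : ℝ)..1, Complex.exp (2 * Real.pi * Complex.I * n * x) * f x
  have hstep : ∀ n : ℤ, ∃ c : ℂ, c ≠ 0 ∧ a n = c * a (n - 1) := by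
    intro n
    let G : ℂ → ℂ := fun z => Complex.exp (2 * Real.pi * Complex.I * n * z) * f z
    have hG : Differentiable ℂ G :=
      (Complex.differentiable_exp.comp (differentiable_id.const_mul _)).mul hf
    have hG1 : ∀ z, G (z + 1) = G z := fun z => by
      simp only [G, h1, mul_add, Complex.exp_add, mul_one, cexp_two_pi_int]
    -- exp(2πin(x+τ)) times the multiplier exp(-2πix - πiτ) equals this constant times
    -- exp(2πi(n-1)x).
    refine ⟨Complex.exp (2 * Real.pi * Complex.I * n * τ - Real.pi * Complex.I * τ),
      Complex.exp_ne_zero _, ?_⟩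
    have h2 := integral_period_eq hG hG1 τ
    refine h2.symm.trans ?_
    rw [← intervalIntegral.integral_const_mul]
    refine intervalIntegral.integral_congr fun x _ => ?_
    simp only [G, hτ]
    rw [← mul_assoc, ← mul_assoc, ← Complex.exp_add, ← Complex.exp_add]
    congr 2
    push_cast; ring
  have ha : ∀ n, a n = 0 := by
    intro n
    induction n using Int.induction_on with
    | zero => simpa [a] using h0
    | succ n ih =>
      obtain ⟨c, _, h⟩ := hstep (n + 1)
      rw [h, add_sub_cancel_right, ih, mul_zero]
    | pred n ih =>
      obtain ⟨c, hc, h⟩ := hstep (-n)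
      rw [ih] at h
      exact (mul_eq_zero.1 h.symm).resolve_left hc
  refine eq_zero_of_real hf fun x => ?_
  refine eq_zero_of_fourier (g := fun x : ℝ => f x) (hf.continuous.comp Complex.continuous_ofReal)
    (fun x => ?_) ha x
  simp only
  rw [← h1 x]
  push_cast; rfl

theorem integral_cexp_int (n : ℤ) :
    ∫ x in (0 : ℝ)..1, Complex.exp (2 * Real.pi * Complex.I * n * x) = if n = 0 then 1 else 0 := by
  split_ifs with h
  · simp [h]
  · have hc : 2 * Real.pi * Complex.I * n ≠ 0 :=
      mul_ne_zero Complex.two_pi_I_ne_zero (by exact_mod_cast h)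
    rw [integral_exp_mul_complex hc]
    simp [cexp_two_pi_int]

/-- Only the term with n = 0 of the theta series has nonzero mean. -/
theorem integral_jacobiTheta (hτ : 0 < τ.im) :
    ∫ x in (0 : ℝ)..1, jacobiTheta₂ x τ = 1 := by
  let f : ℤ → C(ℝ, ℂ) := fun n => ⟨fun x => jacobiTheta₂_term n x τ, by
    unfold jacobiTheta₂_term; fun_prop⟩
  have hsum : Summable fun n : ℤ => ‖jacobiTheta₂_term n 0 τ‖ :=
    ((summable_jacobiTheta₂_term_iff 0 τ).2 hτ).norm
  have h1 := intervalIntegral.hasSum_intervalIntegral_of_summable_norm (a := 0) (b := 1) (f := f)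
    (Summable.of_nonneg_of_le (fun n => norm_nonneg _) (fun n => by
      rw [ContinuousMap.norm_le _ (norm_nonneg _)]
      intro x
      simp [f, norm_jacobiTheta₂_term]) hsum)
  have h2 : ∀ n, ∫ x in (0 : ℝ)..1, f n x = if n = 0 then 1 else 0 := by
    intro n
    have : ∀ x : ℝ, f n x = Complex.exp (Real.pi * Complex.I * n ^ 2 * τ) *
        Complex.exp (2 * Real.pi * Complex.I * n * x) := fun x => by
      simp only [f, ContinuousMap.coe_mk, jacobiTheta₂_term, Complex.exp_add]
      ring
    simp only [this]
    rw [intervalIntegral.integral_const_mul, integral_cexp_int]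
    split_ifs with h
    · simp [h]
    · simp
  simp only [h2] at h1
  have h3 := h1.unique (hasSum_ite_eq (0 : ℤ) (1 : ℂ))
  exact h3

/-- Subtracting the mean of `f` times ϑ, which has mean 1, leaves a function with mean zero, to
which `theta_eq_zero` applies. -/
theorem exists_eq_jacobiTheta (hτ0 : 0 < τ.im) {f : ℂ → ℂ} (hf : Differentiable ℂ f)
    (h1 : ∀ z, f (z + 1) = f z)
    (hτ : ∀ z, f (z + τ) =
      Complex.exp (-2 * Real.pi * Complex.I * z - Real.pi * Complex.I * τ) * f z) :
    ∃ c : ℂ, ∀ z, f z = c * jacobiTheta₂ z τ := by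
  have hd : Differentiable ℂ fun z => jacobiTheta₂ z τ := fun z =>
    differentiableAt_jacobiTheta₂_fst z hτ0
  refine ⟨∫ x in (0 : ℝ)..1, f x, fun z => ?_⟩
  have h2 : (fun z => f z - (∫ x in (0 : ℝ)..1, f x) * jacobiTheta₂ z τ) = 0 := by
    refine theta_eq_zero (τ := τ) (hf.sub (hd.const_mul _)) (fun z => ?_) (fun z => ?_) ?_
    · rw [h1, jacobiTheta₂_add_left]
    · rw [hτ, jacobiTheta₂_add_left',
        show (-Real.pi * Complex.I * (τ + 2 * z) : ℂ) =
          -2 * Real.pi * Complex.I * z - Real.pi * Complex.I * τ by ring]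
      ring
    · rw [intervalIntegral.integral_sub, intervalIntegral.integral_const_mul,
        integral_jacobiTheta hτ0, mul_one, sub_self]
      · exact (hf.continuous.comp Complex.continuous_ofReal).intervalIntegrable _ _
      · exact (continuous_const.mul
          (hd.continuous.comp Complex.continuous_ofReal)).intervalIntegrable _ _
  exact sub_eq_zero.1 (congrFun h2 z)

end DegreeOne

/-! ### The space of sections of L₀ and its dimension δ -/

section ThetaSpace

variable (δ : ℕ+) (τ : ℍ)

/-- The multiplier `exp (-2πiz - πiτ)`. -/
def thetaMult (z : ℂ) : ℂ :=
  Complex.exp (-2 * Real.pi * Complex.I * z - Real.pi * Complex.I * τ)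

/-- The entire functions that are sections of `L₀`. -/
def ThetaSpace : Submodule ℂ (ℂ → ℂ) where
  carrier := {f | Differentiable ℂ f ∧ (∀ z, f (z + (δ : ℕ)) = f z) ∧
    ∀ z, f (z + τ) = thetaMult τ z * f z}
  zero_mem' := ⟨differentiable_const 0, fun _ => rfl, fun _ => by simp⟩
  add_mem' {f g} hf hg := ⟨hf.1.add hg.1, fun z => by simp [hf.2.1 z, hg.2.1 z],
    fun z => by simp [hf.2.2 z, hg.2.2 z, mul_add]⟩
  smul_mem' c f hf := ⟨hf.1.const_smul c, fun z => by simp [hf.2.1 z],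
    fun z => by simp [hf.2.2 z]; ring⟩

/-- The root of unity `exp (2πi m / δ)`. -/
def rootU (m : ℤ) : ℂ := Complex.exp (2 * Real.pi * Complex.I * (m / (δ : ℕ)))

variable {δ} in
theorem delta_ne : ((δ : ℕ) : ℂ) ≠ 0 := by exact_mod_cast δ.pos.ne'

theorem rootU_add (m n : ℤ) : rootU δ (m + n) = rootU δ m * rootU δ n := by
  rw [rootU, rootU, rootU, ← Complex.exp_add]
  congr 1; push_cast; ring

theorem rootU_zero : rootU δ 0 = 1 := by simp [rootU]

theorem rootU_mul_delta (m : ℤ) : rootU δ (m * (δ : ℕ)) = 1 := by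
  rw [rootU, ← cexp_two_pi_int m]
  congr 1
  have := delta_ne (δ := δ)
  push_cast; field_simp

theorem rootU_pow (m : ℤ) (j : ℕ) : rootU δ m ^ j = rootU δ (m * j) := by
  rw [rootU, rootU, ← Complex.exp_nat_mul]
  congr 1; push_cast; ring

theorem dvd_of_rootU {m : ℤ} (h : rootU δ m = 1) : ((δ : ℕ) : ℤ) ∣ m := by
  rw [rootU, Complex.exp_eq_one_iff] at h
  obtain ⟨n, hn⟩ := h
  refine ⟨n, ?_⟩
  have h1 : (m / (δ : ℕ) : ℂ) = n := by
    have := Complex.two_pi_I_ne_zero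
    apply mul_left_cancel₀ this
    rw [hn]; ring
  rw [div_eq_iff delta_ne] at h1
  have h2 : (m : ℂ) = ((n * (δ : ℕ) : ℤ) : ℂ) := by rw [h1]; push_cast; rfl
  rw [mul_comm]
  exact_mod_cast h2

theorem sum_rootU (m : ℤ) : ∑ j ∈ Finset.range δ, rootU δ (m * j) =
    if ((δ : ℕ) : ℤ) ∣ m then ((δ : ℕ) : ℂ) else 0 := by
  split_ifs with h
  · obtain ⟨n, rfl⟩ := h
    have : ∀ j : ℕ, rootU δ ((δ : ℕ) * n * j) = 1 := fun j => by
      rw [show (((δ : ℕ) : ℤ) * n * j) = (n * j) * (δ : ℕ) by ring, rootU_mul_delta]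
    simp [this]
  · have h1 : rootU δ m ≠ 1 := fun h1 => h (dvd_of_rootU δ h1)
    simp only [← rootU_pow]
    have h2 := mul_geom_sum (rootU δ m) δ
    rw [rootU_pow, rootU_mul_delta, sub_self] at h2
    exact (mul_eq_zero.1 h2).resolve_left (sub_ne_zero.2 h1)

/-- The theta functions `exp (2πikz/δ) ϑ(z + kτ/δ, τ)`. -/
def thetaFun (k : ℤ) (z : ℂ) : ℂ :=
  Complex.exp (2 * Real.pi * Complex.I * (k * z / (δ : ℕ))) *
    jacobiTheta₂ (z + k * τ / (δ : ℕ)) τ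

theorem thetaFun_differentiable (k : ℤ) : Differentiable ℂ (thetaFun δ τ k) := by
  intro z
  refine DifferentiableAt.mul (by fun_prop) ?_
  exact DifferentiableAt.comp (g := fun z => jacobiTheta₂ z τ) z
    (differentiableAt_jacobiTheta₂_fst _ τ.im_pos) (by fun_prop)

/-- Translation by 1 acts on `thetaFun k` by the character `rootU k`; these characters separate the
δ basis functions. -/
theorem thetaFun_add_one (k : ℤ) (z : ℂ) :
    thetaFun δ τ k (z + 1) = rootU δ k * thetaFun δ τ k z := by
  rw [thetaFun, thetaFun, add_right_comm z 1, jacobiTheta₂_add_left, rootU, ← mul_assoc,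
    ← Complex.exp_add]
  congr 2
  ring

theorem thetaFun_add_nat (k : ℤ) (z : ℂ) (j : ℕ) :
    thetaFun δ τ k (z + j) = rootU δ (k * j) * thetaFun δ τ k z := by
  induction j with
  | zero => simp [rootU_zero]
  | succ j ih =>
    rw [Nat.cast_succ, ← add_assoc, thetaFun_add_one, ih, ← mul_assoc, ← rootU_add]
    congr 2
    push_cast; ring

theorem thetaFun_add_tau (k : ℤ) (z : ℂ) :
    thetaFun δ τ k (z + τ) = thetaMult τ z * thetaFun δ τ k z := by
  rw [thetaFun, thetaFun, add_right_comm z (τ : ℂ), jacobiTheta₂_add_left', thetaMult, ← mul_assoc,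
    ← mul_assoc, ← Complex.exp_add, ← Complex.exp_add]
  congr 2
  have := delta_ne (δ := δ)
  field_simp
  ring

theorem thetaFun_mem (k : ℤ) : thetaFun δ τ k ∈ ThetaSpace δ τ :=
  ⟨thetaFun_differentiable δ τ k, fun z => by
    rw [thetaFun_add_nat, rootU_mul_delta, one_mul], thetaFun_add_tau δ τ k⟩

/-- ϑ has mean 1 over a period, hence is not identically zero. -/
theorem exists_thetaFun_ne_zero (k : ℤ) : ∃ z, thetaFun δ τ k z ≠ 0 := by
  by_contra! h
  have h1 : ∀ z, jacobiTheta₂ z τ = 0 := fun z => by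
    have h2 := h (z - k * τ / (δ : ℕ))
    rw [thetaFun, sub_add_cancel] at h2
    exact (mul_eq_zero.1 h2).resolve_left (Complex.exp_ne_zero _)
  have h2 := integral_jacobiTheta τ.im_pos
  simp [h1] at h2

/-- The isotypical component of `f` for the translations by integers. -/
def thetaProj (k : ℤ) (f : ℂ → ℂ) (z : ℂ) : ℂ :=
  ((δ : ℕ) : ℂ)⁻¹ * ∑ j ∈ Finset.range δ, rootU δ (-k * j) * f (z + j)

variable {δ τ} in
-- The summation index is shifted by one; δ-periodicity makes the two end terms equal.
theorem thetaProj_add_one {f : ℂ → ℂ} (hf : ∀ z, f (z + (δ : ℕ)) = f z) (k : ℤ) (z : ℂ) :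
    thetaProj δ k f (z + 1) = rootU δ k * thetaProj δ k f z := by
  have h1 : ∑ j ∈ Finset.range δ, rootU δ (-k * (j + 1 : ℕ)) * f (z + (j + 1 : ℕ)) =
      ∑ j ∈ Finset.range δ, rootU δ (-k * j) * f (z + j) := by
    have h2 := Finset.sum_range_succ (fun j : ℕ => rootU δ (-k * j) * f (z + j)) δ
    rw [Finset.sum_range_succ'] at h2
    rw [hf, rootU_mul_delta] at h2
    simp only [Nat.cast_zero, mul_zero, rootU_zero, add_zero] at h2
    exact add_right_cancel h2
  rw [thetaProj, thetaProj, ← h1, mul_left_comm, Finset.mul_sum _ _ (rootU δ k)]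
  congr 1
  refine Finset.sum_congr (M := ℂ) rfl fun j _ => ?_
  rw [← mul_assoc, ← rootU_add]
  congr 2
  · push_cast; ring
  · push_cast; ring

theorem thetaMult_add_nat (z : ℂ) (j : ℕ) : thetaMult τ (z + j) = thetaMult τ z := by
  have h := cexp_two_pi_int (-j)
  rw [thetaMult, thetaMult, ← mul_one (Complex.exp (-2 * Real.pi * Complex.I * z - _)), ← h,
    ← Complex.exp_add]
  congr 1; push_cast; ring

variable {δ τ} in
-- The isotypical component transforms by a character under translation by 1. An exponential factor
-- and a shift by kτ/δ turn it into a theta function of degree one, which is a multiple of ϑ.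
theorem thetaProj_eq {f : ℂ → ℂ} (hf : f ∈ ThetaSpace δ τ) (k : ℤ) :
    ∃ c : ℂ, ∀ z, thetaProj δ k f z = c * thetaFun δ τ k z := by
  obtain ⟨hd, h1, h2⟩ := hf
  have hδ := delta_ne (δ := δ)
  set s : ℂ := k * τ / (δ : ℕ) with hs
  have hP : Differentiable ℂ (thetaProj δ k f) := by
    refine Differentiable.const_mul (Differentiable.fun_sum fun j _ => ?_) _
    exact (hd.comp (differentiable_id.add_const _)).const_mul _
  have hPτ : ∀ z, thetaProj δ k f (z + τ) = thetaMult τ z * thetaProj δ k f z := fun z => by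
    rw [thetaProj, thetaProj, mul_left_comm, Finset.mul_sum _ _ (thetaMult τ z)]
    congr 1
    refine Finset.sum_congr (M := ℂ) rfl fun j _ => ?_
    rw [add_right_comm, h2, thetaMult_add_nat]; ring
  -- The inverse of the operations that produce `thetaFun k` from ϑ.
  let g : ℂ → ℂ := fun z =>
    Complex.exp (-(2 * Real.pi * Complex.I * (k * (z - s) / (δ : ℕ)))) * thetaProj δ k f (z - s)
  obtain ⟨c, hc⟩ := exists_eq_jacobiTheta τ.im_pos (f := g) (by
      intro z
      refine DifferentiableAt.mul (by fun_prop) ?_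
      exact (hP _).comp z (by fun_prop)) (fun z => by
      simp only [g]
      rw [add_sub_right_comm, thetaProj_add_one h1, rootU, ← mul_assoc, ← Complex.exp_add]
      congr 2
      ring) (fun z => by
      simp only [g]
      rw [add_sub_right_comm, hPτ, thetaMult, ← mul_assoc, ← mul_assoc, ← Complex.exp_add,
        ← Complex.exp_add]
      congr 2
      rw [hs]
      field_simp
      ring)
  refine ⟨c, fun z => ?_⟩
  have h3 := hc (z + s)
  simp only [g, add_sub_cancel_right] at h3
  rw [thetaFun, mul_left_comm, ← h3, ← mul_assoc, ← Complex.exp_add, add_neg_cancel,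
    Complex.exp_zero, one_mul]

variable {δ} in
-- Summing over all characters leaves only the translation with j = 0.
theorem sum_thetaProj (f : ℂ → ℂ) (z : ℂ) :
    ∑ k ∈ Finset.range δ, thetaProj δ k f z = f z := by
  simp only [thetaProj]
  rw [← Finset.mul_sum, Finset.sum_comm]
  have h1 : ∀ j ∈ Finset.range δ, ∑ k ∈ Finset.range δ, rootU δ (-(k : ℤ) * j) * f (z + j) =
      if j = 0 then (δ : ℕ) * f z else 0 := by
    intro j hj
    rw [← Finset.sum_mul]
    have h2 := sum_rootU δ (-(j : ℤ))
    have h3 : ∀ k : ℕ, -(k : ℤ) * j = -(j : ℤ) * k := fun k => by ring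
    simp only [h3, h2, dvd_neg, Int.natCast_dvd_natCast]
    have h4 : (δ : ℕ) ∣ j ↔ j = 0 := ⟨fun h => Nat.eq_zero_of_dvd_of_lt h (Finset.mem_range.1 hj),
      fun h => h ▸ dvd_zero _⟩
    simp only [h4]
    split_ifs with h
    · simp [h]
    · simp
  rw [Finset.sum_congr rfl h1, Finset.sum_ite_eq']
  simp [δ.pos]

theorem thetaProj_thetaFun (k l : Fin δ) (z : ℂ) :
    thetaProj δ (k : ℕ) (thetaFun δ τ (l : ℕ)) z = if k = l then thetaFun δ τ (l : ℕ) z else 0 := by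
  simp only [thetaProj, thetaFun_add_nat]
  simp only [← mul_assoc, ← rootU_add, ← add_mul, ← Finset.sum_mul]
  rw [sum_rootU]
  have h1 : ((δ : ℕ) : ℤ) ∣ -((k : ℕ) : ℤ) + ((l : ℕ) : ℤ) ↔ k = l := by
    constructor
    · intro h
      have h2 : -((k : ℕ) : ℤ) + ((l : ℕ) : ℤ) = 0 := by
        refine Int.eq_zero_of_abs_lt_dvd h ?_
        rw [abs_lt]
        have := k.2; have := l.2
        constructor <;> omega
      ext; omega
    · rintro rfl; simp
  simp only [h1]
  split_ifs
  · simp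
  · simp

/-- A point where `thetaFun k` does not vanish. -/
def thetaPt (k : ℤ) : ℂ := (exists_thetaFun_ne_zero δ τ k).choose

theorem thetaPt_spec (k : ℤ) : thetaFun δ τ k (thetaPt δ τ k) ≠ 0 :=
  (exists_thetaFun_ne_zero δ τ k).choose_spec

/-- The coefficient of `thetaFun k`, a combination of values of `f`. -/
def thetaCoef (f : ℂ → ℂ) (k : Fin δ) : ℂ :=
  thetaProj δ (k : ℕ) f (thetaPt δ τ (k : ℕ)) / thetaFun δ τ (k : ℕ) (thetaPt δ τ (k : ℕ))

variable {δ τ} in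
-- Each isotypical component is a multiple of `thetaFun k`, so its value at a single nonzero point
-- of `thetaFun k` determines the multiple.
theorem thetaCoef_spec {f : ℂ → ℂ} (hf : f ∈ ThetaSpace δ τ) (z : ℂ) :
    f z = ∑ k : Fin δ, thetaCoef δ τ f k * thetaFun δ τ (k : ℕ) z := by
  conv_lhs => rw [← sum_thetaProj (δ := δ) f z,
    ← Fin.sum_univ_eq_sum_range (fun k => thetaProj δ (k : ℕ) f z)]
  refine Finset.sum_congr rfl fun k _ => ?_
  obtain ⟨c, hc⟩ := thetaProj_eq hf (k : ℕ)
  rw [thetaCoef, hc, hc, mul_div_cancel_right₀ _ (thetaPt_spec δ τ _)]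

theorem thetaCoef_sum (c : Fin δ → ℂ) :
    thetaCoef δ τ (fun z => ∑ l : Fin δ, c l * thetaFun δ τ (l : ℕ) z) = c := by
  funext k
  have h1 : ∀ z, thetaProj δ (k : ℕ) (fun z => ∑ l : Fin δ, c l * thetaFun δ τ (l : ℕ) z) z =
      ∑ l : Fin δ, c l * thetaProj δ (k : ℕ) (thetaFun δ τ (l : ℕ)) z := fun z => by
    simp only [thetaProj, Finset.mul_sum]
    rw [Finset.sum_comm]
    refine Finset.sum_congr rfl fun l _ => Finset.sum_congr rfl fun j _ => ?_
    ring
  rw [thetaCoef, h1]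
  simp only [thetaProj_thetaFun, mul_ite, mul_zero, Finset.sum_ite_eq, Finset.mem_univ, if_true]
  exact mul_div_cancel_right₀ _ (thetaPt_spec δ τ _)

/-- `ThetaSpace` has dimension `δ`. -/
def thetaEquiv : ThetaSpace δ τ ≃ₗ[ℂ] (Fin δ → ℂ) where
  toFun f := thetaCoef δ τ f.1
  map_add' f g := by
    funext k
    simp [thetaCoef, thetaProj, mul_add, Finset.sum_add_distrib, add_div]
  map_smul' c f := by
    funext k
    simp only [thetaCoef, thetaProj, Submodule.coe_smul, Pi.smul_apply, smul_eq_mul,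
      RingHom.id_apply, mul_left_comm _ c, ← Finset.mul_sum, mul_div_assoc]
  invFun c := ⟨fun z => ∑ l : Fin δ, c l * thetaFun δ τ (l : ℕ) z, by
    have : (fun z => ∑ l : Fin δ, c l * thetaFun δ τ (l : ℕ) z) =
        ∑ l : Fin δ, c l • thetaFun δ τ (l : ℕ) := by
      funext z; simp
    rw [this]
    exact Submodule.sum_mem _ fun l _ => Submodule.smul_mem _ _ (thetaFun_mem δ τ _)⟩
  left_inv f := Subtype.ext (funext fun z => (thetaCoef_spec f.2 z).symm)
  right_inv c := thetaCoef_sum δ τ c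

end ThetaSpace

/-! ### Lattices, fundamental domain, and the inner product of theta functions -/

section Lattices

/-- Two points of a ball of radius r/2 differ by less than r, so they are congruent only if equal.
-/
theorem isCov_mk {W : Type} [NormedAddCommGroup W] (Γ : AddSubgroup W)
    (h : ∃ r > 0, ∀ l ∈ Γ, ‖l‖ < r → l = 0) : IsCov (fun w : W => (w : W ⧸ Γ)) Γ where
  surj := QuotientAddGroup.mk_surjective
  map_nhds w := (QuotientAddGroup.isOpenMap_coe (N := Γ)).map_nhds_eq
    QuotientAddGroup.continuous_mk.continuousAt
  inj w := by
    obtain ⟨r, hr, h⟩ := h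
    refine ⟨Metric.ball w (r / 2), Metric.ball_mem_nhds _ (by positivity), ?_⟩
    intro u hu v hv huv
    have h1 := h _ (QuotientAddGroup.eq.1 huv) (by
      rw [mem_ball_iff_norm] at hu hv
      calc ‖-u + v‖ = ‖(v - w) - (u - w)‖ := by congr 1; abel
        _ ≤ ‖v - w‖ + ‖u - w‖ := norm_sub_le _ _
        _ < r := by linarith)
    exact (neg_add_eq_zero.1 h1)
  deck w w' := by
    rw [QuotientAddGroup.eq, neg_add_eq_sub]

theorem IsCov.prodMap {W₁ X₁ W₂ X₂ : Type} [NormedAddCommGroup W₁] [NormedAddCommGroup W₂]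
    [NormedSpace ℂ W₁] [NormedSpace ℂ W₂] [TopologicalSpace X₁] [TopologicalSpace X₂]
    {p₁ : W₁ → X₁} {p₂ : W₂ → X₂}
    {Γ₁ : AddSubgroup W₁} {Γ₂ : AddSubgroup W₂} (h₁ : IsCov p₁ Γ₁) (h₂ : IsCov p₂ Γ₂) :
    IsCov (Prod.map p₁ p₂) (Γ₁.prod Γ₂) where
  surj := h₁.surj.prodMap h₂.surj
  map_nhds w := by
    rw [nhds_prod_eq, ← prod_map_map_eq', h₁.map_nhds, h₂.map_nhds, ← nhds_prod_eq]; rfl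
  inj w := by
    obtain ⟨U, hU, h3⟩ := h₁.inj w.1
    obtain ⟨V, hV, h4⟩ := h₂.inj w.2
    refine ⟨U ×ˢ V, prod_mem_nhds hU hV, ?_⟩
    intro a ha b hb hab
    exact Prod.ext (h3 ha.1 hb.1 (congrArg Prod.fst hab)) (h4 ha.2 hb.2 (congrArg Prod.snd hab))
  deck w w' := by
    rw [AddSubgroup.mem_prod, Prod.fst_sub, Prod.snd_sub, ← h₁.deck, ← h₂.deck]
    exact Prod.ext_iff

theorem mem_closure_two {a t l : ℂ} : l ∈ AddSubgroup.closure {a, t} ↔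
    ∃ m n : ℤ, l = m * a + n * t := by
  rw [AddSubgroup.mem_closure_pair]
  simp only [zsmul_eq_mul, eq_comm]

/-- The imaginary part of a short lattice vector kills the coefficient of `t`; then the real part
kills that of `a`. -/
theorem closure_discrete {a : ℝ} {t : ℂ} (ha : 0 < a) (ht : 0 < t.im) :
    ∃ r > 0, ∀ l ∈ AddSubgroup.closure {(a : ℂ), t}, ‖l‖ < r → l = 0 := by
  refine ⟨min a t.im, lt_min ha ht, fun l hl hr => ?_⟩
  obtain ⟨m, n, rfl⟩ := mem_closure_two.1 hl
  have h0 : ∀ (k : ℤ) (c : ℝ), 0 < c → |k * c| < c → k = 0 := by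
    intro k c hc h
    rw [abs_mul, abs_of_pos hc] at h
    have h2 : |(k : ℝ)| < 1 := by
      by_contra! h3
      nlinarith
    exact Int.abs_lt_one_iff.1 (by exact_mod_cast h2)
  have hn : n = 0 := by
    refine h0 n t.im ht ?_
    have h1 := (Complex.abs_im_le_norm _).trans_lt (hr.trans_le (min_le_right _ _))
    simpa using h1
  subst hn
  have hm : m = 0 := by
    refine h0 m a ha ?_
    have h1 := (Complex.abs_re_le_norm _).trans_lt (hr.trans_le (min_le_left _ _))
    simpa using h1
  simp [hm]

variable (δ : ℕ+) (τ : ℍ)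

theorem mem_lat {l : ℂ} : l ∈ lat δ τ ↔ ∃ m n : ℤ, l = m * (δ : ℕ) + n * τ := mem_closure_two

theorem mem_latHat {l : ℂ} : l ∈ latHat δ τ ↔ ∃ m n : ℤ, l = m + n * (τ / (δ : ℕ)) := by
  refine mem_closure_two.trans ?_
  simp only [mul_one]

theorem delta_pos : (0 : ℝ) < (δ : ℕ) := by exact_mod_cast δ.pos

theorem isCov_pM : IsCov (pM δ τ) (lat δ τ) := by
  have h := closure_discrete (a := ((δ : ℕ) : ℝ)) (t := τ) (delta_pos δ) τ.im_pos
  rw [Complex.ofReal_natCast] at h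
  exact isCov_mk (lat δ τ) h

theorem isCov_pMhat : IsCov (pMhat δ τ) (latHat δ τ) := by
  have h := closure_discrete (a := 1) (t := τ / (δ : ℕ)) one_pos (by
    rw [Complex.div_natCast_im]
    exact div_pos τ.im_pos (delta_pos δ))
  rw [Complex.ofReal_one] at h
  exact isCov_mk (latHat δ τ) h

theorem isCov_pMM : IsCov (pMM δ τ) ((lat δ τ).prod (lat δ τ)) :=
  (isCov_pM δ τ).prodMap (isCov_pM δ τ)

theorem isCov_pMMhat : IsCov (pMMhat δ τ) ((lat δ τ).prod (latHat δ τ)) :=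
  (isCov_pM δ τ).prodMap (isCov_pMhat δ τ)

/-! #### Real coordinates -/

variable {δ τ}

theorem x₁_add (z w : ℂ) : x₁ δ τ (z + w) = x₁ δ τ z + x₁ δ τ w := by
  simp only [x₁, Complex.add_re, Complex.add_im]; ring

theorem x₂_add (z w : ℂ) : x₂ τ (z + w) = x₂ τ z + x₂ τ w := by
  simp only [x₂, Complex.add_im]; ring

theorem x₁_comb (a b : ℝ) : x₁ δ τ (a * (δ : ℕ) + b * τ) = a := by
  have h1 : τ.im ≠ 0 := τ.im_ne_zero
  have h2 := (delta_pos δ).ne'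
  simp [x₁]
  field_simp
  ring

theorem x₂_comb (a b : ℝ) : x₂ τ (a * (δ : ℕ) + b * τ) = b := by
  have h1 : τ.im ≠ 0 := τ.im_ne_zero
  simp [x₂, mul_div_cancel_right₀ b h1]

theorem x_eq (z : ℂ) : z = x₁ δ τ z * (δ : ℕ) + x₂ τ z * τ := by
  have h1 : τ.im ≠ 0 := τ.im_ne_zero
  have h2 := (delta_pos δ).ne'
  apply Complex.ext
  · simp [x₁, x₂]; field_simp; ring
  · simp [x₂, div_mul_cancel₀ _ h1]

theorem x₂_int (m n : ℤ) : x₂ τ (m * (δ : ℕ) + n * τ) = n := by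
  exact_mod_cast x₂_comb (δ := δ) (τ := τ) m n

theorem x₁_int (m n : ℤ) : x₁ δ τ (m * (δ : ℕ) + n * τ) = m := by
  exact_mod_cast x₁_comb (δ := δ) (τ := τ) m n

theorem continuous_x₁ : Continuous (x₁ δ τ) := by unfold x₁; fun_prop

theorem continuous_x₂ : Continuous (x₂ τ) := by unfold x₂; fun_prop

theorem mem_fundPar {z : ℂ} :
    z ∈ fundPar δ τ ↔ x₁ δ τ z ∈ Set.Ico (0 : ℝ) 1 ∧ x₂ τ z ∈ Set.Ico (0 : ℝ) 1 := by
  constructor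
  · rintro ⟨a, ha, b, hb, rfl⟩
    rw [x₁_comb, x₂_comb]; exact ⟨ha, hb⟩
  · rintro ⟨ha, hb⟩
    exact ⟨_, ha, _, hb, x_eq z⟩

variable (δ τ)

theorem measurableSet_fundPar : MeasurableSet (fundPar δ τ) := by
  have : fundPar δ τ = x₁ δ τ ⁻¹' Set.Ico 0 1 ∩ x₂ τ ⁻¹' Set.Ico 0 1 := by
    ext z; exact mem_fundPar
  rw [this]
  exact (continuous_x₁.measurable measurableSet_Ico).inter
    (continuous_x₂.measurable measurableSet_Ico)

theorem fundPar_subset : fundPar δ τ ⊆ Metric.closedBall 0 ((δ : ℕ) + ‖(τ : ℂ)‖) := by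
  rintro z ⟨a, ha, b, hb, rfl⟩
  rw [mem_closedBall_zero_iff]
  refine (norm_add_le _ _).trans (add_le_add ?_ ?_)
  · rw [norm_mul, Complex.norm_real, Complex.norm_natCast, Real.norm_of_nonneg ha.1]
    exact mul_le_of_le_one_left (Nat.cast_nonneg _) ha.2.le
  · rw [norm_mul, Complex.norm_real, Real.norm_of_nonneg hb.1]
    exact mul_le_of_le_one_left (norm_nonneg _) hb.2.le

theorem integrableOn_fundPar {f : ℂ → ℂ} (hf : Continuous f) :
    IntegrableOn f (fundPar δ τ) :=
  (hf.continuousOn.integrableOn_compact (isCompact_closedBall 0 _)).mono_set (fundPar_subset δ τ)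

theorem isAddFundamentalDomain_fundPar :
    IsAddFundamentalDomain (lat δ τ) (fundPar δ τ) (volume : Measure ℂ) := by
  refine IsAddFundamentalDomain.mk' (measurableSet_fundPar δ τ).nullMeasurableSet fun z => ?_
  have hfl : ∀ r : ℝ, r - ⌊r⌋ ∈ Set.Ico (0 : ℝ) 1 := fun r =>
    ⟨by linarith [Int.floor_le r], by linarith [Int.lt_floor_add_one r]⟩
  -- The only translate in the fundamental domain has the fractional parts of `x₁` and `x₂` as
  -- coordinates.
  refine ⟨⟨(-⌊x₁ δ τ z⌋ : ℤ) * (δ : ℕ) + (-⌊x₂ τ z⌋ : ℤ) * τ, (mem_lat δ τ).2 ⟨_, _, rfl⟩⟩, ?_, ?_⟩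
  · change _ + z ∈ fundPar δ τ
    rw [mem_fundPar, x₁_add, x₂_add, x₁_int, x₂_int]
    push_cast
    rw [neg_add_eq_sub, neg_add_eq_sub]
    exact ⟨hfl _, hfl _⟩
  · rintro ⟨g, hg⟩ h
    change g + z ∈ fundPar δ τ at h
    obtain ⟨m, n, rfl⟩ := (mem_lat δ τ).1 hg
    rw [mem_fundPar, x₁_add, x₂_add, x₁_int, x₂_int] at h
    have key : ∀ (k : ℤ) (r : ℝ), (k : ℝ) + r ∈ Set.Ico (0 : ℝ) 1 → k = -⌊r⌋ := by
      intro k r hk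
      have : ⌊r⌋ = -k := by
        rw [Int.floor_eq_iff]; push_cast
        exact ⟨by linarith [hk.1], by linarith [hk.2]⟩
      omega
    rw [Subtype.mk.injEq, key m _ h.1, key n _ h.2]

instance : Countable (lat δ τ) := by
  refine Function.Surjective.countable (α := ℤ × ℤ)
    (f := fun q => ⟨q.1 * (δ : ℕ) + q.2 * τ, (mem_lat δ τ).2 ⟨_, _, rfl⟩⟩) ?_
  rintro ⟨l, hl⟩
  obtain ⟨m, n, rfl⟩ := (mem_lat δ τ).1 hl
  exact ⟨(m, n), rfl⟩

/-- The integral of a periodic function over the fundamental domain is translation invariant. -/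
theorem setIntegral_fundPar_add {F : ℂ → ℂ} (h1 : ∀ z, F (z + (δ : ℕ)) = F z)
    (h2 : ∀ z, F (z + τ) = F z) (μ : ℂ) :
    ∫ z in fundPar δ τ, F (z + μ) = ∫ z in fundPar δ τ, F z := by
  have hper : ∀ l ∈ lat δ τ, ∀ z, F (z + l) = F z := by
    intro l hl
    refine AddSubgroup.closure_induction (p := fun l _ => ∀ z, F (z + l) = F z) ?_ ?_ ?_ ?_ hl
    · rintro l (rfl | rfl)
      · exact h1
      · exact h2
    · intro z; rw [add_zero]
    · intro a b _ _ ha hb z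
      rw [← add_assoc, hb, ha]
    · intro a _ ha z
      rw [← ha, neg_add_cancel_right]
  have hD := isAddFundamentalDomain_fundPar δ τ
  -- As translations commute, the translate of a fundamental domain is again one, and a periodic
  -- function has the same integral over both.
  have h3 := (hD.vadd_of_comm μ).setIntegral_eq hD (f := F) (fun g z => by
    change F (g.1 + z) = F z
    rw [add_comm]; exact hper _ g.2 z)
  rw [← h3]
  have h4 : MeasurePreserving (fun z : ℂ => z + μ) volume volume :=
    measurePreserving_add_right _ _
  have h5 := h4.setIntegral_image_emb (measurableEmbedding_addRight μ) F (fundPar δ τ)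
  rw [← h5]
  congr 2
  ext z
  simp only [Set.mem_vadd_set, Set.mem_image, vadd_eq_add, add_comm μ]

/-- Otherwise `f` vanishes near the centre of the parallelogram and hence everywhere. The interior
is used so that the nonzero set has positive measure. -/
theorem exists_ne_zero_mem_fundPar {f : ℂ → ℂ} (hf : Differentiable ℂ f) (h0 : f ≠ 0) :
    ∃ z ∈ interior (fundPar δ τ), f z ≠ 0 := by
  by_contra! h
  apply h0
  have h1 : AnalyticOnNhd ℂ f Set.univ := fun z _ => hf.analyticAt z
  have h2 : ((1 / 2 : ℝ) : ℂ) * (δ : ℕ) + ((1 / 2 : ℝ) : ℂ) * τ ∈ interior (fundPar δ τ) := by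
    refine mem_interior.2 ⟨x₁ δ τ ⁻¹' Set.Ioo 0 1 ∩ x₂ τ ⁻¹' Set.Ioo 0 1, ?_, ?_, ?_⟩
    · rintro z ⟨ha, hb⟩
      exact mem_fundPar.2 ⟨⟨ha.1.le, ha.2⟩, ⟨hb.1.le, hb.2⟩⟩
    · exact (isOpen_Ioo.preimage continuous_x₁).inter (isOpen_Ioo.preimage continuous_x₂)
    · rw [Set.mem_inter_iff, Set.mem_preimage, Set.mem_preimage, x₁_comb, x₂_comb]
      norm_num
  have h3 := h1.eqOn_zero_of_preconnected_of_eventuallyEq_zero isPreconnected_univ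
    (Set.mem_univ (((1 / 2 : ℝ) : ℂ) * (δ : ℕ) + ((1 / 2 : ℝ) : ℂ) * τ)) (by
      filter_upwards [isOpen_interior.mem_nhds h2] with z hz using h z hz)
  funext z
  exact h3 (Set.mem_univ z)

/-! #### The inner product on `ThetaSpace` -/

/-- The weight `exp (-2π z₂² / τ₂)`. -/
def wt (z : ℂ) : ℝ := Real.exp (-2 * Real.pi / τ.im * z.im ^ 2)

theorem continuous_wt : Continuous (wt τ) := by unfold wt; fun_prop

/-- The weight compensates the multiplier, so products of two theta functions with it are
Λ-periodic. -/
theorem wt_add_tau (z : ℂ) : ‖thetaMult τ z‖ ^ 2 * wt τ (z + τ) = wt τ z := by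
  have h1 : τ.im ≠ 0 := τ.im_ne_zero
  rw [thetaMult, Complex.norm_exp, wt, wt, ← Real.exp_nat_mul, ← Real.exp_add]
  congr 1
  simp
  field_simp
  ring

variable {δ τ} in
theorem thetaSpace_continuous (f : ThetaSpace δ τ) : Continuous f.1 := f.2.1.continuous

/-- The integrand of the inner product. -/
def thetaInt (f g : ℂ → ℂ) (z : ℂ) : ℂ := wt τ z * (f z * (starRingEnd ℂ) (g z))

theorem continuous_thetaInt {f g : ℂ → ℂ} (hf : Continuous f) (hg : Continuous g) :
    Continuous (thetaInt τ f g) :=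
  (Complex.continuous_ofReal.comp (continuous_wt τ)).mul
    (hf.mul (Complex.continuous_conj.comp hg))

variable {δ τ} in
theorem integrable_thetaInt (f g : ThetaSpace δ τ) :
    IntegrableOn (thetaInt τ f.1 g.1) (fundPar δ τ) :=
  integrableOn_fundPar δ τ
    (continuous_thetaInt τ (thetaSpace_continuous f) (thetaSpace_continuous g))

/-- The `L²` inner product on `ThetaSpace`. -/
def thetaForm : Sesq (ThetaSpace δ τ) :=
  LinearMap.mk₂'ₛₗ (RingHom.id ℂ) (starRingEnd ℂ)
    (fun f g => ∫ z in fundPar δ τ, thetaInt τ f.1 g.1 z)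
    (fun f f' g => by
      rw [← integral_add (integrable_thetaInt f g) (integrable_thetaInt f' g)]
      refine integral_congr_ae (Eventually.of_forall fun z => ?_)
      simp only [thetaInt, Submodule.coe_add, Pi.add_apply]; ring)
    (fun c f g => by
      rw [smul_eq_mul, ← integral_const_mul]
      refine integral_congr_ae (Eventually.of_forall fun z => ?_)
      simp only [thetaInt, Submodule.coe_smul, Pi.smul_apply, smul_eq_mul, RingHom.id_apply]; ring)
    (fun f g g' => by
      rw [← integral_add (integrable_thetaInt f g) (integrable_thetaInt f g')]
      refine integral_congr_ae (Eventually.of_forall fun z => ?_)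
      simp only [thetaInt, Submodule.coe_add, Pi.add_apply, map_add]; ring)
    (fun c f g => by
      rw [smul_eq_mul, ← integral_const_mul]
      refine integral_congr_ae (Eventually.of_forall fun z => ?_)
      simp only [thetaInt, Submodule.coe_smul, Pi.smul_apply, smul_eq_mul, map_mul]; ring)

variable {δ τ}

theorem thetaForm_apply (f g : ThetaSpace δ τ) :
    thetaForm δ τ f g = ∫ z in fundPar δ τ, thetaInt τ f.1 g.1 z := rfl

/-- The integrand is Λ-periodic. Hence the L² metric depends on μ only through a scalar factor. -/
theorem thetaForm_translate (f g : ThetaSpace δ τ) (μ : ℂ) :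
    ∫ z in fundPar δ τ, thetaInt τ f.1 g.1 (z + μ) = thetaForm δ τ f g := by
  refine setIntegral_fundPar_add δ τ (fun z => ?_) (fun z => ?_) μ
  · simp only [thetaInt, f.2.2.1, g.2.2.1]
    congr 2
    simp [wt]
  · simp only [thetaInt, f.2.2.2, g.2.2.2, map_mul]
    rw [← wt_add_tau τ z]
    push_cast
    rw [← Complex.mul_conj']
    ring

theorem thetaForm_symm (f g : ThetaSpace δ τ) :
    thetaForm δ τ g f = (starRingEnd ℂ) (thetaForm δ τ f g) := by
  rw [thetaForm_apply, thetaForm_apply, ← integral_conj]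
  refine integral_congr_ae (Eventually.of_forall fun z => ?_)
  simp only [thetaInt, map_mul, Complex.conj_ofReal, Complex.conj_conj]; ring

theorem thetaForm_pos (f : ThetaSpace δ τ) (hf : f ≠ 0) : 0 < (thetaForm δ τ f f).re := by
  have e : ∀ z, thetaInt τ f.1 f.1 z = ((wt τ z * ‖f.1 z‖ ^ 2 : ℝ) : ℂ) := fun z => by
    rw [thetaInt, Complex.mul_conj']; push_cast; rfl
  have hc : Continuous fun z => wt τ z * ‖f.1 z‖ ^ 2 :=
    (continuous_wt τ).mul ((thetaSpace_continuous f).norm.pow 2)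
  rw [thetaForm_apply]
  simp only [e]
  rw [integral_complex_ofReal, Complex.ofReal_re]
  have hw : ∀ z, 0 < wt τ z := fun z => Real.exp_pos _
  rw [setIntegral_pos_iff_support_of_nonneg_ae]
  · obtain ⟨z, hz, hz0⟩ := exists_ne_zero_mem_fundPar δ τ f.2.1 (fun h => hf (Subtype.ext h))
    have hopen : IsOpen (interior (fundPar δ τ) ∩ {z | f.1 z ≠ 0}) :=
      isOpen_interior.inter (isOpen_ne_fun (thetaSpace_continuous f) continuous_const)
    refine (hopen.measure_pos volume ⟨z, hz, hz0⟩).trans_le (measure_mono ?_)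
    rintro z ⟨hz, hz0⟩
    refine ⟨?_, interior_subset hz⟩
    rw [Function.mem_support]
    have := norm_pos_iff.2 hz0
    exact (mul_pos (hw z) (by positivity)).ne'
  · exact Eventually.of_forall fun z => mul_nonneg (hw z).le (by positivity)
  · exact (hc.continuousOn.integrableOn_compact (isCompact_closedBall 0 _)).mono_set
      (fundPar_subset δ τ)

variable (δ τ)

/-- The inner product in coordinates. -/
def coefForm : Sesq (Fin δ → ℂ) :=
  ((thetaForm δ τ).comp (thetaEquiv δ τ).symm.toLinearMap).compl₂
    (thetaEquiv δ τ).symm.toLinearMap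

theorem coefForm_apply (f g : ThetaSpace δ τ) :
    coefForm δ τ (thetaEquiv δ τ f) (thetaEquiv δ τ g) = thetaForm δ τ f g := by
  simp [coefForm]

theorem isPosHerm_coefForm : IsPosHerm (coefForm δ τ) where
  symm u v := by
    obtain ⟨f, rfl⟩ := (thetaEquiv δ τ).surjective u
    obtain ⟨g, rfl⟩ := (thetaEquiv δ τ).surjective v
    rw [coefForm_apply, coefForm_apply, thetaForm_symm]
  pos u hu := by
    obtain ⟨f, rfl⟩ := (thetaEquiv δ τ).surjective u
    rw [coefForm_apply]
    exact thetaForm_pos f (fun h => hu (by rw [h, map_zero]))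

end Lattices

/-! ### Fibres and metrics of bundles given by multipliers -/

section Multipliers

variable {W X ι : Type} [AddCommGroup W] {p : W → X} {gen : ι → W} {e : ι → W → ℂ}

/-- Values at any two points over `x` differ by a chain of nonvanishing multipliers and their
inverses. -/
theorem multFib_eq_zero (hp : ∀ w w', p w = p w' ↔ w' - w ∈ AddSubgroup.closure (Set.range gen))
    (he : ∀ i w, e i w ≠ 0) {x : X} (s : multFib p gen e x) (w : W) (hw : p w = x)
    (h0 : s.1 ⟨w, hw⟩ = 0) : s = 0 := by
  have key : ∀ l ∈ AddSubgroup.closure (Set.range gen), ∀ w w' : {w : W // p w = x},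
      w'.1 = w.1 + l → (s.1 w' = 0 ↔ s.1 w = 0) := by
    intro l hl
    refine AddSubgroup.closure_induction (p := fun l _ => ∀ w w' : {w : W // p w = x},
      w'.1 = w.1 + l → (s.1 w' = 0 ↔ s.1 w = 0)) ?_ ?_ ?_ ?_ hl
    · rintro _ ⟨i, rfl⟩ w w' h
      rw [s.2 i w w' h, mul_eq_zero, or_iff_right (he _ _)]
    · intro w w' h
      rw [Subtype.ext (h.trans (add_zero _))]
    · intro a b ha _ h1 h2 w w' h
      have h3 : p (w.1 + a) = x := by
        refine Eq.trans ?_ w.2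
        rw [eq_comm, hp]; simpa using ha
      rw [h2 ⟨w.1 + a, h3⟩ w' (by rw [h, add_assoc]), h1 w ⟨w.1 + a, h3⟩ rfl]
    · intro a _ h1 w w' h
      exact (h1 w' w (by rw [h, neg_add_cancel_right])).symm
  refine Subtype.ext (funext fun w' => ?_)
  exact (key (w'.1 - w) ((hp _ _).1 (hw.trans w'.2.symm)) ⟨w, hw⟩ w' (by simp)).2 h0

/-- A cocycle that extends the multipliers `e` from the generators to the lattice:
`m w₀ w` is the factor between the values at `w₀` and at `w`. -/
structure IsCocycle (p : W → X) (gen : ι → W) (e : ι → W → ℂ) (m : W → W → ℂ) : Prop where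
  deck : ∀ w w', p w = p w' ↔ w' - w ∈ AddSubgroup.closure (Set.range gen)
  ne_zero : ∀ i w, e i w ≠ 0
  self : ∀ w, m w w = 1
  step : ∀ w₀ w i, p w = p w₀ → m w₀ (w + gen i) = e i w * m w₀ w

variable {m : W → W → ℂ}

/-- Evaluation at a point over `x`. -/
def multEval (hm : IsCocycle p gen e m) (x : X) (w : W) (h : p w = x) :
    multFib p gen e x ≃ₗ[ℂ] ℂ where
  toFun s := s.1 ⟨w, h⟩
  map_add' _ _ := rfl
  map_smul' _ _ := rfl
  invFun c := ⟨fun w' => m w w'.1 * c, fun i w₁ w₂ h' => by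
    simp only
    rw [h', hm.step _ _ _ (w₁.2.trans h.symm), mul_assoc]⟩
  left_inv s := by
    rw [← sub_eq_zero]
    refine multFib_eq_zero hm.deck hm.ne_zero _ w h ?_
    simp [hm.self]
  right_inv c := by simp [hm.self]

theorem multEval_apply (hm : IsCocycle p gen e m) (x : X) (w : W) (h : p w = x)
    (s : multFib p gen e x) : multEval hm x w h s = s.1 ⟨w, h⟩ := rfl

theorem multEval_factor (hm : IsCocycle p gen e m) (x : X) (w w' : W) (h : p w = x)
    (h' : p w' = x) (s : multFib p gen e x) :
    multEval hm x w' h' s = m w w' * multEval hm x w h s := by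
  conv_lhs => rw [← (multEval hm x w h).symm_apply_apply s]
  rfl

/-- `multMetric` is evaluated at an arbitrarily chosen preimage; the invariance of `k` against the
cocycle moves it to any `w`. -/
theorem multMetric_apply (hm : IsCocycle p gen e m) (hp : Function.Surjective p) {k : W → ℝ}
    (hk : ∀ w w', p w = p w' → k w' * ‖m w w'‖ ^ 2 = k w) (x : X) (w : W) (h : p w = x)
    (s t : multFib p gen e x) : multMetric hp gen e k x s t =
      k w * (multEval hm x w h s * (starRingEnd ℂ) (multEval hm x w h t)) := by
  have h1 := Function.surjInv_eq hp x
  change (k (Function.surjInv hp x) : ℂ) * (multEval hm x _ h1 s *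
    (starRingEnd ℂ) (multEval hm x _ h1 t)) = _
  rw [multEval_factor hm x w _ h, multEval_factor hm x w _ h (Function.surjInv_eq hp x) t,
    ← hk w _ (h.trans h1.symm)]
  push_cast
  rw [← Complex.mul_conj', map_mul]
  ring

end Multipliers

/-! ### Trivializations of multiplier bundles -/

section MultLift

variable {W X ι : Type} [NormedAddCommGroup W] [NormedSpace ℂ W] [TopologicalSpace X] {p : W → X}
  {gen : ι → W} {e : ι → W → ℂ} {m : W → W → ℂ} {Γ : AddSubgroup W}

/-- The trivialization of a line bundle given by multipliers. -/
def multLift (hm : IsCocycle p gen e m)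
    (hd : ∀ l ∈ Γ, Differentiable ℂ fun w => m w (w + l)) :
    LiftTriv (multBundle p gen e) ℂ Γ where
  T x w h := multEval hm x w h
  deck l hl := by
    refine ⟨fun w => m w (w + l) • ContinuousLinearMap.id ℂ ℂ,
      (hd l hl).smul (differentiable_const _), fun x w h h' u => ?_⟩
    exact multEval_factor hm x w (w + l) h h' u
  hol _ _ := Iff.rfl

theorem multLift_factor (hm : IsCocycle p gen e m)
    (hd : ∀ l ∈ Γ, Differentiable ℂ fun w => m w (w + l)) (l : W) :
    (multLift hm hd).HasFactor l (fun w => m w (w + l)) :=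
  fun x w h h' u => multEval_factor hm x w (w + l) h h' u

end MultLift

/-! ### The bundles L₀, P_μ̂ and J -/

section Concrete

variable (δ : ℕ+) (τ : ℍ)

theorem cexp_eq_of_int {a b : ℂ} (n : ℤ) (h : a = b + 2 * Real.pi * Complex.I * n) :
    Complex.exp a = Complex.exp b := by
  rw [h, Complex.exp_add, cexp_two_pi_int, mul_one]

theorem range_genM : Set.range (genM δ τ) = {((δ : ℕ) : ℂ), (τ : ℂ)} := by
  simp [genM, Matrix.range_cons, Matrix.range_empty, Set.pair_comm]

theorem closure_genM : AddSubgroup.closure (Set.range (genM δ τ)) = lat δ τ := by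
  rw [range_genM]; rfl

variable {δ τ}

theorem exists_int_of_pM {w w' : ℂ} (h : pM δ τ w = pM δ τ w') :
    ∃ a b : ℤ, w' = w + (a * (δ : ℕ) + b * τ) := by
  obtain ⟨a, b, h1⟩ := (mem_lat δ τ).1 (((isCov_pM δ τ).deck _ _).1 h)
  exact ⟨a, b, by rw [← h1]; ring⟩

theorem x₂_int' (w : ℂ) (m n : ℤ) : x₂ τ (w + (m * (δ : ℕ) + n * τ) - w) = n := by
  rw [add_sub_cancel_left, x₂_int]

variable (δ τ)

/-- The cocycle of `L₀`. -/
def cocL₀ (w₀ w : ℂ) : ℂ :=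
  -- For w - w₀ = aδ + bτ the number x₂(w - w₀) is b; the term in b² collects the steps of τ.
  Complex.exp (-2 * Real.pi * Complex.I * (x₂ τ (w - w₀) * w₀) -
    Real.pi * Complex.I * (x₂ τ (w - w₀) ^ 2 * τ))

theorem x₂_zero : x₂ τ 0 = 0 := by simp [x₂]

theorem isCocycle_L₀ : IsCocycle (pM δ τ) (genM δ τ) (multL₀ τ) (cocL₀ τ) where
  deck w w' := by rw [closure_genM]; exact (isCov_pM δ τ).deck w w'
  ne_zero i w := by
    fin_cases i
    · simp [multL₀]
    · exact Complex.exp_ne_zero _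
  self w := by simp [cocL₀, x₂_zero]
  step w₀ w i h := by
    obtain ⟨a, b, rfl⟩ := exists_int_of_pM h.symm
    have hδ : x₂ τ ((δ : ℕ) : ℂ) = 0 := by simp [x₂]
    have hτ : x₂ τ (τ : ℂ) = 1 := by simp [x₂, div_self τ.im_ne_zero]
    fin_cases i
    · simp only [genM, multL₀, Fin.zero_eta, Matrix.cons_val_zero, one_mul]
      rw [cocL₀, cocL₀, add_sub_right_comm, x₂_add, x₂_int', hδ, add_zero]
    · simp only [genM, multL₀, Fin.mk_one, Matrix.cons_val_one, Matrix.cons_val_fin_one]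
      rw [cocL₀, cocL₀, add_sub_right_comm, x₂_add, x₂_int', hτ, ← Complex.exp_add]
      -- The multiplier of τ is taken at w₀ + aδ + bτ, where aδ contributes an integral multiple of
      -- 2πi.
      refine cexp_eq_of_int (a * (δ : ℕ)) ?_
      push_cast; ring

theorem cocL₀_diff (l : ℂ) : Differentiable ℂ fun w => cocL₀ τ w (w + l) := by
  simp only [cocL₀, add_sub_cancel_left]
  fun_prop

/-- The trivialization of `L₀`. -/
def liftL₀ : LiftTriv (L₀ δ τ) ℂ (lat δ τ) :=
  multLift (isCocycle_L₀ δ τ) fun l _ => cocL₀_diff τ l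

theorem liftL₀_factor (a b : ℤ) : (liftL₀ δ τ).HasFactor (a * (δ : ℕ) + b * τ) (fun w =>
    Complex.exp (-2 * Real.pi * Complex.I * (b * w) - Real.pi * Complex.I * (b ^ 2 * τ))) := by
  have h := multLift_factor (isCocycle_L₀ δ τ) (Γ := lat δ τ) (fun l _ => cocL₀_diff τ l)
    (a * (δ : ℕ) + b * τ)
  simp only [cocL₀, add_sub_cancel_left, x₂_int, Complex.ofReal_intCast] at h
  exact h

theorem hL₀_apply (x : M δ τ) (w : ℂ) (h : pM δ τ w = x) (s t : (L₀ δ τ).Fib x) :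
    hL₀ δ τ x s t = wt τ w *
      ((liftL₀ δ τ).T x w h s * (starRingEnd ℂ) ((liftL₀ δ τ).T x w h t)) := by
  refine multMetric_apply (isCocycle_L₀ δ τ) (pM_surj δ τ) (k := wt τ) ?_ x w h s t
  intro w w' hw
  obtain ⟨a, b, rfl⟩ := exists_int_of_pM hw
  have h1 : τ.im ≠ 0 := τ.im_ne_zero
  rw [cocL₀, x₂_int', Complex.norm_exp, wt, wt, ← Real.exp_nat_mul, ← Real.exp_add]
  congr 1
  simp [← Complex.ofReal_pow, -Complex.ofReal_intCast]
  field_simp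
  ring

/-! #### The bundles of degree zero -/

theorem isCocycle_pic (μh : ℂ) : IsCocycle (pM δ τ) (genM δ τ)
    ![fun _ => Complex.exp (2 * Real.pi * Complex.I * (μh * (-Complex.I / (2 * τ.im))) * (δ : ℕ)),
      fun _ => Complex.exp (2 * Real.pi * Complex.I * (μh * (-Complex.I / (2 * τ.im))) *
        (starRingEnd ℂ) (τ : ℂ))]
    (fun w₀ w => Complex.exp (2 * Real.pi * Complex.I * (μh * (-Complex.I / (2 * τ.im))) *
        (starRingEnd ℂ) (w - w₀))) where
  deck w w' := by rw [closure_genM]; exact (isCov_pM δ τ).deck w w'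
  ne_zero i w := by
    fin_cases i <;> exact Complex.exp_ne_zero _
  self w := by simp
  step w₀ w i h := by
    fin_cases i
    all_goals
      simp only [genM, Fin.zero_eta, Fin.mk_one, Matrix.cons_val_zero, Matrix.cons_val_one,
        Matrix.cons_val_fin_one, ← Complex.exp_add, map_add, map_sub, map_natCast]
      congr 1
      ring

/-- The trivialization of `picBundle`. -/
def liftPic (μh : ℂ) : LiftTriv (picBundle δ τ μh) ℂ (lat δ τ) :=
  multLift (isCocycle_pic δ τ μh) fun l _ => by simp

theorem liftPic_factor (μh l : ℂ) : (liftPic δ τ μh).HasFactor l (fun _ =>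
    Complex.exp (2 * Real.pi * Complex.I * (μh * (-Complex.I / (2 * τ.im))) *
        (starRingEnd ℂ) l)) := by
  have h := multLift_factor (isCocycle_pic δ τ μh) (Γ := lat δ τ) (fun l _ => by simp) l
  simp only [add_sub_cancel_left] at h
  exact h

/-! #### The bundle `J` -/

theorem closure_range_pair {A B : Type} [AddCommGroup A] [AddCommGroup B] (a b : A) (c d : B) :
    AddSubgroup.closure (Set.range ![(a, (0 : B)), (b, 0), (0, c), (0, d)]) =
      (AddSubgroup.closure {a, b}).prod (AddSubgroup.closure {c, d}) := by
  apply le_antisymm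
  · rw [AddSubgroup.closure_le]
    rintro _ ⟨i, rfl⟩
    fin_cases i
    · exact ⟨AddSubgroup.subset_closure (by simp), AddSubgroup.zero_mem _⟩
    · exact ⟨AddSubgroup.subset_closure (by simp), AddSubgroup.zero_mem _⟩
    · exact ⟨AddSubgroup.zero_mem _, AddSubgroup.subset_closure (by simp)⟩
    · exact ⟨AddSubgroup.zero_mem _, AddSubgroup.subset_closure (by simp)⟩
  · rintro ⟨u, v⟩ ⟨hu, hv⟩
    obtain ⟨m, n, hu⟩ := AddSubgroup.mem_closure_pair.1 hu
    obtain ⟨m', n', hv⟩ := AddSubgroup.mem_closure_pair.1 hv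
    have e : (u, v) = m • (a, (0 : B)) + n • (b, (0 : B)) + m' • ((0 : A), c) +
        n' • ((0 : A), d) := by
      simp only at hu hv
      simp [hu, hv]
    rw [e]
    refine add_mem (add_mem (add_mem ?_ ?_) ?_) ?_ <;>
      refine AddSubgroup.zsmul_mem _ (AddSubgroup.subset_closure ?_) _
    · exact ⟨0, rfl⟩
    · exact ⟨1, rfl⟩
    · exact ⟨2, rfl⟩
    · exact ⟨3, rfl⟩

theorem closure_genMM : AddSubgroup.closure (Set.range (genMM δ τ)) = (lat δ τ).prod (lat δ τ) :=
  closure_range_pair _ _ _ _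

/-- The cocycle of `J`. -/
def cocJ (w₀ w : ℂ × ℂ) : ℂ :=
  Complex.exp (-2 * Real.pi * Complex.I * (x₂ τ (w.1 - w₀.1) * w₀.2 + x₂ τ (w.2 - w₀.2) * w₀.1 +
    x₂ τ (w.1 - w₀.1) * x₂ τ (w.2 - w₀.2) * τ))

variable {δ τ} in
theorem exists_int_of_pMM {w w' : ℂ × ℂ} (h : pMM δ τ w = pMM δ τ w') :
    ∃ a b c d : ℤ, w' = (w.1 + (a * (δ : ℕ) + b * τ), w.2 + (c * (δ : ℕ) + d * τ)) := by
  obtain ⟨a, b, h1⟩ := exists_int_of_pM (congrArg Prod.fst h)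
  obtain ⟨c, d, h2⟩ := exists_int_of_pM (congrArg Prod.snd h)
  exact ⟨a, b, c, d, Prod.ext h1 h2⟩

theorem isCocycle_J : IsCocycle (pMM δ τ) (genMM δ τ) multJ (cocJ τ) where
  deck w w' := by rw [closure_genMM]; exact (isCov_pMM δ τ).deck w w'
  ne_zero i w := by
    fin_cases i
    · exact one_ne_zero
    · exact Complex.exp_ne_zero _
    · exact one_ne_zero
    · exact Complex.exp_ne_zero _
  self w := by simp [cocJ, x₂_zero]
  step w₀ w i h := by
    obtain ⟨a, b, c, d, rfl⟩ := exists_int_of_pMM h.symm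
    have hδ : x₂ τ ((δ : ℕ) : ℂ) = 0 := by simp [x₂]
    have hτ : x₂ τ (τ : ℂ) = 1 := by simp [x₂, div_self τ.im_ne_zero]
    fin_cases i
    · simp [genMM, multJ, cocJ, add_sub_right_comm, x₂_add, hδ]
    · simp only [genMM, multJ, cocJ, Fin.mk_one, Matrix.cons_val_one, Matrix.cons_val_zero,
        Prod.mk_add_mk, add_sub_right_comm _ (τ : ℂ), x₂_add (_ - _), x₂_int', hτ, add_zero,
        ← Complex.exp_add]
      refine cexp_eq_of_int (c * (δ : ℕ)) ?_
      push_cast; ring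
    · simp [genMM, multJ, cocJ, add_sub_right_comm, x₂_add, hδ]
    · change cocJ τ w₀ (_ + (0, (τ : ℂ))) = Complex.exp _ * _
      simp only [cocJ,
        Prod.mk_add_mk, add_sub_right_comm _ (τ : ℂ), x₂_add (_ - _), x₂_int', hτ, add_zero,
        ← Complex.exp_add]
      refine cexp_eq_of_int (a * (δ : ℕ)) ?_
      push_cast; ring

theorem cocJ_diff (l : ℂ × ℂ) : Differentiable ℂ fun w => cocJ τ w (w + l) := by
  simp only [cocJ, Prod.fst_add, Prod.snd_add, add_sub_cancel_left]
  fun_prop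

/-- The trivialization of `J`. -/
def liftJ : LiftTriv (J δ τ) ℂ ((lat δ τ).prod (lat δ τ)) :=
  multLift (isCocycle_J δ τ) fun l _ => cocJ_diff τ l

theorem liftJ_factor (a b c d : ℤ) :
    (liftJ δ τ).HasFactor (a * (δ : ℕ) + b * τ, c * (δ : ℕ) + d * τ) (fun w =>
      Complex.exp (-2 * Real.pi * Complex.I * (b * w.2 + d * w.1 + b * d * τ))) := by
  have h := multLift_factor (isCocycle_J δ τ) (Γ := (lat δ τ).prod (lat δ τ))
    (fun l _ => cocJ_diff τ l) (a * (δ : ℕ) + b * τ, c * (δ : ℕ) + d * τ)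
  simp only [cocJ, Prod.fst_add, Prod.snd_add, add_sub_cancel_left, x₂_int,
    Complex.ofReal_intCast] at h
  exact h

theorem hJ_apply (y : M δ τ × M δ τ) (w : ℂ × ℂ) (h : pMM δ τ w = y) (s t : (J δ τ).Fib y) :
    hJ δ τ y s t = (Real.exp (-4 * Real.pi / τ.im * (w.1.im * w.2.im)) : ℝ) *
      ((liftJ δ τ).T y w h s * (starRingEnd ℂ) ((liftJ δ τ).T y w h t)) := by
  refine multMetric_apply (isCocycle_J δ τ) ((pM_surj δ τ).prodMap (pM_surj δ τ)) ?_ y w h s t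
  intro w w' hw
  obtain ⟨a, b, c, d, rfl⟩ := exists_int_of_pMM hw
  have h1 : τ.im ≠ 0 := τ.im_ne_zero
  rw [cocJ, x₂_int', x₂_int', Complex.norm_exp, ← Real.exp_nat_mul, ← Real.exp_add]
  congr 1
  simp [-Complex.ofReal_intCast]
  field_simp
  ring

end Concrete

/-! ### The holomorphic trivialization of the Poincaré bundle -/

section Poincare

/-- The Cauchy–Riemann equations, in the form in which `PBundle` states the vanishing of the
(0,1)-part. -/
theorem differentiableAt_complex_iff {W : Type} [NormedAddCommGroup W] [NormedSpace ℂ W]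
    {f : W → ℂ} {w : W} : DifferentiableAt ℂ f w ↔
      DifferentiableAt ℝ f w ∧
        ∀ v, fderiv ℝ f w (Complex.I • v) = Complex.I * fderiv ℝ f w v := by
  constructor
  · intro h
    refine ⟨h.restrictScalars ℝ, fun v => ?_⟩
    rw [h.fderiv_restrictScalars ℝ]
    simp
  · rintro ⟨h, hI⟩
    let g : W →L[ℂ] ℂ :=
      { toFun := fderiv ℝ f w
        map_add' := map_add _
        map_smul' := fun c v => by
          conv_lhs => rw [← Complex.re_add_im c]
          rw [add_smul, mul_smul, map_add, Complex.coe_smul, Complex.coe_smul, map_smul, map_smul,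
            hI]
          simp only [Complex.real_smul, RingHom.id_apply, smul_eq_mul]
          conv_rhs => rw [← Complex.re_add_im c]
          ring
        cont := (fderiv ℝ f w).cont }
    exact (hasFDerivAt_of_restrictScalars ℝ (g' := fderiv ℝ f w) (f' := g) h.hasFDerivAt
      rfl).differentiableAt

variable (δ : ℕ+) (τ : ℍ)

theorem mem_latStar {l : ℝ × ℝ} :
    l ∈ latStar ↔ ∃ m n : ℤ, l = (2 * Real.pi * m, 2 * Real.pi * n) := by
  rw [latStar, AddSubgroup.mem_closure_pair]
  refine exists₂_congr fun m n => ?_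
  rw [eq_comm]
  simp [mul_comm]

theorem closure_genMMstar : AddSubgroup.closure (Set.range (genMMstar δ τ)) =
    (lat δ τ).prod latStar :=
  closure_range_pair _ _ _ _

theorem deck_pMMstar (w w' : ℂ × (ℝ × ℝ)) : pMMstar δ τ w = pMMstar δ τ w' ↔
    w' - w ∈ (lat δ τ).prod latStar := by
  rw [AddSubgroup.mem_prod, Prod.fst_sub, Prod.snd_sub, ← (isCov_pM δ τ).deck,
    ← neg_add_eq_sub w.2, ← QuotientAddGroup.eq]
  exact Prod.ext_iff

variable {δ τ} in
theorem exists_int_of_pMMstar {w w' : ℂ × (ℝ × ℝ)} (h : pMMstar δ τ w = pMMstar δ τ w') :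
    ∃ a b c d : ℤ, w' = (w.1 + (a * (δ : ℕ) + b * τ),
      (w.2.1 + 2 * Real.pi * c, w.2.2 + 2 * Real.pi * d)) := by
  obtain ⟨h1, h2⟩ := (deck_pMMstar δ τ w w').1 h
  obtain ⟨a, b, h1⟩ := (mem_lat δ τ).1 h1
  obtain ⟨c, d, h2⟩ := mem_latStar.1 h2
  refine ⟨a, b, c, d, Prod.ext ?_ ?_⟩
  · rw [← h1]; simp
  · have h3 : (w.2.1 + 2 * Real.pi * c, w.2.2 + 2 * Real.pi * d) =
      w.2 + (2 * Real.pi * c, 2 * Real.pi * d) := rfl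
    rw [h3, ← h2]; simp

/-- The cocycle of `𝒫`. -/
def cocP (w₀ w : ℂ × (ℝ × ℝ)) : ℂ :=
  -- Only the shift of ξ enters, because the multipliers in the directions of Λ are 1.
  Complex.exp (-Complex.I * ((w.2.1 - w₀.2.1) * x₁ δ τ w₀.1 + (w.2.2 - w₀.2.2) * x₂ τ w₀.1))

theorem isCocycle_P : IsCocycle (pMMstar δ τ) (genMMstar δ τ) (multMMstar δ τ) (cocP δ τ) where
  deck w w' := by rw [closure_genMMstar]; exact deck_pMMstar δ τ w w'
  ne_zero i w := by
    fin_cases i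
    · exact one_ne_zero
    · exact one_ne_zero
    · exact Complex.exp_ne_zero _
    · exact Complex.exp_ne_zero _
  self w := by simp [cocP]
  step w₀ w i h := by
    obtain ⟨a, b, c, d, rfl⟩ := exists_int_of_pMMstar h.symm
    fin_cases i
    · simp [genMMstar, multMMstar, cocP]
    · simp [genMMstar, multMMstar, cocP]
    · change cocP δ τ w₀ (_ + (0, (2 * Real.pi, 0))) = Complex.exp _ * _
      simp only [cocP, Prod.mk_add_mk, ← Complex.exp_add, x₁_add w₀.1, x₁_int]
      refine cexp_eq_of_int a ?_
      push_cast; ring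
    · change cocP δ τ w₀ (_ + (0, (0, 2 * Real.pi))) = Complex.exp _ * _
      simp only [cocP, Prod.mk_add_mk, ← Complex.exp_add, x₂_add w₀.1, x₂_int]
      refine cexp_eq_of_int b ?_
      push_cast; ring

/-- The function `exp (-2πi μ̂ z₂ / τ₂)`. -/
def gaugeP (w : ℂ × ℂ) : ℂ :=
  -- Its logarithm has ∂̄-derivative (π μ̂/τ₂) dz̄, which is the (0,1)-part of iξ.
  Complex.exp (-(2 * Real.pi * Complex.I / τ.im * (w.2 * w.1.im)))

theorem IdIso_eq (w : ℂ × ℂ) {y : M δ τ × Mhat δ τ} (h : pMMhat δ τ w = y) :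
    pMMstar δ τ (w.1, isoLift δ τ w.2) = IdIso δ τ y := by
  subst h; rfl

/-- The trivialization of the pull-back of `P` to `V × V̂`. -/
def trivP (y : M δ τ × Mhat δ τ) (w : ℂ × ℂ) (h : pMMhat δ τ w = y) :
    PcalFib δ τ (IdIso δ τ y) ≃ₗ[ℂ] ℂ :=
  (multEval (isCocycle_P δ τ) (IdIso δ τ y) (w.1, isoLift δ τ w.2) (IdIso_eq δ τ w h)).trans
    (LinearEquiv.smulOfNeZero ℂ ℂ (gaugeP τ w) (Complex.exp_ne_zero _))

theorem trivP_apply (y : M δ τ × Mhat δ τ) (w : ℂ × ℂ) (h : pMMhat δ τ w = y)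
    (s : PcalFib δ τ (IdIso δ τ y)) :
    trivP δ τ y w h s = gaugeP τ w * s.1 ⟨(w.1, isoLift δ τ w.2), IdIso_eq δ τ w h⟩ := rfl

/-- Neither the cocycle of 𝒫 nor the quotient of the gauge functions is holomorphic in general, but
their product is: the real coordinates recombine to z/δ. -/
theorem trivP_factor (a b c d : ℤ) (y : M δ τ × Mhat δ τ) (w : ℂ × ℂ) (h : pMMhat δ τ w = y)
    (h' : pMMhat δ τ (w + ((a * (δ : ℕ) + b * τ : ℂ), (c + d * (τ / (δ : ℕ)) : ℂ))) = y)
    (s : PcalFib δ τ (IdIso δ τ y)) :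
    trivP δ τ y _ h' s = Complex.exp (-2 * Real.pi * Complex.I *
      (b * w.2 + d * (w.1 / (δ : ℕ)) + b * d * (τ / (δ : ℕ)))) * trivP δ τ y w h s := by
  have h1 : (τ.im : ℂ) ≠ 0 := by exact_mod_cast τ.im_ne_zero
  have h2 := delta_ne (δ := δ)
  have h3 := multEval_factor (isCocycle_P δ τ) (IdIso δ τ y) _ _ (IdIso_eq δ τ w h)
    (IdIso_eq δ τ _ h') s
  change gaugeP τ _ * multEval (isCocycle_P δ τ) (IdIso δ τ y) _ (IdIso_eq δ τ _ h') s =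
    _ * (gaugeP τ w * multEval (isCocycle_P δ τ) (IdIso δ τ y) _ (IdIso_eq δ τ w h) s)
  rw [h3, ← mul_assoc, ← mul_assoc]
  congr 1
  have h4 : isoLift δ τ (c + d * (τ / (δ : ℕ))) = (2 * Real.pi * d, -(2 * Real.pi * c)) := by
    have h5 : τ.im ≠ 0 := τ.im_ne_zero
    have h6 := (delta_pos δ).ne'
    have e1 : ((τ : ℂ) / (δ : ℕ)).im = τ.im / (δ : ℕ) := Complex.div_natCast_im _ _
    have e2 : ((τ : ℂ) / (δ : ℕ)).re = τ.re / (δ : ℕ) := Complex.div_natCast_re _ _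
    ext
    · simp [isoLift, e1]; field_simp
    · simp [isoLift, e1, e2]; field_simp; ring
  have h7 : ((w.1 + (a * (δ : ℕ) + b * τ)).im : ℂ) = w.1.im + b * τ.im := by simp
  -- The coordinate `x₁` comes from the cocycle of 𝒫 and the term with τ/δ from the gauge.
  have h8 : w.1 / (δ : ℕ) = x₁ δ τ w.1 + w.1.im / τ.im * (τ / (δ : ℕ)) := by
    conv_lhs => rw [x_eq (δ := δ) (τ := τ) w.1]
    rw [x₂]; push_cast; field_simp
  simp only [cocP, gaugeP, ← Complex.exp_add, Prod.snd_add, Prod.fst_add, map_add, h4, h7]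
  -- The cross term of c with bτ₂ in the quotient of gauge functions.
  refine cexp_eq_of_int (-(b * c)) ?_
  rw [x₂, h8]
  push_cast
  field_simp
  ring

/-- By the choice of `gaugeP`, ∂̄(gu) = g(∂̄u + A u), where A is the (0,1)-part of the connection
form; and g never vanishes. -/
theorem covP_iff (u : ℂ × ℂ → ℂ) (w : ℂ × ℂ) :
    (DifferentiableAt ℝ u w ∧
      ∀ v : ℂ × ℂ, covP δ τ u w (Complex.I • v) = Complex.I * covP δ τ u w v) ↔
    DifferentiableAt ℂ (fun w => gaugeP τ w * u w) w := by
  have h1 : (τ.im : ℂ) ≠ 0 := by exact_mod_cast τ.im_ne_zero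
  have hg' : ∀ w, HasFDerivAt (gaugeP τ) (gaugeP τ w • (-((2 * Real.pi * Complex.I / τ.im : ℂ) •
      (w.2 • ((Complex.ofRealCLM.comp Complex.imCLM).comp (ContinuousLinearMap.fst ℝ ℂ ℂ)) +
        (w.1.im : ℂ) • ContinuousLinearMap.snd ℝ ℂ ℂ)))) w := fun w => by
    have e1 : HasFDerivAt (fun w : ℂ × ℂ => w.2) (ContinuousLinearMap.snd ℝ ℂ ℂ) w :=
      hasFDerivAt_snd
    have e2 : HasFDerivAt (fun w : ℂ × ℂ => (w.1.im : ℂ))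
        ((Complex.ofRealCLM.comp Complex.imCLM).comp (ContinuousLinearMap.fst ℝ ℂ ℂ)) w :=
      ((Complex.ofRealCLM.comp Complex.imCLM).comp (ContinuousLinearMap.fst ℝ ℂ ℂ)).hasFDerivAt
    exact ((e1.mul e2).const_mul (2 * Real.pi * Complex.I / τ.im : ℂ)).neg.cexp
  have hgd : ∀ w, DifferentiableAt ℝ (gaugeP τ) w := fun w => (hg' w).differentiableAt
  have hg : ∀ v, fderiv ℝ (gaugeP τ) w v = -(2 * Real.pi * Complex.I / τ.im *
      (v.2 * w.1.im + w.2 * v.1.im)) * gaugeP τ w := by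
    intro v
    rw [(hg' w).fderiv]
    simp
    ring
  have hg0 : ∀ w, gaugeP τ w ≠ 0 := fun w => Complex.exp_ne_zero _
  rw [differentiableAt_complex_iff]
  have hiff : DifferentiableAt ℝ (fun w => gaugeP τ w * u w) w ↔ DifferentiableAt ℝ u w := by
    refine ⟨fun h => ?_, fun h => (hgd w).mul h⟩
    refine (((hgd w).inv (hg0 w)).mul h).congr_of_eventuallyEq (Eventually.of_forall fun v => ?_)
    simp [inv_mul_cancel_left₀ (hg0 v)]
  rw [hiff]
  refine and_congr_right fun hu => forall_congr' fun v => ?_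
  rw [fderiv_fun_mul (hgd w) hu]
  simp only [covP, add_apply, smul_apply, smul_eq_mul, hg, connPcal]
  -- In complex coordinates the form ξ is (2π/τ₂)(μ̂₂ dz₁ - μ̂₁ dz₂).
  have hconn : ∀ v : ℂ, ((isoLift δ τ w.2).1 * x₁ δ τ v + (isoLift δ τ w.2).2 * x₂ τ v : ℂ) =
      2 * Real.pi / τ.im * (w.2.im * v.re - w.2.re * v.im) := by
    intro v
    have h2 := delta_ne (δ := δ)
    simp only [isoLift, x₁, x₂, AddMonoidHom.coe_mk, ZeroHom.coe_mk]
    push_cast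
    field_simp
    ring
  have e : w.2 = w.2.re + w.2.im * Complex.I := (Complex.re_add_im _).symm
  have r1 : (Complex.I • v).1.re = -v.1.im := by simp
  have r2 : (Complex.I • v).1.im = v.1.re := by simp
  have r3 : (Complex.I • v).2 = Complex.I * v.2 := rfl
  rw [hconn, hconn, r1, r2, r3]
  set p : ℂ := (w.2.re : ℂ)
  set q : ℂ := (w.2.im : ℂ)
  set K : ℂ := 2 * Real.pi / τ.im with hK
  have hK' : 2 * Real.pi * Complex.I / τ.im = K * Complex.I := by rw [hK]; ring
  rw [hK']
  push_cast
  constructor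
  · intro h
    linear_combination gaugeP τ w * h + (u w * gaugeP τ w * K * (-Complex.I * v.1.re +
      Complex.I * Complex.I * v.1.im)) * e +
      (u w * gaugeP τ w * K * Complex.I * q * v.1.im) * Complex.I_mul_I
  · intro h
    apply mul_left_cancel₀ (hg0 w)
    linear_combination h - (u w * gaugeP τ w * K * (-Complex.I * v.1.re +
      Complex.I * Complex.I * v.1.im)) * e -
      (u w * gaugeP τ w * K * Complex.I * q * v.1.im) * Complex.I_mul_I

/-- The trivialization of the Poincaré bundle. -/
def liftP' : LiftTriv (PBundle δ τ) ℂ ((lat δ τ).prod (latHat δ τ)) where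
  T y w h := trivP δ τ y w h
  deck l hl := by
    obtain ⟨⟨a, b, h1⟩, ⟨c, d, h2⟩⟩ := And.imp (mem_lat δ τ).1 (mem_latHat δ τ).1 hl
    have hl : l = ((a * (δ : ℕ) + b * τ : ℂ), (c + d * (τ / (δ : ℕ)) : ℂ)) := Prod.ext h1 h2
    subst hl
    refine ⟨fun w => Complex.exp (-2 * Real.pi * Complex.I *
      (b * w.2 + d * (w.1 / (δ : ℕ)) + b * d * (τ / (δ : ℕ)))) • ContinuousLinearMap.id ℂ ℂ,
      by fun_prop, fun y w h h' u => trivP_factor δ τ a b c d y w h h' u⟩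
  hol y s := forall₂_congr fun _ _ => eventually_congr (Eventually.of_forall fun w' =>
    covP_iff δ τ (liftP δ τ s) w')

theorem liftP'_factor (a b c d : ℤ) :
    (liftP' δ τ).HasFactor ((a * (δ : ℕ) + b * τ : ℂ), (c + d * (τ / (δ : ℕ)) : ℂ)) (fun w =>
      Complex.exp (-2 * Real.pi * Complex.I *
        (b * w.2 + d * (w.1 / (δ : ℕ)) + b * d * (τ / (δ : ℕ))))) :=
  fun y w h h' u => trivP_factor δ τ a b c d y w h h' u

/-- The metric is 1 in the flat description, so in the holomorphic one it becomes |`gaugeP`|⁻². -/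
theorem hP_apply (y : M δ τ × Mhat δ τ) (w : ℂ × ℂ) (h : pMMhat δ τ w = y)
    (s t : (PBundle δ τ).Fib y) :
    hP δ τ y s t = (Real.exp (-4 * Real.pi / τ.im * (w.1.im * w.2.im)) : ℝ) *
      ((liftP' δ τ).T y w h s * (starRingEnd ℂ) ((liftP' δ τ).T y w h t)) := by
  have h1 := multMetric_apply (isCocycle_P δ τ) ((pM_surj δ τ).prodMap pMstar_surj)
    (k := fun _ => 1) (fun w w' hw => by
      rw [cocP, Complex.norm_exp]
      simp) (IdIso δ τ y) _ (IdIso_eq δ τ w h) s t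
  have h2 : ((Real.exp (-4 * Real.pi / τ.im * (w.1.im * w.2.im)) : ℝ) : ℂ) *
      (gaugeP τ w * (starRingEnd ℂ) (gaugeP τ w)) = 1 := by
    rw [Complex.mul_conj', gaugeP, Complex.norm_exp]
    norm_cast
    rw [← Real.exp_nat_mul, ← Real.exp_add, Real.exp_eq_one_iff]
    simp
    ring
  refine h1.trans ?_
  change _ = _ * ((gaugeP τ w * multEval (isCocycle_P δ τ) (IdIso δ τ y) _ (IdIso_eq δ τ w h) s) *
    (starRingEnd ℂ) (gaugeP τ w * multEval (isCocycle_P δ τ) (IdIso δ τ y) _ (IdIso_eq δ τ w h) t))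
  rw [map_mul]
  push_cast
  push_cast at h2
  linear_combination (-(multEval (isCocycle_P δ τ) (IdIso δ τ y) _ (IdIso_eq δ τ w h) s *
    (starRingEnd ℂ) (multEval (isCocycle_P δ τ) (IdIso δ τ y) _ (IdIso_eq δ τ w h) t))) * h2

end Poincare

/-! ### The map φ_{L₀} lifts to the identity; the Poincaré property -/

section Phi

variable {δ : ℕ+} {τ : ℍ}

/-- An entire function whose absolute value is periodic under `Λ` is constant. -/
theorem eq_const_of_norm_periodic {f : ℂ → ℂ} (hf : Differentiable ℂ f)
    (h1 : ∀ z, ‖f (z + (δ : ℕ))‖ = ‖f z‖) (h2 : ∀ z, ‖f (z + τ)‖ = ‖f z‖) (z : ℂ) :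
    f z = f 0 := by
  refine hf.apply_eq_apply_of_bounded ?_ z 0
  have hc : IsCompact (f '' Metric.closedBall 0 ((δ : ℕ) + ‖(τ : ℂ)‖)) :=
    (isCompact_closedBall _ _).image hf.continuous
  obtain ⟨C, hC⟩ := hc.isBounded.exists_norm_le
  have p1 : Function.Periodic (fun z => ‖f z‖) ((δ : ℕ) : ℂ) := h1
  have p2 : Function.Periodic (fun z => ‖f z‖) (τ : ℂ) := h2
  refine isBounded_iff_forall_norm_le.2 ⟨C, ?_⟩
  rintro _ ⟨w, rfl⟩
  set m := ⌊x₁ δ τ w⌋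
  set n := ⌊x₂ τ w⌋
  have e : ‖f w‖ = ‖f (w - m • ((δ : ℕ) : ℂ) - n • (τ : ℂ))‖ := by
    rw [p2.sub_zsmul_eq n, p1.sub_zsmul_eq m]
  rw [e]
  refine hC _ ⟨_, fundPar_subset δ τ ?_, rfl⟩
  refine ⟨Int.fract (x₁ δ τ w), ⟨Int.fract_nonneg _, Int.fract_lt_one _⟩, Int.fract (x₂ τ w),
    ⟨Int.fract_nonneg _, Int.fract_lt_one _⟩, ?_⟩
  conv_lhs => rw [x_eq (δ := δ) (τ := τ) w]
  rw [← Int.self_sub_floor, ← Int.self_sub_floor]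
  push_cast
  simp only [zsmul_eq_mul, m, n]
  ring

/-- After multiplication by exp(-2πisz) with a suitable real `s`, the modulus of `G` is Λ-periodic,
so `G` is a multiple of exp(2πisz) by Liouville. The two multipliers then give sδ = n and sτ + ν = m
with integers n, m, so ν = m - nτ/δ. -/
theorem mem_latHat_of_factor {G : ℂ → ℂ} (hG : Differentiable ℂ G) (h0 : G 0 ≠ 0) {ν : ℂ}
    (h1 : ∀ z, G (z + (δ : ℕ)) = G z)
    (h2 : ∀ z, G (z + τ) = Complex.exp (-(2 * Real.pi * Complex.I * ν)) * G z) :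
    ν ∈ latHat δ τ := by
  have hτ : τ.im ≠ 0 := τ.im_ne_zero
  have hpi : (2 * Real.pi * Complex.I : ℂ) ≠ 0 := Complex.two_pi_I_ne_zero
  -- This `s` balances the modulus of the multiplier for τ; being real, it does not disturb the
  -- modulus for δ.
  set s : ℝ := -(ν.im / τ.im) with hs
  set F : ℂ → ℂ := fun z => Complex.exp (-(2 * Real.pi * Complex.I * (s * z))) * G z with hF
  have hFd : Differentiable ℂ F := by
    refine Differentiable.mul ?_ hG
    fun_prop
  have key : ∀ z, F z = F 0 := by
    refine eq_const_of_norm_periodic (δ := δ) (τ := τ) hFd (fun z => ?_) fun z => ?_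
    · simp only [hF, h1, norm_mul, Complex.norm_exp]
      congr 2
      simp
    · simp only [hF, h2, norm_mul, Complex.norm_exp, ← mul_assoc, ← Real.exp_add]
      congr 2
      simp [hs]
      field_simp
      ring
  have hGe : ∀ z, G z = Complex.exp (2 * Real.pi * Complex.I * (s * z)) * G 0 := fun z => by
    have h3 : Complex.exp (-(2 * Real.pi * Complex.I * (s * z))) * G z = G 0 := by
      have := key z
      simpa [hF] using this
    rw [← h3, ← mul_assoc, ← Complex.exp_add]
    simp
  have e1 : Complex.exp (2 * Real.pi * Complex.I * (s * (δ : ℕ))) = 1 := by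
    have h3 := h1 0
    rw [zero_add, hGe] at h3
    exact mul_right_cancel₀ h0 (h3.trans (one_mul _).symm)
  have e2 : Complex.exp (2 * Real.pi * Complex.I * (s * τ)) =
      Complex.exp (-(2 * Real.pi * Complex.I * ν)) := by
    have h3 := h2 0
    rw [zero_add, hGe] at h3
    exact mul_right_cancel₀ h0 h3
  obtain ⟨n, hn⟩ := Complex.exp_eq_one_iff.1 e1
  obtain ⟨m, hm⟩ := Complex.exp_eq_exp_iff_exists_int.1 e2
  have hn' : (s : ℂ) * (δ : ℕ) = n := by
    apply mul_left_cancel₀ hpi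
    rw [hn]; ring
  have hm' : (s : ℂ) * τ = -ν + m := by
    apply mul_left_cancel₀ hpi
    rw [hm]; ring
  refine (mem_latHat δ τ).2 ⟨m, -n, ?_⟩
  have := delta_ne (δ := δ)
  push_cast
  rw [← hn']
  field_simp
  linear_combination hm'

variable (δ τ)

/-- The trivialization of `T_x^* L₀ ⊗ L₀^*` for `x = pM μ`. -/
def liftTrans (μ : ℂ) : LiftTriv (tensor (pullback (pM δ τ) (fun y => y + pM δ τ μ) (L₀ δ τ))
    (dual (L₀ δ τ))) ℂ (lat δ τ) :=
  ((liftL₀ δ τ).pullback (isCov_pM δ τ) (isCov_pM δ τ) (fun y => y + pM δ τ μ) (fun z => z + μ)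
    (fun _ => rfl) (by fun_prop) (fun l hl => ⟨l, hl, fun w => add_right_comm _ _ _⟩)).tensor
    ((liftL₀ δ τ).dual (isCov_pM δ τ)) (isCov_pM δ τ)

/-- The quotient of the factors of L₀ at z + μ and at z does not depend on z. -/
theorem liftTrans_factor (μ : ℂ) (a b : ℤ) :
    (liftTrans δ τ μ).HasFactor (a * (δ : ℕ) + b * τ)
      (fun _ => Complex.exp (-(2 * Real.pi * Complex.I * (b * μ)))) := by
  have h := LiftTriv.HasFactor.tensor (isCov_pM δ τ)
    ((liftL₀_factor δ τ a b).pullback (isCov_pM δ τ) (isCov_pM δ τ) (g := fun y => y + pM δ τ μ)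
      (gt := fun z => z + μ) (l := a * (δ : ℕ) + b * τ)
      (fun _ => rfl) (by fun_prop) (fun l hl => ⟨l, hl, fun w => add_right_comm _ _ _⟩)
      (fun w => add_right_comm _ _ _)) ((liftL₀_factor δ τ a b).dual (isCov_pM δ τ))
  refine h.congr fun w => ?_
  simp only [Pi.mul_apply, Pi.inv_apply, ← Complex.exp_neg, ← Complex.exp_add]
  congr 1
  ring

/-- The function exp(-2πiσw) replaces l̄ by l̄ - l in the factor. The real part aδ cancels, and τ̄ -
τ = -2iτ₂ cancels the denominator of σ. -/
theorem pic_factor_eq (μh : ℂ) (a b : ℤ) (w : ℂ) :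
    Complex.exp (-(2 * Real.pi * Complex.I * (μh * (-Complex.I / (2 * τ.im))) *
      (w + (a * (δ : ℕ) + b * τ)))) * Complex.exp (2 * Real.pi * Complex.I *
        (μh * (-Complex.I / (2 * τ.im))) * (starRingEnd ℂ) (a * (δ : ℕ) + b * τ)) =
    Complex.exp (-(2 * Real.pi * Complex.I * (b * μh))) *
      Complex.exp (-(2 * Real.pi * Complex.I * (μh * (-Complex.I / (2 * τ.im))) * w)) := by
  have hτ : (τ.im : ℂ) ≠ 0 := by exact_mod_cast τ.im_ne_zero
  rw [← Complex.exp_add, ← Complex.exp_add]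
  congr 1
  have e : (τ : ℂ) = (starRingEnd ℂ) (τ : ℂ) + 2 * τ.im * Complex.I := by
    have := Complex.sub_conj (τ : ℂ)
    rw [sub_eq_iff_eq_add] at this
    push_cast [UpperHalfPlane.coe_im] at this
    linear_combination this
  simp only [map_add, map_mul, map_intCast, map_natCast]
  generalize (starRingEnd ℂ) (τ : ℂ) = t at e
  rw [e]
  field_simp
  linear_combination (2 * b * μh * τ.im : ℂ) * Complex.I_sq

theorem exists_iso_pic {E : HolBundle (pM δ τ)} (L : LiftTriv E ℂ (lat δ τ)) (μh : ℂ)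
    (hL : ∀ a b : ℤ, L.HasFactor (a * (δ : ℕ) + b * τ)
      (fun _ => Complex.exp (-(2 * Real.pi * Complex.I * (b * μh))))) :
    Nonempty (HolIso (picBundle δ τ μh) E) := by
  obtain ⟨A, -⟩ := LiftTriv.exists_iso (liftPic δ τ μh) L (isCov_pM δ τ)
    (fun w => Complex.exp (-(2 * Real.pi * Complex.I * (μh * (-Complex.I / (2 * τ.im))) * w)))
    (by fun_prop) (fun w => Complex.exp_ne_zero _) (fun l hl => by
      obtain ⟨a, b, rfl⟩ := (mem_lat δ τ).1 hl
      exact ⟨_, _, liftPic_factor δ τ μh _, hL a b, pic_factor_eq δ τ μh a b⟩)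
  exact ⟨A⟩

/-- The isomorphism is multiplication by some `g`. Multiplied by exp(2πiσw) it has multipliers 1 and
exp(-2πi(μ - μ̂)), to which `mem_latHat_of_factor` applies. -/
theorem sub_mem_latHat_of_iso {μh μ : ℂ} (A : HolIso (picBundle δ τ μh)
    (tensor (pullback (pM δ τ) (fun y => y + pM δ τ μ) (L₀ δ τ)) (dual (L₀ δ τ)))) :
    μ - μh ∈ latHat δ τ := by
  obtain ⟨g, hg, hg0, hA⟩ := LiftTriv.exists_mul_of_iso (liftPic δ τ μh) (liftTrans δ τ μ)
    (isCov_pM δ τ) A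
  set s : ℂ := 2 * Real.pi * Complex.I * (μh * (-Complex.I / (2 * τ.im))) with hs
  have h1 : ∀ (a b : ℤ) (w : ℂ), Complex.exp (s * (w + (a * (δ : ℕ) + b * τ))) *
      g (w + (a * (δ : ℕ) + b * τ)) = Complex.exp (-(2 * Real.pi * Complex.I * (b * (μ - μh)))) *
        (Complex.exp (s * w) * g w) := by
    intro a b w
    have h2 := LiftTriv.mul_factor_eq (liftPic δ τ μh) (liftTrans δ τ μ) hA
      ((isCov_pM δ τ).add ((mem_lat δ τ).2 ⟨a, b, rfl⟩)) (liftPic_factor δ τ μh _)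
      (liftTrans_factor δ τ μ a b) w
    have h3 := pic_factor_eq δ τ μh a b w
    rw [← hs] at h2 h3
    set P := Complex.exp (s * (starRingEnd ℂ) (a * (δ : ℕ) + b * τ))
    have hP : P ≠ 0 := Complex.exp_ne_zero _
    apply mul_right_cancel₀ hP
    rw [mul_assoc, h2, mul_sub, mul_sub, neg_sub, sub_eq_add_neg, Complex.exp_add]
    have h4 := congrArg (fun t => t * (Complex.exp (s * (w + (a * (δ : ℕ) + b * τ))) *
      Complex.exp (s * w) * Complex.exp (2 * Real.pi * Complex.I * (b * μh)))) h3
    have e1 : Complex.exp (-(s * (w + (a * (δ : ℕ) + b * τ)))) *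
      Complex.exp (s * (w + (a * (δ : ℕ) + b * τ))) = 1 := by rw [← Complex.exp_add]; simp
    have e2 : Complex.exp (-(s * w)) * Complex.exp (s * w) = 1 := by
      rw [← Complex.exp_add]; simp
    have e3 : Complex.exp (-(2 * Real.pi * Complex.I * (b * μh))) *
      Complex.exp (2 * Real.pi * Complex.I * (b * μh)) = 1 := by rw [← Complex.exp_add]; simp
    -- This is `pic_factor_eq` with the inverse exponentials cleared.
    have h5 : P * Complex.exp (s * w) * Complex.exp (2 * Real.pi * Complex.I * (b * μh)) =
        Complex.exp (s * (w + (a * (δ : ℕ) + b * τ))) := by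
      linear_combination h4 - (P * Complex.exp (s * w) *
        Complex.exp (2 * Real.pi * Complex.I * (b * μh))) * e1 +
        Complex.exp (s * (w + (a * (δ : ℕ) + b * τ))) * (Complex.exp (-(2 * Real.pi * Complex.I * (b * μh))) *
        Complex.exp (2 * Real.pi * Complex.I * (b * μh)) * e2 + e3)
    rw [← h5]
    ring
  refine mem_latHat_of_factor (δ := δ) (τ := τ) (G := fun w => Complex.exp (s * w) * g w) ?_ ?_ ?_ ?_
  · exact Differentiable.mul (by fun_prop) hg
  · exact mul_ne_zero (Complex.exp_ne_zero _) (hg0 0)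
  · intro z
    simpa using h1 1 0 z
  · intro z
    simpa using h1 0 1 z

/-- The class of μ satisfies the condition defining `φL₀`, and any other solution differs from μ by
an element of `latHat`. -/
theorem φL₀_pM (μ : ℂ) : φL₀ δ τ (pM δ τ μ) = pMhat δ τ μ := by
  have h := Classical.epsilon_spec (p := fun q => ∃ μh : ℂ, pMhat δ τ μh = q ∧
    Nonempty (HolIso (picBundle δ τ μh)
      (tensor (pullback (pM δ τ) (fun y => y + pM δ τ μ) (L₀ δ τ)) (dual (L₀ δ τ)))))
    ⟨pMhat δ τ μ, μ, rfl, exists_iso_pic δ τ (liftTrans δ τ μ) μ (liftTrans_factor δ τ μ)⟩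
  obtain ⟨μh, h1, ⟨A⟩⟩ := h
  refine h1.symm.trans (((isCov_pMhat δ τ).deck _ _).2 (sub_mem_latHat_of_iso δ τ A))

theorem pMMhat_eq_IdPhi (w : ℂ × ℂ) : pMMhat δ τ w = IdPhi δ τ (pMM δ τ w) :=
  Prod.ext rfl (φL₀_pM δ τ w.2).symm

theorem lat_le_latHat : lat δ τ ≤ latHat δ τ := by
  intro l hl
  obtain ⟨a, b, rfl⟩ := (mem_lat δ τ).1 hl
  refine (mem_latHat δ τ).2 ⟨a * (δ : ℕ), b * (δ : ℕ), ?_⟩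
  have := delta_ne (δ := δ)
  push_cast
  field_simp

theorem exists_mem_prod (l : ℂ × ℂ) (hl : l ∈ (lat δ τ).prod (lat δ τ)) :
    ∃ k ∈ (lat δ τ).prod (latHat δ τ), ∀ w, id (w + l) = id w + k :=
  ⟨l, ⟨hl.1, lat_le_latHat δ τ hl.2⟩, fun _ => rfl⟩

/-- The trivialization of `(Id × φ_{L₀})^* P`. -/
def liftPhiP : LiftTriv (phiP δ τ) ℂ ((lat δ τ).prod (lat δ τ)) :=
  (liftP' δ τ).pullback (isCov_pMMhat δ τ) (isCov_pMM δ τ) (IdPhi δ τ) id (pMMhat_eq_IdPhi δ τ)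
    differentiable_id (exists_mem_prod δ τ)

theorem liftPhiP_factor (a b c d : ℤ) :
    (liftPhiP δ τ).HasFactor ((a * (δ : ℕ) + b * τ : ℂ), (c * (δ : ℕ) + d * τ : ℂ)) (fun w =>
      Complex.exp (-2 * Real.pi * Complex.I * (b * w.2 + d * w.1 + b * d * τ))) := by
  have hδ := delta_ne (δ := δ)
  -- In the basis 1, τ/δ of `latHat` the vector cδ + dτ has coordinates cδ and dδ; this removes the
  -- denominators from the factor.
  have h := (liftP'_factor δ τ a b (c * (δ : ℕ)) (d * (δ : ℕ))).pullback (isCov_pMMhat δ τ)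
    (isCov_pMM δ τ) (pMMhat_eq_IdPhi δ τ) differentiable_id (exists_mem_prod δ τ)
    (l := ((a * (δ : ℕ) + b * τ : ℂ), (c * (δ : ℕ) + d * τ : ℂ))) (fun w => by
      have e : (c * (δ : ℕ) + d * τ : ℂ) =
          ((c * (δ : ℕ) : ℤ) : ℂ) + ((d * (δ : ℕ) : ℤ) : ℂ) * (τ / (δ : ℕ)) := by
        push_cast; field_simp
      rw [e])
  refine h.congr fun w => ?_
  congr 2
  push_cast
  field_simp

/-! #### The Poincaré bundle -/

theorem isPoincare_PBundle : IsPoincare δ τ (PBundle δ τ) := by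
  refine ⟨(liftP' δ τ).isHolBundle (isCov_pMMhat δ τ) (Module.finrank_self ℂ), fun μh => ?_, ?_⟩
  · have hΓ : ∀ l ∈ lat δ τ, ∃ k ∈ (lat δ τ).prod (latHat δ τ), ∀ w : ℂ,
        ((w + l, μh) : ℂ × ℂ) = (w, μh) + k := fun l hl =>
      ⟨(l, 0), ⟨hl, AddSubgroup.zero_mem _⟩, fun w => by simp⟩
    have hd : Differentiable ℂ fun z : ℂ => ((z, μh) : ℂ × ℂ) := by fun_prop
    obtain ⟨A⟩ := exists_iso_pic δ τ ((liftP' δ τ).pullback (isCov_pMMhat δ τ) (isCov_pM δ τ)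
      (fun x => (x, pMhat δ τ μh)) (fun z => (z, μh)) (fun _ => rfl) hd hΓ) μh (fun a b => by
        have h := (liftP'_factor δ τ a b 0 0).pullback (isCov_pMMhat δ τ) (isCov_pM δ τ)
          (g := fun x => (x, pMhat δ τ μh)) (fun _ => rfl) hd hΓ (l := a * (δ : ℕ) + b * τ)
          (fun w => by simp)
        refine h.congr fun w => ?_
        congr 1
        simp)
    exact ⟨A.symm⟩
  · have hΓ : ∀ l ∈ latHat δ τ, ∃ k ∈ (lat δ τ).prod (latHat δ τ), ∀ w : ℂ,
        ((0, w + l) : ℂ × ℂ) = (0, w) + k := fun l hl =>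
      ⟨(0, l), ⟨AddSubgroup.zero_mem _, hl⟩, fun w => by simp⟩
    have hd : Differentiable ℂ fun z : ℂ => ((0, z) : ℂ × ℂ) := by fun_prop
    obtain ⟨A, -⟩ := LiftTriv.exists_iso ((liftP' δ τ).pullback (isCov_pMMhat δ τ) (isCov_pMhat δ τ)
      (fun q => (pM δ τ 0, q)) (fun z => (0, z)) (fun _ => rfl) hd hΓ)
      (trivialLift (pMhat δ τ) (latHat δ τ)) (isCov_pMhat δ τ) 1 (differentiable_const _)
      (fun _ => one_ne_zero) (fun l hl => by
        obtain ⟨c, d, rfl⟩ := (mem_latHat δ τ).1 hl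
        refine ⟨_, _, (liftP'_factor δ τ 0 0 c d).pullback (isCov_pMMhat δ τ) (isCov_pMhat δ τ)
          (g := fun q => (pM δ τ 0, q)) (fun _ => rfl) hd hΓ (fun w => by simp),
          trivialLift_factor _, fun w => by simp⟩)
    exact ⟨A⟩

end Phi

/-! ### Uniqueness of the normalized isomorphism with J -/

section Normalized

variable (δ : ℕ+) (τ : ℍ)

theorem gaugeP_zero (μ : ℂ) : gaugeP τ (0, μ) = 1 := by simp [gaugeP]

/-- At z = 0 both the cocycle of 𝒫 in ξ and the gauge are 1, so the canonical trivialization agrees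
with the holomorphic one. -/
theorem eval_eq_of_zero (y : M δ τ × Mhat δ τ) (μ : ℂ) (h : pMMhat δ τ (0, μ) = y)
    (u : PcalFib δ τ (IdIso δ τ y)) (ξ : ℝ × ℝ) (hξ : pMMstar δ τ (0, ξ) = IdIso δ τ y) :
    u.1 ⟨(0, ξ), hξ⟩ = trivP δ τ y (0, μ) h u := by
  have h1 := multEval_factor (isCocycle_P δ τ) (IdIso δ τ y) _ _ (IdIso_eq δ τ _ h) hξ u
  rw [trivP_apply, gaugeP_zero, one_mul]
  refine h1.trans ?_
  simp only [cocP, x₁, x₂]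
  simp [multEval_apply]

theorem isNormalized_iff (Ψ : HolIso (J δ τ) (phiP δ τ)) {g : ℂ × ℂ → ℂ}
    (hg : ∀ y w h u, (liftPhiP δ τ).T y w h (Ψ.toEquiv y u) = g w * (liftJ δ τ).T y w h u) :
    IsNormalized δ τ Ψ ↔ ∀ μ, g (0, μ) = 1 := by
  have key : ∀ (μ : ℂ) (v : (J δ τ).Fib (pM δ τ 0, pM δ τ μ)) (ξ : ℝ × ℝ)
    (hξ : pMMstar δ τ (0, ξ) = IdIso δ τ (IdPhi δ τ (pM δ τ 0, pM δ τ μ))),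
    Subtype.val (p := (· ∈ PcalFib δ τ (IdIso δ τ (IdPhi δ τ (pM δ τ 0, pM δ τ μ)))))
      (Ψ.toEquiv (pM δ τ 0, pM δ τ μ) v) ⟨(0, ξ), hξ⟩ = g (0, μ) * v.1 ⟨(0, μ), rfl⟩ := by
    intro μ v ξ hξ
    exact (eval_eq_of_zero δ τ (IdPhi δ τ (pM δ τ 0, pM δ τ μ)) μ (pMMhat_eq_IdPhi δ τ (0, μ))
      (Ψ.toEquiv (pM δ τ 0, pM δ τ μ) v) ξ hξ).trans (hg (pM δ τ 0, pM δ τ μ) (0, μ) rfl v)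
  constructor
  · intro h μ
    have h1 := key μ (((liftJ δ τ).T (pM δ τ 0, pM δ τ μ) (0, μ) rfl).symm 1) (isoLift δ τ μ)
      (IdIso_eq δ τ (0, μ) (pMMhat_eq_IdPhi δ τ (0, μ)))
    rw [h] at h1
    have h2 : (((liftJ δ τ).T (pM δ τ 0, pM δ τ μ) (0, μ) rfl).symm 1).1 ⟨(0, μ), rfl⟩ = 1 :=
      ((liftJ δ τ).T (pM δ τ 0, pM δ τ μ) (0, μ) rfl).apply_symm_apply 1
    rw [h2, mul_one] at h1
    exact h1.symm
  · intro h μ v ξ hξ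
    rw [key, h, one_mul]

theorem exists_isNormalized : ∃ Ψ : HolIso (J δ τ) (phiP δ τ), IsNormalized δ τ Ψ := by
  obtain ⟨Ψ, hΨ⟩ := LiftTriv.exists_iso (liftJ δ τ) (liftPhiP δ τ) (isCov_pMM δ τ) (fun _ => 1)
    (differentiable_const _) (fun _ => one_ne_zero) (fun l hl => by
      obtain ⟨⟨a, b, h1⟩, ⟨c, d, h2⟩⟩ := And.imp (mem_lat δ τ).1 (mem_lat δ τ).1 hl
      have hl : l = ((a * (δ : ℕ) + b * τ : ℂ), (c * (δ : ℕ) + d * τ : ℂ)) := Prod.ext h1 h2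
      subst hl
      exact ⟨_, _, liftJ_factor δ τ a b c d, liftPhiP_factor δ τ a b c d, fun w => by ring⟩)
  exact ⟨Ψ, (isNormalized_iff δ τ Ψ hΨ).2 fun _ => rfl⟩

/-- Ψ is multiplication by an entire `g`. Equal factors of automorphy make `g` Λ-periodic in z,
hence constant in z by Liouville, and its value at z = 0 is 1. -/
theorem liftPhiP_of_isNormalized {Ψ : HolIso (J δ τ) (phiP δ τ)} (hΨ : IsNormalized δ τ Ψ)
    (y : M δ τ × M δ τ) (w : ℂ × ℂ) (h : pMM δ τ w = y) (u : (J δ τ).Fib y) :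
    (liftPhiP δ τ).T y w h (Ψ.toEquiv y u) = (liftJ δ τ).T y w h u := by
  obtain ⟨g, hg, hg0, hA⟩ := LiftTriv.exists_mul_of_iso (liftJ δ τ) (liftPhiP δ τ)
    (isCov_pMM δ τ) Ψ
  have h1 := (isNormalized_iff δ τ Ψ hA).1 hΨ
  have h2 : ∀ (a b : ℤ) (w : ℂ × ℂ), g (w + ((a * (δ : ℕ) + b * τ : ℂ), 0)) = g w := by
    intro a b w
    have h3 := liftJ_factor δ τ a b 0 0
    have h4 := liftPhiP_factor δ τ a b 0 0
    have e : ((0 : ℤ) * (δ : ℕ) + (0 : ℤ) * τ : ℂ) = 0 := by simp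
    rw [e] at h3 h4
    have h5 := LiftTriv.mul_factor_eq (liftJ δ τ) (liftPhiP δ τ) hA
      ((isCov_pMM δ τ).add ⟨(mem_lat δ τ).2 ⟨a, b, rfl⟩, AddSubgroup.zero_mem _⟩) h3 h4 w
    rw [mul_comm] at h5
    exact mul_left_cancel₀ (Complex.exp_ne_zero _) h5
  have h3 : ∀ w : ℂ × ℂ, g w = 1 := fun w => by
    rw [← h1 w.2]
    have hd : Differentiable ℂ fun z : ℂ => ((z, w.2) : ℂ × ℂ) := by fun_prop
    refine eq_const_of_norm_periodic (δ := δ) (τ := τ) (f := fun z => g (z, w.2)) (hg.comp hd)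
      (fun z => ?_) (fun z => ?_) w.1
    · have := h2 1 0 (z, w.2)
      simp at this
      rw [this]
    · have := h2 0 1 (z, w.2)
      simp at this
      rw [this]
  rw [hA, h3, one_mul]

theorem hPhiP_apply {Ψ : HolIso (J δ τ) (phiP δ τ)} (hΨ : IsNormalized δ τ Ψ)
    (y : M δ τ × M δ τ) (w : ℂ × ℂ) (h : pMM δ τ w = y) (s t : (phiP δ τ).Fib y) :
    hPhiP δ τ Ψ y s t = (Real.exp (-4 * Real.pi / τ.im * (w.1.im * w.2.im)) : ℝ) *
      ((liftPhiP δ τ).T y w h s * (starRingEnd ℂ) ((liftPhiP δ τ).T y w h t)) := by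
  refine (hJ_apply δ τ y w h ((Ψ.toEquiv y).symm s) ((Ψ.toEquiv y).symm t)).trans ?_
  rw [← liftPhiP_of_isNormalized δ τ hΨ, ← liftPhiP_of_isNormalized δ τ hΨ,
    LinearEquiv.apply_symm_apply, LinearEquiv.apply_symm_apply]

end Normalized

/-! ### The Hermitian line bundles Ẽ and Ẽ' -/

section Tensor

/-- The tensor product of two metrics on lines. -/
theorem tensorSesq_line {P Q : Type} [AddCommGroup P] [Module ℂ P] [AddCommGroup Q] [Module ℂ Q]
    (A : P ≃ₗ[ℂ] ℂ) (B : Q ≃ₗ[ℂ] ℂ) {h : Sesq P} {k : Sesq Q} {a b : ℂ}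
    (ha : ∀ s t, h s t = a * (A s * (starRingEnd ℂ) (A t)))
    (hb : ∀ s t, k s t = b * (B s * (starRingEnd ℂ) (B t))) (s t : P ⊗[ℂ] Q) :
    tensorSesq h k s t =
      a * b * (lineTensor A B s * (starRingEnd ℂ) (lineTensor A B t)) := by
  conv_lhs => rw [lineTensor_symm A B s, lineTensor_symm A B t]
  rw [tensorSesq_tmul, ha, hb]
  simp
  ring

/-- The standard Hermitian form on `ℂ`. -/
def stdForm : Sesq ℂ :=
  LinearMap.mk₂'ₛₗ (RingHom.id ℂ) (starRingEnd ℂ) (fun s t => s * (starRingEnd ℂ) t)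
    (by intros; simp [add_mul]) (by intros; simp [mul_assoc])
    (by intros; simp [mul_add]) (by intros; simp [mul_left_comm])

theorem isPosHerm_stdForm : IsPosHerm stdForm where
  symm s t := by simp [stdForm, mul_comm]
  pos s hs := by
    simp only [stdForm, LinearMap.mk₂'ₛₗ_apply, Complex.mul_conj]
    exact_mod_cast Complex.normSq_pos.2 hs

variable (δ : ℕ+) (τ : ℍ)

/-- The weight of the metrics on `Ẽ` and `Ẽ'`. -/
def wtE (w : ℂ × ℂ) : ℝ := wt τ w.1 * Real.exp (-4 * Real.pi / τ.im * (w.1.im * w.2.im))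

theorem contDiff_wtE : ContDiff ℝ ∞ (wtE τ) := by
  have e1 : ContDiff ℝ ∞ fun w : ℂ × ℂ => w.1.im := Complex.imCLM.contDiff.comp contDiff_fst
  have e2 : ContDiff ℝ ∞ fun w : ℂ × ℂ => w.2.im := Complex.imCLM.contDiff.comp contDiff_snd
  unfold wtE wt
  fun_prop

theorem wtE_pos (w : ℂ × ℂ) : 0 < wtE τ w := mul_pos (Real.exp_pos _) (Real.exp_pos _)

theorem fst_mem (Γ : AddSubgroup ℂ) (l : ℂ × ℂ) (hl : l ∈ (lat δ τ).prod Γ) :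
    ∃ k ∈ lat δ τ, ∀ w : ℂ × ℂ, (w + l).1 = w.1 + k := ⟨l.1, hl.1, fun _ => rfl⟩

/-- The trivialization of `Ẽ`. -/
def liftEtilde : LiftTriv (Etilde δ τ) ℂ ((lat δ τ).prod (latHat δ τ)) :=
  ((liftL₀ δ τ).pullback (isCov_pM δ τ) (isCov_pMMhat δ τ) Prod.fst Prod.fst (fun _ => rfl)
    differentiable_fst (fst_mem δ τ _)).tensor (liftP' δ τ) (isCov_pMMhat δ τ)

theorem liftEtilde_factor (a b c d : ℤ) :
    (liftEtilde δ τ).HasFactor ((a * (δ : ℕ) + b * τ : ℂ), (c + d * (τ / (δ : ℕ)) : ℂ)) (fun w =>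
      Complex.exp (-2 * Real.pi * Complex.I * (b * w.1) - Real.pi * Complex.I * (b ^ 2 * τ)) *
      Complex.exp (-2 * Real.pi * Complex.I *
        (b * w.2 + d * (w.1 / (δ : ℕ)) + b * d * (τ / (δ : ℕ))))) :=
  LiftTriv.HasFactor.tensor (isCov_pMMhat δ τ)
    ((liftL₀_factor δ τ a b).pullback (isCov_pM δ τ) (isCov_pMMhat δ τ) (fun _ => rfl)
    differentiable_fst (fst_mem δ τ _) (fun _ => rfl)) (liftP'_factor δ τ a b c d)

theorem hEtilde_apply (y : M δ τ × Mhat δ τ) (w : ℂ × ℂ) (h : pMMhat δ τ w = y)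
    (s t : (Etilde δ τ).Fib y) : hEtilde δ τ y s t =
      wtE τ w * stdForm ((liftEtilde δ τ).T y w h s) ((liftEtilde δ τ).T y w h t) := by
  refine (tensorSesq_line ((liftL₀ δ τ).T y.1 w.1 (congrArg Prod.fst h)) ((liftP' δ τ).T y w h)
    (hL₀_apply δ τ y.1 w.1 (congrArg Prod.fst h)) (hP_apply δ τ y w h) s t).trans ?_
  rw [wtE, Complex.ofReal_mul]
  rfl

/-- The trivialization of `Ẽ'`. -/
def liftEtilde' : LiftTriv (Etilde' δ τ) ℂ ((lat δ τ).prod (lat δ τ)) :=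
  ((liftL₀ δ τ).pullback (isCov_pM δ τ) (isCov_pMM δ τ) Prod.fst Prod.fst (fun _ => rfl)
    differentiable_fst (fst_mem δ τ _)).tensor (liftPhiP δ τ) (isCov_pMM δ τ)

theorem liftEtilde'_factor (a b c d : ℤ) :
    (liftEtilde' δ τ).HasFactor ((a * (δ : ℕ) + b * τ : ℂ), (c * (δ : ℕ) + d * τ : ℂ)) (fun w =>
      Complex.exp (-2 * Real.pi * Complex.I * (b * w.1) - Real.pi * Complex.I * (b ^ 2 * τ)) *
      Complex.exp (-2 * Real.pi * Complex.I * (b * w.2 + d * w.1 + b * d * τ))) :=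
  LiftTriv.HasFactor.tensor (isCov_pMM δ τ)
    ((liftL₀_factor δ τ a b).pullback (isCov_pM δ τ) (isCov_pMM δ τ) (fun _ => rfl)
    differentiable_fst (fst_mem δ τ _) (fun _ => rfl)) (liftPhiP_factor δ τ a b c d)

theorem hEtilde'_apply {Ψ : HolIso (J δ τ) (phiP δ τ)} (hΨ : IsNormalized δ τ Ψ)
    (y : M δ τ × M δ τ) (w : ℂ × ℂ) (h : pMM δ τ w = y) (s t : (Etilde' δ τ).Fib y) :
    hEtilde' δ τ Ψ y s t =
      wtE τ w * stdForm ((liftEtilde' δ τ).T y w h s) ((liftEtilde' δ τ).T y w h t) := by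
  refine (tensorSesq_line ((liftL₀ δ τ).T y.1 w.1 (congrArg Prod.fst h))
    ((liftPhiP δ τ).T y w h) (hL₀_apply δ τ y.1 w.1 (congrArg Prod.fst h))
    (hPhiP_apply δ τ hΨ y w h) s t).trans ?_
  rw [wtE, Complex.ofReal_mul]
  rfl

theorem isHermitian_Etilde :
    IsHolBundle (Etilde δ τ) 1 ∧ IsHermMetric (Etilde δ τ) (hEtilde δ τ) :=
  ⟨(liftEtilde δ τ).isHolBundle (isCov_pMMhat δ τ) (Module.finrank_self ℂ),
    (liftEtilde δ τ).isHermMetric (isCov_pMMhat δ τ) isPosHerm_stdForm (contDiff_wtE τ)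
      (wtE_pos τ) (hEtilde_apply δ τ)⟩

theorem isHermitian_Etilde' {Ψ : HolIso (J δ τ) (phiP δ τ)} (hΨ : IsNormalized δ τ Ψ) :
    IsHolBundle (Etilde' δ τ) 1 ∧ IsHermMetric (Etilde' δ τ) (hEtilde' δ τ Ψ) :=
  ⟨(liftEtilde' δ τ).isHolBundle (isCov_pMM δ τ) (Module.finrank_self ℂ),
    (liftEtilde' δ τ).isHermMetric (isCov_pMM δ τ) isPosHerm_stdForm (contDiff_wtE τ)
      (wtE_pos τ) (hEtilde'_apply δ τ hΨ)⟩

/-- The identity map `Ẽ' → (Id × φ_{L₀})^* Ẽ`. -/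
def isoEtilde : HolIso (Etilde' δ τ) (pullback (pMM δ τ) (IdPhi δ τ) (Etilde δ τ)) :=
  (liftEtilde' δ τ).isoOfMul ((liftEtilde δ τ).pullback (isCov_pMMhat δ τ) (isCov_pMM δ τ)
    (IdPhi δ τ) id (pMMhat_eq_IdPhi δ τ) differentiable_id (exists_mem_prod δ τ))
    -- The fibres agree by definition, and since `IdPhi` lifts to the identity so do the
    -- trivializations; the multiplying function is therefore 1.
    (fun y => LinearEquiv.refl ℂ ((Etilde' δ τ).Fib y)) 1 (differentiable_const _)
    (fun _ => one_ne_zero) (fun y w h u => (one_smul ℂ ((liftEtilde' δ τ).T y w h u)).symm)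

theorem isIsometry_isoEtilde {Ψ : HolIso (J δ τ) (phiP δ τ)} (hΨ : IsNormalized δ τ Ψ) :
    (isoEtilde δ τ).IsIsometry (hEtilde' δ τ Ψ) (fun y => hEtilde δ τ (IdPhi δ τ y)) := by
  intro y u v
  obtain ⟨w, h⟩ := (isCov_pMM δ τ).surj y
  refine (hEtilde_apply δ τ (IdPhi δ τ y) w ((pMMhat_eq_IdPhi δ τ w).trans (congrArg _ h))
    u v).trans ?_
  rw [hEtilde'_apply δ τ hΨ y w h]
  rfl

end Tensor

/-! ### Theta functions under lattice translations and with parameters -/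

section ThetaLattice

variable {δ : ℕ+} {τ : ℍ}

theorem thetaSpace_add_lat {f : ℂ → ℂ} (hf : f ∈ ThetaSpace δ τ) (a b : ℤ) (z : ℂ) :
    f (z + (a * (δ : ℕ) + b * τ)) =
      Complex.exp (-2 * Real.pi * Complex.I * (b * z) - Real.pi * Complex.I * (b ^ 2 * τ)) *
        f z := by
  have h1 : Function.Periodic f ((δ : ℕ) : ℂ) := hf.2.1
  have h2 : f (z + (a * (δ : ℕ) + b * τ)) = f (z + b * τ) := by
    rw [add_left_comm, add_comm, ← zsmul_eq_mul ((δ : ℕ) : ℂ) a]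
    exact h1.zsmul a (z + b * τ)
  rw [h2]
  clear h2
  induction b using Int.induction_on with
  | zero => simp
  | succ i ih =>
    have e : z + ((i + 1 : ℤ) : ℂ) * τ = z + ((i : ℤ) : ℂ) * τ + τ := by push_cast; ring
    rw [e, hf.2.2, ih, thetaMult, ← mul_assoc, ← Complex.exp_add]
    congr 2
    push_cast; ring
  | pred i ih =>
    have e : z + ((-i : ℤ) : ℂ) * τ = z + ((-i - 1 : ℤ) : ℂ) * τ + τ := by push_cast; ring
    rw [e, hf.2.2, thetaMult] at ih
    refine mul_left_cancel₀ (Complex.exp_ne_zero _) (ih.trans ?_)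
    rw [← mul_assoc (Complex.exp _) (Complex.exp _), ← Complex.exp_add]
    congr 2
    push_cast; ring

theorem thetaCoef_finset_sum (c : Fin δ → ℂ) (f : Fin δ → ℂ → ℂ) (k : Fin δ) :
    thetaCoef δ τ (fun z => ∑ l, c l * f l z) k = ∑ l, thetaCoef δ τ (f l) k * c l := by
  simp only [thetaCoef, thetaProj, Finset.mul_sum, Finset.sum_div, Finset.sum_mul]
  rw [Finset.sum_comm]
  refine Finset.sum_congr rfl fun l _ => Finset.sum_congr rfl fun j _ => ?_
  ring

/-- The coefficients depend holomorphically on parameters. -/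
theorem differentiableAt_thetaCoef {f : ℂ → ℂ → ℂ} {μ : ℂ} (k : Fin δ)
    (hf : ∀ j ∈ Finset.range δ,
      DifferentiableAt ℂ (fun ν => f ν (thetaPt δ τ (k : ℕ) + (j : ℕ))) μ) :
    DifferentiableAt ℂ (fun ν => thetaCoef δ τ (f ν) k) μ := by
  simp only [thetaCoef, thetaProj]
  refine (DifferentiableAt.const_mul ?_ _).div_const _
  refine DifferentiableAt.fun_sum fun j hj => ?_
  exact (hf j hj).const_mul _

end ThetaLattice

/-! ### The push-forward in the frame of theta functions -/

section Pushforward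

variable {δ : ℕ+} {τ : ℍ} {X₂ : Type} [TopologicalSpace X₂] {p₂ : ℂ → X₂} {Γ₂ : AddSubgroup ℂ}
  {F : HolBundle (Prod.map (pM δ τ) p₂)} (L : LiftTriv F ℂ ((lat δ τ).prod Γ₂))

/-- The function on `V` of a section over `M × {y}`. -/
def sliceVal {y : X₂} (s : ∀ x, F.Fib (x, y)) (μ : ℂ) (h : p₂ μ = y) (z : ℂ) : ℂ :=
  L.T (pM δ τ z, y) (z, μ) (Prod.ext rfl h) (s (pM δ τ z))

theorem sliceVal_eq {y : X₂} (s : ∀ x, F.Fib (x, y)) (μ : ℂ) (h : p₂ μ = y) {x : M δ τ} {z : ℂ}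
    (hz : pM δ τ z = x) :
    L.T (x, y) (z, μ) (Prod.ext hz h) (s x) = sliceVal L s μ h z := by
  subst hz; rfl

theorem sliceVal_injective {y : X₂} {s t : ∀ x, F.Fib (x, y)} {μ : ℂ} {h : p₂ μ = y}
    (hst : ∀ z, sliceVal L s μ h z = sliceVal L t μ h z) : s = t := by
  funext x
  obtain ⟨z, rfl⟩ := pM_surj δ τ x
  exact (L.T _ _ _).injective (hst z)

theorem mem_pushforward_fib (hp₂ : IsCov p₂ Γ₂) {y : X₂} (s : ∀ x, F.Fib (x, y)) (μ : ℂ)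
    (h : p₂ μ = y) :
    s ∈ (⨅ x, (pullback (pM δ τ) (fun x => (x, y)) F).hol x :
      Submodule ℂ (∀ x, (pullback (pM δ τ) (fun x => (x, y)) F).Fib x)) ↔
    Differentiable ℂ (sliceVal L s μ h) := by
  subst h
  have hd : Differentiable ℂ fun z : ℂ => ((z, μ) : ℂ × ℂ) := by fun_prop
  have hΓ : ∀ l ∈ lat δ τ, ∃ k ∈ (lat δ τ).prod Γ₂, ∀ w : ℂ,
      ((w + l, μ) : ℂ × ℂ) = (w, μ) + k := fun l hl =>
    ⟨(l, 0), ⟨hl, AddSubgroup.zero_mem _⟩, fun w => by simp⟩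
  refine (Submodule.mem_iInf (R := ℂ) (M := ∀ x, F.Fib (x, p₂ μ)) _).trans ?_
  have h1 := (L.pullback ((isCov_pM δ τ).prodMap hp₂) (isCov_pM δ τ) (fun x => (x, p₂ μ))
      (fun z => (z, μ)) (fun _ => rfl) hd hΓ).hol
  constructor
  · intro hs z
    exact ((h1 (pM δ τ z) s).1 (hs _) z rfl).self_of_nhds
  · intro hs x
    exact (h1 x s).2 fun w _ => Eventually.of_forall fun v => hs v

/-- The factors of automorphy of `π₁^* L₀ ⊗ P` under translations in the first variable. -/
def IsThetaLift : Prop := ∀ a b : ℤ, L.HasFactor (a * (δ : ℕ) + b * τ, 0) (fun w =>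
  Complex.exp (-2 * Real.pi * Complex.I * (b * (w.1 + w.2)) -
    Real.pi * Complex.I * (b ^ 2 * τ)))

variable {L} in
theorem IsThetaLift.sliceVal_add (hL : IsThetaLift L) {y : X₂} (s : ∀ x, F.Fib (x, y)) (μ : ℂ)
    (h : p₂ μ = y) (a b : ℤ) (z : ℂ) : sliceVal L s μ h (z + (a * (δ : ℕ) + b * τ)) =
      Complex.exp (-2 * Real.pi * Complex.I * (b * (z + μ)) -
        Real.pi * Complex.I * (b ^ 2 * τ)) * sliceVal L s μ h z := by
  have hz : pM δ τ (z + (a * (δ : ℕ) + b * τ)) = pM δ τ z :=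
    (isCov_pM δ τ).add ((mem_lat δ τ).2 ⟨a, b, rfl⟩) z
  have e : ((z, μ) : ℂ × ℂ) + ((a * (δ : ℕ) + b * τ : ℂ), 0) = (z + (a * (δ : ℕ) + b * τ), μ) := by
    simp
  have h1 := hL a b (pM δ τ z, y) (z, μ) (Prod.ext rfl h) (by rw [e]; exact Prod.ext hz h)
    (s (pM δ τ z))
  have h2 : Prod.map (pM δ τ) p₂ (z + (a * (δ : ℕ) + b * τ), μ) = (pM δ τ z, y) := Prod.ext hz h
  rw [L.symm_rfl e _ h2, sliceVal_eq L s μ h hz] at h1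
  exact h1

/-- An element of the push-forward as a section over `M × {y}`. -/
def pushVal {y : X₂} (s : (pushforward (pM δ τ) p₂ F).Fib y) : ∀ x, F.Fib (x, y) :=
  Subtype.val (p := (· ∈ (⨅ x, (pullback (pM δ τ) (fun x => (x, y)) F).hol x :
    Submodule ℂ (∀ x, (pullback (pM δ τ) (fun x => (x, y)) F).Fib x)))) s

/-- The theta function of a section over `M × {y}`. -/
def thetaOf {y : X₂} (s : ∀ x, F.Fib (x, y)) (μ : ℂ) (h : p₂ μ = y) (z : ℂ) : ℂ :=
  sliceVal L s μ h (z - μ)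

variable {L}

/-- The factors over M × {μ} are those of L₀ at z + μ, so the shift by μ produces a section of L₀.
-/
theorem IsThetaLift.thetaOf_mem (hL : IsThetaLift L) (hp₂ : IsCov p₂ Γ₂) {y : X₂}
    (s : (pushforward (pM δ τ) p₂ F).Fib y) (μ : ℂ) (h : p₂ μ = y) :
    thetaOf L (pushVal s) μ h ∈ ThetaSpace δ τ := by
  refine ⟨((mem_pushforward_fib L hp₂ (pushVal s) μ h).1 s.2).comp (by fun_prop), fun z => ?_, fun z => ?_⟩
  · have h1 := hL.sliceVal_add (pushVal s) μ h 1 0 (z - μ)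
    simp only [Int.cast_one, Int.cast_zero] at h1
    unfold thetaOf
    convert h1 using 1
    · congr 1; ring
    · simp
  · have h1 := hL.sliceVal_add (pushVal s) μ h 0 1 (z - μ)
    simp only [Int.cast_one, Int.cast_zero] at h1
    unfold thetaOf thetaMult
    convert h1 using 1
    · congr 1; ring
    · congr 2; ring

/-- A section is prescribed at one chosen point over each `x`; the common factors of automorphy make
it take the value f(z + μ) at every other point. -/
theorem IsThetaLift.exists_thetaOf (hL : IsThetaLift L) (hp₂ : IsCov p₂ Γ₂) {y : X₂} (μ : ℂ)
    (h : p₂ μ = y) (f : ThetaSpace δ τ) :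
    ∃ s : (pushforward (pM δ τ) p₂ F).Fib y, thetaOf L (pushVal s) μ h = f.1 := by
  choose σ hσ using pM_surj δ τ
  let s : ∀ x, F.Fib (x, y) := fun x =>
    (L.T (x, y) (σ x, μ) (Prod.ext (hσ x) h)).symm (f.1 (σ x + μ))
  have h1 : ∀ z, sliceVal L s μ h z = f.1 (z + μ) := by
    intro z
    obtain ⟨a, b, e⟩ := exists_int_of_pM (hσ (pM δ τ z))
    have h2 := hL.sliceVal_add s μ h a b (σ (pM δ τ z))
    rw [← e, ← sliceVal_eq L s μ h (hσ _)] at h2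
    simp only [s, LinearEquiv.apply_symm_apply] at h2
    rw [h2, ← thetaSpace_add_lat f.2, add_right_comm, ← e]
  refine ⟨⟨s, (mem_pushforward_fib L hp₂ s μ h).2 ?_⟩, funext fun z => ?_⟩
  · rw [funext h1]
    exact f.2.1.comp (by fun_prop)
  · exact (h1 _).trans (by rw [sub_add_cancel])

/-- The sections over `M × {y}` are the theta functions. -/
def IsThetaLift.fibEquiv (hL : IsThetaLift L) (hp₂ : IsCov p₂ Γ₂) (y : X₂) (μ : ℂ)
    (h : p₂ μ = y) : (pushforward (pM δ τ) p₂ F).Fib y ≃ₗ[ℂ] ThetaSpace δ τ :=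
  LinearEquiv.ofBijective
    { toFun := fun s => ⟨thetaOf L (pushVal s) μ h, hL.thetaOf_mem hp₂ s μ h⟩
      map_add' := fun s t => Subtype.ext (funext fun z => (L.T _ _ _).map_add _ _)
      map_smul' := fun c s => Subtype.ext (funext fun z => (L.T _ _ _).map_smul _ _) }
    ⟨fun s t hst => Subtype.ext (sliceVal_injective L (μ := μ) (h := h) fun z => by
        have := congrFun (congrArg Subtype.val hst) (z + μ)
        change sliceVal L (pushVal s) μ h (z + μ - μ) = sliceVal L (pushVal t) μ h (z + μ - μ)
          at this
        rw [add_sub_cancel_right] at this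
        exact this),
      fun f => by
        obtain ⟨s, hs⟩ := hL.exists_thetaOf hp₂ μ h f
        exact ⟨s, Subtype.ext hs⟩⟩

theorem IsThetaLift.fibEquiv_apply (hL : IsThetaLift L) (hp₂ : IsCov p₂ Γ₂) (y : X₂) (μ : ℂ)
    (h : p₂ μ = y) (s : (pushforward (pM δ τ) p₂ F).Fib y) :
    (hL.fibEquiv hp₂ y μ h s).1 = thetaOf L (pushVal s) μ h := rfl

/-- The trivialization of the push-forward. -/
def IsThetaLift.pushTriv (hL : IsThetaLift L) (hp₂ : IsCov p₂ Γ₂) (y : X₂) (μ : ℂ)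
    (h : p₂ μ = y) : (pushforward (pM δ τ) p₂ F).Fib y ≃ₗ[ℂ] (Fin δ → ℂ) :=
  (hL.fibEquiv hp₂ y μ h).trans (thetaEquiv δ τ)

theorem IsThetaLift.pushTriv_apply (hL : IsThetaLift L) (hp₂ : IsCov p₂ Γ₂) (y : X₂) (μ : ℂ)
    (h : p₂ μ = y) (s : (pushforward (pM δ τ) p₂ F).Fib y) :
    hL.pushTriv hp₂ y μ h s = thetaCoef δ τ (thetaOf L (pushVal s) μ h) := rfl

theorem IsThetaLift.thetaOf_eq_sum (hL : IsThetaLift L) (hp₂ : IsCov p₂ Γ₂) {y : X₂} (μ : ℂ)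
    (h : p₂ μ = y) (s : (pushforward (pM δ τ) p₂ F).Fib y) (z : ℂ) : thetaOf L (pushVal s) μ h z =
      ∑ k : Fin δ, hL.pushTriv hp₂ y μ h s k * thetaFun δ τ (k : ℕ) z :=
  thetaCoef_spec (hL.thetaOf_mem hp₂ s μ h) z

/-- The factor of automorphy of the push-forward, for a factor `n` of the line bundle. -/
def pushFactor (δ : ℕ+) (τ : ℍ) (n : ℂ × ℂ → ℂ) (l μ : ℂ) : (Fin δ → ℂ) →L[ℂ] (Fin δ → ℂ) :=
  ∑ k : Fin δ, ∑ k' : Fin δ,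
    thetaCoef δ τ (fun z => n (z - l - μ, μ) * thetaFun δ τ (k' : ℕ) (z - l)) k •
      (ContinuousLinearMap.proj k' : (Fin δ → ℂ) →L[ℂ] ℂ).smulRight (Pi.single k (1 : ℂ))

theorem pushFactor_apply (n : ℂ × ℂ → ℂ) (l μ : ℂ) (c : Fin δ → ℂ) (k : Fin δ) :
    pushFactor δ τ n l μ c k = ∑ k' : Fin δ,
      thetaCoef δ τ (fun z => n (z - l - μ, μ) * thetaFun δ τ (k' : ℕ) (z - l)) k * c k' := by
  simp [pushFactor, Finset.sum_apply, Pi.single_apply]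

theorem differentiable_pushFactor {n : ℂ × ℂ → ℂ} (hn : Differentiable ℂ n) (l : ℂ) :
    Differentiable ℂ (pushFactor δ τ n l) := by
  unfold pushFactor
  refine Differentiable.fun_sum fun k _ => Differentiable.fun_sum fun k' _ => ?_
  refine Differentiable.smul_const (fun μ => ?_) _
  refine differentiableAt_thetaCoef k fun j _ => ?_
  have : Differentiable ℂ fun μ => n (thetaPt δ τ (k : ℕ) + (j : ℕ) - l - μ, μ) :=
    hn.comp (f := fun μ : ℂ => ((thetaPt δ τ (k : ℕ) + (j : ℕ) - l - μ, μ) : ℂ × ℂ)) (by fun_prop)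
  exact (this μ).mul_const _

/-- Replacing μ by μ + l turns the theta function f(z) into n(z - l - μ, μ) f(z - l). Expanding f in
the basis makes this a matrix acting on coefficients. -/
theorem IsThetaLift.pushTriv_add (hL : IsThetaLift L) (hp₂ : IsCov p₂ Γ₂) {l : ℂ}
    {n : ℂ × ℂ → ℂ} (hn : L.HasFactor (0, l) n) (y : X₂) (μ : ℂ) (h : p₂ μ = y)
    (h' : p₂ (μ + l) = y) (s : (pushforward (pM δ τ) p₂ F).Fib y) :
    hL.pushTriv hp₂ y (μ + l) h' s = pushFactor δ τ n l μ (hL.pushTriv hp₂ y μ h s) := by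
  have h1 : thetaOf L (pushVal s) (μ + l) h' = fun z => ∑ k' : Fin δ, hL.pushTriv hp₂ y μ h s k' *
      (n (z - l - μ, μ) * thetaFun δ τ (k' : ℕ) (z - l)) := by
    funext z
    have e : ((z - (μ + l), μ) : ℂ × ℂ) + (0, l) = (z - (μ + l), μ + l) := by simp
    have h2 := hn (pM δ τ (z - (μ + l)), y) (z - (μ + l), μ) (Prod.ext rfl h)
      (by rw [e]; exact Prod.ext rfl h') (pushVal s (pM δ τ (z - (μ + l))))
    have h6 : Prod.map (pM δ τ) p₂ (z - (μ + l), μ + l) = (pM δ τ (z - (μ + l)), y) :=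
      Prod.ext rfl h'
    rw [L.symm_rfl e _ h6] at h2
    have h3 := hL.thetaOf_eq_sum hp₂ μ h s (z - l)
    have e2 : z - (μ + l) = z - l - μ := by ring
    have h4 : thetaOf L (pushVal s) (μ + l) h' z = n (z - (μ + l), μ) *
      sliceVal L (pushVal s) μ h (z - (μ + l)) := h2
    rw [h4, e2]
    have h5 : sliceVal L (pushVal s) μ h (z - l - μ) = thetaOf L (pushVal s) μ h (z - l) := rfl
    rw [h5, h3, Finset.mul_sum]
    refine Finset.sum_congr rfl fun k _ => ?_
    ring
  funext k
  rw [hL.pushTriv_apply, h1, thetaCoef_finset_sum, pushFactor_apply]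

theorem sliceVal_eq_thetaOf {y : X₂} (s : ∀ x, F.Fib (x, y)) (μ : ℂ) (h : p₂ μ = y) (z : ℂ) :
    sliceVal L s μ h z = thetaOf L s μ h (z + μ) := by
  rw [thetaOf, add_sub_cancel_right]

/-- The coefficients are finite combinations of values along the holomorphic curves ν ↦ (c - ν, ν),
so joint holomorphy passes to them. Conversely the section is the sum of the coefficients times
`thetaFun k (z + μ)`. -/
theorem IsThetaLift.mem_hol_iff (hL : IsThetaLift L) (hp₂ : IsCov p₂ Γ₂) (y : X₂)
    (s : ∀ y, (pushforward (pM δ τ) p₂ F).Fib y) :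
    s ∈ (pushforward (pM δ τ) p₂ F).hol y ↔ ∀ μ, p₂ μ = y → ∀ᶠ ν in 𝓝 μ,
      DifferentiableAt ℂ (fun ν => hL.pushTriv hp₂ (p₂ ν) ν rfl (s (p₂ ν))) ν := by
  have h0 : s ∈ (pushforward (pM δ τ) p₂ F).hol y ↔ ∀ (z μ : ℂ), p₂ μ = y →
      ∀ᶠ w in 𝓝 (z, μ), DifferentiableAt ℂ
        (fun w : ℂ × ℂ => sliceVal L (pushVal (s (p₂ w.2))) w.2 rfl w.1) w := by
    have h1 : s ∈ (pushforward (pM δ τ) p₂ F).hol y ↔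
        ∀ x, (fun q : M δ τ × X₂ => (pushVal (s q.2) q.1 : F.Fib q)) ∈ F.hol (x, y) := Iff.rfl
    rw [h1]
    constructor
    · intro hs z μ h
      exact (L.hol _ _).1 (hs (pM δ τ z)) (z, μ) (Prod.ext rfl h)
    · intro hs x
      exact (L.hol _ _).2 fun w hw => hs w.1 w.2 (congrArg Prod.snd hw)
  rw [h0]
  constructor
  · intro hs μ h
    have h1 : ∀ k : Fin δ, ∀ᶠ ν in 𝓝 μ, ∀ j ∈ Finset.range δ, DifferentiableAt ℂ
        (fun ν => thetaOf L (pushVal (s (p₂ ν))) ν rfl (thetaPt δ τ (k : ℕ) + (j : ℕ))) ν := by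
      intro k
      rw [Filter.eventually_all_finset]
      intro j _
      have hd : Differentiable ℂ fun ν : ℂ =>
          ((thetaPt δ τ (k : ℕ) + (j : ℕ) - ν, ν) : ℂ × ℂ) := by fun_prop
      filter_upwards [(hd μ).continuousAt.eventually (hs _ μ h)] with ν hν
      exact DifferentiableAt.comp
        (g := fun w : ℂ × ℂ => sliceVal L (pushVal (s (p₂ w.2))) w.2 rfl w.1)
        (f := fun ν : ℂ => ((thetaPt δ τ (k : ℕ) + (j : ℕ) - ν, ν) : ℂ × ℂ)) ν hν (hd ν)
    filter_upwards [Filter.eventually_all.2 h1] with ν hν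
    exact differentiableAt_pi.2 fun k => differentiableAt_thetaCoef k (hν k)
  · intro hs z μ h
    have h1 : Tendsto Prod.snd (𝓝 ((z, μ) : ℂ × ℂ)) (𝓝 μ) := continuous_snd.tendsto _
    filter_upwards [h1.eventually (hs μ h)] with w hw
    have h2 : ∀ w : ℂ × ℂ, sliceVal L (pushVal (s (p₂ w.2))) w.2 rfl w.1 =
        ∑ k : Fin δ, hL.pushTriv hp₂ (p₂ w.2) w.2 rfl (s (p₂ w.2)) k *
          thetaFun δ τ (k : ℕ) (w.1 + w.2) := fun w => by
      rw [sliceVal_eq_thetaOf, hL.thetaOf_eq_sum hp₂]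
    rw [funext h2]
    refine DifferentiableAt.fun_sum fun k _ => DifferentiableAt.mul ?_ ?_
    · have h3 := differentiableAt_pi.1 hw k
      exact DifferentiableAt.comp
        (g := fun ν => hL.pushTriv hp₂ (p₂ ν) ν rfl (s (p₂ ν)) k) w h3 differentiableAt_snd
    · have h4 : DifferentiableAt ℂ (fun w : ℂ × ℂ => w.1 + w.2) w := by fun_prop
      exact DifferentiableAt.comp w (thetaFun_differentiable δ τ _ _) h4

/-- The trivialization of the push-forward by theta functions. -/
def IsThetaLift.lift (hL : IsThetaLift L) (hp₂ : IsCov p₂ Γ₂) :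
    LiftTriv (pushforward (pM δ τ) p₂ F) (Fin δ → ℂ) Γ₂ where
  T := hL.pushTriv hp₂
  deck l hl := by
    obtain ⟨m, hm, h1⟩ := L.deck (0, l) ⟨AddSubgroup.zero_mem _, hl⟩
    have hn : L.HasFactor (0, l) (fun w => m w 1) := fun x w h h' u => by
      rw [h1 x w h h' u]
      simpa [mul_comm] using (m w).map_smul (L.T x w h u) 1
    exact ⟨pushFactor δ τ (fun w => m w 1) l,
      differentiable_pushFactor (hm.clm_apply (differentiable_const _)) l,
      fun y μ h h' s => hL.pushTriv_add hp₂ hn y μ h h' s⟩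
  hol := hL.mem_hol_iff hp₂

/-- Completing the square in z₂. -/
theorem wtE_eq (z μ : ℂ) :
    wtE τ (z, μ) = Real.exp (2 * Real.pi / τ.im * μ.im ^ 2) * wt τ (z + μ) := by
  rw [wtE, wt, wt, ← Real.exp_add, ← Real.exp_add]
  congr 1
  simp
  ring

/-- By `wtE_eq` the integrand is a scalar in μ times the inner-product integrand shifted by μ, and
the shift does not change the integral. -/
theorem IsThetaLift.l2Metric_apply (hL : IsThetaLift L) (hp₂ : IsCov p₂ Γ₂)
    {h : ∀ x, F.Fib x → F.Fib x → ℂ} (hh : ∀ y w (hw : Prod.map (pM δ τ) p₂ w = y) u v,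
      h y u v = wtE τ w * stdForm (L.T y w hw u) (L.T y w hw v))
    (y : X₂) (μ : ℂ) (hμ : p₂ μ = y) (s t : (pushforward (pM δ τ) p₂ F).Fib y) :
    l2Metric (pM δ τ) p₂ F (fundPar δ τ) h y s t =
      (Real.exp (2 * Real.pi / τ.im * μ.im ^ 2) : ℝ) *
        coefForm δ τ ((hL.lift hp₂).T y μ hμ s) ((hL.lift hp₂).T y μ hμ t) := by
  have h1 : coefForm δ τ ((hL.lift hp₂).T y μ hμ s) ((hL.lift hp₂).T y μ hμ t) =
      thetaForm δ τ (hL.fibEquiv hp₂ y μ hμ s) (hL.fibEquiv hp₂ y μ hμ t) :=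
    coefForm_apply δ τ _ _
  rw [h1, ← thetaForm_translate _ _ μ, ← integral_const_mul]
  refine integral_congr_ae (Eventually.of_forall fun z => ?_)
  refine (hh (pM δ τ z, y) (z, μ) (Prod.ext rfl hμ) _ _).trans ?_
  rw [wtE_eq, Complex.ofReal_mul, mul_assoc]
  refine congrArg _ ?_
  simp only [thetaInt]
  rw [hL.fibEquiv_apply, hL.fibEquiv_apply, ← sliceVal_eq_thetaOf, ← sliceVal_eq_thetaOf]
  rfl

end Pushforward

/-! ### The bundles E and E', the isometry and the curvature -/

section Final

variable (δ : ℕ+) (τ : ℍ)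

theorem isThetaLift_liftEtilde : IsThetaLift (liftEtilde δ τ) := by
  intro a b
  have h := liftEtilde_factor δ τ a b 0 0
  have e : ((0 : ℤ) + (0 : ℤ) * (τ / (δ : ℕ)) : ℂ) = 0 := by simp
  rw [e] at h
  refine h.congr fun w => ?_
  rw [← Complex.exp_add]
  congr 1
  push_cast; ring

theorem isThetaLift_liftEtilde' : IsThetaLift (liftEtilde' δ τ) := by
  intro a b
  have h := liftEtilde'_factor δ τ a b 0 0
  have e : ((0 : ℤ) * (δ : ℕ) + (0 : ℤ) * τ : ℂ) = 0 := by simp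
  rw [e] at h
  refine h.congr fun w => ?_
  rw [← Complex.exp_add]
  congr 1
  push_cast; ring

/-- The trivialization of `E`. -/
def liftE : LiftTriv (EBundle δ τ) (Fin δ → ℂ) (latHat δ τ) :=
  (isThetaLift_liftEtilde δ τ).lift (isCov_pMhat δ τ)

/-- The trivialization of `E'`. -/
def liftE' : LiftTriv (EBundle' δ τ) (Fin δ → ℂ) (lat δ τ) :=
  (isThetaLift_liftEtilde' δ τ).lift (isCov_pM δ τ)

theorem hE_apply (q : Mhat δ τ) (μ : ℂ) (h : pMhat δ τ μ = q) (s t : (EBundle δ τ).Fib q) :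
    hE δ τ q s t = (Real.exp (2 * Real.pi / τ.im * μ.im ^ 2) : ℝ) *
      coefForm δ τ ((liftE δ τ).T q μ h s) ((liftE δ τ).T q μ h t) :=
  (isThetaLift_liftEtilde δ τ).l2Metric_apply (isCov_pMhat δ τ) (hEtilde_apply δ τ) q μ h s t

theorem hE'_apply {Ψ : HolIso (J δ τ) (phiP δ τ)} (hΨ : IsNormalized δ τ Ψ) (y : M δ τ) (μ : ℂ)
    (h : pM δ τ μ = y) (s t : (EBundle' δ τ).Fib y) :
    hE' δ τ Ψ y s t = (Real.exp (2 * Real.pi / τ.im * μ.im ^ 2) : ℝ) *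
      coefForm δ τ ((liftE' δ τ).T y μ h s) ((liftE' δ τ).T y μ h t) :=
  (isThetaLift_liftEtilde' δ τ).l2Metric_apply (isCov_pM δ τ) (hEtilde'_apply δ τ hΨ) y μ h s t

theorem contDiff_gauss (a : ℝ) : ContDiff ℝ ∞ fun w : ℂ => Real.exp (a * w.im ^ 2) := by
  have e1 : ContDiff ℝ ∞ fun w : ℂ => w.im := Complex.imCLM.contDiff
  fun_prop

theorem isHermitian_E :
    IsHolBundle (EBundle δ τ) δ ∧ IsHermMetric (EBundle δ τ) (hE δ τ) :=
  ⟨(liftE δ τ).isHolBundle (isCov_pMhat δ τ) (Module.finrank_fin_fun ℂ),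
    (liftE δ τ).isHermMetric (isCov_pMhat δ τ) (isPosHerm_coefForm δ τ) (contDiff_gauss _)
      (fun _ => Real.exp_pos _) (hE_apply δ τ)⟩

theorem isHermitian_E' {Ψ : HolIso (J δ τ) (phiP δ τ)} (hΨ : IsNormalized δ τ Ψ) :
    IsHolBundle (EBundle' δ τ) δ ∧ IsHermMetric (EBundle' δ τ) (hE' δ τ Ψ) :=
  ⟨(liftE' δ τ).isHolBundle (isCov_pM δ τ) (Module.finrank_fin_fun ℂ),
    (liftE' δ τ).isHermMetric (isCov_pM δ τ) (isPosHerm_coefForm δ τ) (contDiff_gauss _)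
      (fun _ => Real.exp_pos _) (hE'_apply δ τ hΨ)⟩

theorem pMhat_eq_φL₀ {y : M δ τ} {μ : ℂ} (h : pM δ τ μ = y) : pMhat δ τ μ = φL₀ δ τ y := by
  rw [← h, φL₀_pM]

/-- The trivialization of Ẽ' is that of Ẽ at the same point of ℂ × ℂ. -/
theorem sliceVal_Etilde' {y : M δ τ} (s : ∀ x, (Etilde' δ τ).Fib (x, y)) (μ : ℂ)
    (h : pM δ τ μ = y) (z : ℂ) : sliceVal (liftEtilde' δ τ) s μ h z =
      sliceVal (F := Etilde δ τ) (liftEtilde δ τ) (y := φL₀ δ τ y) s μ (pMhat_eq_φL₀ δ τ h) z := rfl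

/-- The sections of `Ẽ'` over `M × {y}` are those of `Ẽ` over `M × {φ_{L₀}(y)}`. -/
theorem liftE_eq_iff {y : M δ τ} (s : (EBundle' δ τ).Fib y) (t : (EBundle δ τ).Fib (φL₀ δ τ y))
    (μ : ℂ) (h : pM δ τ μ = y) :
    (liftE δ τ).T (φL₀ δ τ y) μ (pMhat_eq_φL₀ δ τ h) t = (liftE' δ τ).T y μ h s ↔
      ∀ x, pushVal (F := Etilde δ τ) t x = pushVal (F := Etilde' δ τ) s x := by
  have e1 : (liftE δ τ).T (φL₀ δ τ y) μ (pMhat_eq_φL₀ δ τ h) t = thetaCoef δ τ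
      (thetaOf (liftEtilde δ τ) (pushVal t) μ (pMhat_eq_φL₀ δ τ h)) := rfl
  have e2 : (liftE' δ τ).T y μ h s = thetaCoef δ τ
      (thetaOf (liftEtilde' δ τ) (pushVal s) μ h) := rfl
  rw [e1, e2]
  constructor
  · intro h1
    refine congrFun (sliceVal_injective (liftEtilde δ τ) (F := Etilde δ τ) (μ := μ)
      (h := pMhat_eq_φL₀ δ τ h) (t := fun x => pushVal (F := Etilde' δ τ) s x) fun z => ?_)
    refine Eq.trans ?_ (sliceVal_Etilde' δ τ (pushVal s) μ h z)
    rw [sliceVal_eq_thetaOf, sliceVal_eq_thetaOf,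
      thetaCoef_spec ((isThetaLift_liftEtilde δ τ).thetaOf_mem (isCov_pMhat δ τ) t μ
        (pMhat_eq_φL₀ δ τ h)),
      thetaCoef_spec ((isThetaLift_liftEtilde' δ τ).thetaOf_mem (isCov_pM δ τ) s μ h), h1]
  · intro h1
    congr 1
    funext z
    refine Eq.trans ?_ (sliceVal_Etilde' δ τ (pushVal s) μ h (z - μ)).symm
    exact congrArg (fun s => sliceVal (liftEtilde δ τ) s μ (pMhat_eq_φL₀ δ τ h) (z - μ))
      (funext h1)

/-- The identity on the sections over `M × {y}`. -/
def fibE (y : M δ τ) : (EBundle' δ τ).Fib y ≃ₗ[ℂ] (EBundle δ τ).Fib (φL₀ δ τ y) :=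
  ((liftE' δ τ).T y (Function.surjInv (pM_surj δ τ) y) (Function.surjInv_eq _ y)).trans
    ((liftE δ τ).T (φL₀ δ τ y) (Function.surjInv (pM_surj δ τ) y)
      (pMhat_eq_φL₀ δ τ (Function.surjInv_eq _ y))).symm

theorem pushVal_fibE (y : M δ τ) (s : (EBundle' δ τ).Fib y) (x : M δ τ) :
    pushVal (F := Etilde δ τ) (fibE δ τ y s) x = pushVal (F := Etilde' δ τ) s x := by
  refine (liftE_eq_iff δ τ s (fibE δ τ y s) (Function.surjInv (pM_surj δ τ) y)
    (Function.surjInv_eq _ y)).1 ?_ x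
  simp [fibE]

theorem liftE_fibE (y : M δ τ) (s : (EBundle' δ τ).Fib y) (μ : ℂ) (h : pM δ τ μ = y) :
    (liftE δ τ).T (φL₀ δ τ y) μ (pMhat_eq_φL₀ δ τ h) (fibE δ τ y s) = (liftE' δ τ).T y μ h s :=
  (liftE_eq_iff δ τ s (fibE δ τ y s) μ h).2 (pushVal_fibE δ τ y s)

theorem exists_mem_latHat (l : ℂ) (hl : l ∈ lat δ τ) :
    ∃ k ∈ latHat δ τ, ∀ w, id (w + l) = id w + k :=
  ⟨l, lat_le_latHat δ τ hl, fun _ => rfl⟩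

/-- The isomorphism `E' ≅ φ_{L₀}^* E`. -/
def isoE : HolIso (EBundle' δ τ) (pullback (pM δ τ) (φL₀ δ τ) (EBundle δ τ)) :=
  (liftE' δ τ).isoOfMul ((liftE δ τ).pullback (isCov_pMhat δ τ) (isCov_pM δ τ) (φL₀ δ τ) id
    (fun _ => pMhat_eq_φL₀ δ τ rfl) differentiable_id (exists_mem_latHat δ τ))
    (fibE δ τ) 1 (differentiable_const _) (fun _ => one_ne_zero)
    (fun y μ h s => (liftE_fibE δ τ y s μ h).trans (one_smul ℂ _).symm)

theorem isIsometry_isoE {Ψ : HolIso (J δ τ) (phiP δ τ)} (hΨ : IsNormalized δ τ Ψ) :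
    (isoE δ τ).IsIsometry (hE' δ τ Ψ) (fun y => hE δ τ (φL₀ δ τ y)) := by
  intro y s t
  obtain ⟨μ, h⟩ := pM_surj δ τ y
  refine (hE_apply δ τ (φL₀ δ τ y) μ (pMhat_eq_φL₀ δ τ h) (fibE δ τ y s) (fibE δ τ y t)).trans ?_
  rw [hE'_apply δ τ hΨ y μ h, liftE_fibE, liftE_fibE]

/-- Both curvatures are the same scalar, determined by the common weight exp(2πμ₂²/τ₂), and a scalar
commutes with `fibE`. -/
theorem curvature_fibE {Ψ : HolIso (J δ τ) (phiP δ τ)} (hΨ : IsNormalized δ τ Ψ) (y : M δ τ)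
    (v v' : ℂ) (s : (EBundle' δ τ).Fib y) :
    fibE δ τ y (curvature (hE' δ τ Ψ) y v v' s) =
      curvature (hE δ τ) (φL₀ δ τ y) v v' (fibE δ τ y s) := by
  rw [(liftE' δ τ).curvature_eq (isCov_pM δ τ) (isPosHerm_coefForm δ τ) (hE'_apply δ τ hΨ),
    (liftE δ τ).curvature_eq (isCov_pMhat δ τ) (isPosHerm_coefForm δ τ) (hE_apply δ τ)]
  simp

end Final

end ThetaTorus

end

theorem mainTheorem9 (δ : ℕ+) (τ : ℍ) :
    -- `P` is the Poincaré line bundle, and there is a normalized description by multipliers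
    IsPoincare δ τ (PBundle δ τ) ∧
    (∃ Ψ : HolIso (J δ τ) (phiP δ τ), IsNormalized δ τ Ψ) ∧
    ∀ Ψ : HolIso (J δ τ) (phiP δ τ), IsNormalized δ τ Ψ →
      -- `Ẽ` and `Ẽ'` are Hermitian holomorphic line bundles
      (IsHolBundle (Etilde δ τ) 1 ∧ IsHermMetric (Etilde δ τ) (hEtilde δ τ)) ∧
      (IsHolBundle (Etilde' δ τ) 1 ∧ IsHermMetric (Etilde' δ τ) (hEtilde' δ τ Ψ)) ∧
      -- `(Ẽ', h_Ẽ') = (Id × φ_{L₀})^* (Ẽ, h_Ẽ)`, with the identity on the fibres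
      (∃ F : HolIso (Etilde' δ τ) (pullback (pMM δ τ) (IdPhi δ τ) (Etilde δ τ)),
        (∀ (y : M δ τ × M δ τ) (u : (Etilde' δ τ).Fib y), F.toEquiv y u = u) ∧
        F.IsIsometry (hEtilde' δ τ Ψ) (fun y => hEtilde δ τ (IdPhi δ τ y))) ∧
      -- `E` and `E'` are Hermitian holomorphic vector bundles of rank `δ`
      (IsHolBundle (EBundle δ τ) δ ∧ IsHermMetric (EBundle δ τ) (hE δ τ)) ∧
      (IsHolBundle (EBundle' δ τ) δ ∧ IsHermMetric (EBundle' δ τ) (hE' δ τ Ψ)) ∧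
      -- `(E', h_E') = φ_{L₀}^* (E, h_E)`, with the identity on the sections over `M × {y}`
      ∃ Φ : HolIso (EBundle' δ τ) (pullback (pM δ τ) (φL₀ δ τ) (EBundle δ τ)),
        (∀ (y : M δ τ) (s : (EBundle' δ τ).Fib y) (x : M δ τ),
          (show (EBundle δ τ).Fib (φL₀ δ τ y) from Φ.toEquiv y s).1 x = s.1 x) ∧
        Φ.IsIsometry (hE' δ τ Ψ) (fun y => hE δ τ (φL₀ δ τ y)) ∧
        -- `Θ(E') = φ_{L₀}^* Θ(E)`, where the linear lift `φt` of `φ_{L₀}` is its differential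
        ∃ φt : ℂ →L[ℂ] ℂ, (∀ μ, φL₀ δ τ (pM δ τ μ) = pMhat δ τ (φt μ)) ∧
          ∀ (y : M δ τ) (v v' : ℂ) (s : (EBundle' δ τ).Fib y),
            Φ.toEquiv y (curvature (hE' δ τ Ψ) y v v' s) =
              curvature (hE δ τ) (φL₀ δ τ y) (φt v) (φt v') (Φ.toEquiv y s) :=
  ⟨isPoincare_PBundle δ τ, exists_isNormalized δ τ, fun _ hΨ =>
    ⟨isHermitian_Etilde δ τ, isHermitian_Etilde' δ τ hΨ,
      ⟨isoEtilde δ τ, fun _ _ => rfl, isIsometry_isoEtilde δ τ hΨ⟩,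
      isHermitian_E δ τ, isHermitian_E' δ τ hΨ,
      isoE δ τ, pushVal_fibE δ τ, isIsometry_isoE δ τ hΨ,
      -- The linear lift of `φL₀` is the identity, since M and M̂ are quotients of the same ℂ in
      -- these coordinates.
      ContinuousLinearMap.id ℂ ℂ, φL₀_pM δ τ, curvature_fibE δ τ hΨ⟩⟩
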